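/- **Setting.** A compositional workflow is built from single steps and single release points by serial composition $G_1;G_2$, parallel branching $G_1\parallel G_2$ and xor branching $G_1\otimes G_2$ (disjoint vertex sets); $S$, $R$, $\mathcal B$ denote its sets of steps, release points and xor branchings. Its finite set $\Sigma$ of execution sequences is defined recursively: $\{(v)\}$ for a single vertex, all concatenations for $;$, all interleavings for $\parallel$, the union for $\otimes$. A schema $W$ adds a finite set $U$ of users, a policy $A\subseteq S\times U$ in which every step has an authorized user, and finitely many constraints $c=(T,\Theta,P)$ with $T\subseteq S$ containing no two exclusive steps, $\Theta\subseteq U^T$, $P\subseteq R$. In an execution sequence $\sigma$ the release points of $P$ cut $T\cap S(\sigma)$ into subscopes $T_0,\dots,T_q$ (here $S(\sigma)$ is the set of steps in $\sigma$), and a plan $\pi:S(\sigma)\to U$ satisfies $c$ if $\pi|_{T_i}\in\Theta|_{T_i}$ for all $i$. The cost is $w(\sigma,\pi)=\sum_c w_c(\sigma,\pi)+\sum_{u\in U}\omega(\pi^{-1}(u),u)$ with integer weights, where $w_c(\sigma,\pi)$ is $0$ if $\pi$ satisfies $c$ and positive otherwise, and depends on $\sigma$ only through the subscopes of $c$; and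 $\omega(T',u)$ is $0$ if $u$ is authorized for all steps in $T'$ and positive otherwise. The frequency distribution on $\Sigma$ is uniform, $f(\sigma)=1/|\Sigma|$. *Bounded Expected Cost WSP*: given $W$ and a budget $B\ge 0$, are there plans $\pi_\sigma:S(\sigma)\to U$ ($\sigma\in\Sigma$) with $\sum_{\sigma\in\Sigma} f(\sigma)w(\sigma,\pi_\sigma)\le B$? *Approximate BC-WSP*: given $W$, $B\ge 0$ and $p\in[0,1]$, is $\sum_{\sigma\in\Sigma_B}f(\sigma)\ge p$, where $\Sigma_B$ is the set of $\sigma\in\Sigma$ having a plan of cost at most $B$? Two execution sequences are equivalent if they have the same sequence of release points, the same set of steps, and every step has the same set of release points to its right. The equivalence classes are the execution arrangements. **Theorem.** (1) Let $X_1,\dots,X_N$ be the execution arrangements of $W$ and $a_i=|X_i|$. For every $i$, the minimum of $w(\sigma,\pi)$ over the plans $\pi:S(\sigma)\to U$ is the same number $w_i^\star$ for all $\sigma\in X_i$. For all real $B\ge0$ and $p\in[0,1]$, $W$ with budget $B$ is a yes-instance of Bounded Expected Cost WSP if and only if $$\frac{\sum_{i=1}^N a_iw_i^\star}{\sum_{i=1}^N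 a_i}\le B,$$ and $W$ with $B$ and $p$ is a yes-instance of Approximate BC-WSP if and only if $$\frac{\sum_{i:\,w_i^\star\le B}a_i}{\sum_{i=1}^N a_i}\ge p.$$ (2) Assume that all weighted constraints are user-independent ($\Theta$ and $w_c$ do not change under permutations of $U$), that $B$ and $p$ are rational, and that the weights $w_c$ and $\omega$ can be evaluated in time polynomial in the size of the instance per call. Then Bounded Expected Cost WSP and Approximate BC-WSP can each be solved in time $$\mathcal O^*\bigl(2^{|\mathcal B|}\,|R|!\,(|R|+1)^{|S|}\,|S|^{|S|}\bigr),$$ the running time obtained for Bounded Cost WSP (the question whether every $\sigma\in\Sigma$ has a plan of cost at most $B$), where $\mathcal O^*$ hides factors polynomial in the size of the instance. In particular both problems are fixed-parameter tractable when parameterized by $|S|+|R|+|\mathcal B|$. -/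

import Mathlib

/-! Compositional workflows, valued constraints with release points, the problems
BEC-WSP and Approximate BC-WSP, and a step-counting machine model. -/

namespace WSP

/-! ## Compositional workflows -/

/-- Compositional workflow specifications, as expressions built from single steps and single
release points by serial composition, parallel branching and xor branching. -/
inductive Workflow (S R : Type*) where
  | step (s : S)
  | release (r : R)
  | seq (G₁ G₂ : Workflow S R)
  | par (G₁ G₂ : Workflow S R)
  | xor (G₁ G₂ : Workflow S R)

namespace Workflow

variable {S R : Type*}

/-- All (occurrences of) steps and release points of a workflow. -/
def vertices : Workflow S R → List (S ⊕ R)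
  | step s => [Sum.inl s]
  | release r => [Sum.inr r]
  | seq G₁ G₂ => G₁.vertices ++ G₂.vertices
  | par G₁ G₂ => G₁.vertices ++ G₂.vertices
  | xor G₁ G₂ => G₁.vertices ++ G₂.vertices

/-- The number of xor branchings. -/
def numXor : Workflow S R → ℕ
  | step _ => 0
  | release _ => 0
  | seq G₁ G₂ => G₁.numXor + G₂.numXor
  | par G₁ G₂ => G₁.numXor + G₂.numXor
  | xor G₁ G₂ => G₁.numXor + G₂.numXor + 1

/-- `v` and `v'` lie in different branches of some xor branching. -/
def Exclusive (v v' : S ⊕ R) : Workflow S R → Prop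
  | step _ => False
  | release _ => False
  | seq G₁ G₂ => G₁.Exclusive v v' ∨ G₂.Exclusive v v'
  | par G₁ G₂ => G₁.Exclusive v v' ∨ G₂.Exclusive v v'
  | xor G₁ G₂ => G₁.Exclusive v v' ∨ G₂.Exclusive v v' ∨
      (v ∈ G₁.vertices ∧ v' ∈ G₂.vertices) ∨ (v ∈ G₂.vertices ∧ v' ∈ G₁.vertices)

end Workflow

/-- All interleavings of two sequences that preserve the order inside each of them. -/
def interleavings {α : Type*} : List α → List α → List (List α)
  | [], l' => [l']
  | l, [] => [l]
  | a :: l, b :: l' =>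
      (interleavings l (b :: l')).map (a :: ·) ++ (interleavings (a :: l) l').map (b :: ·)
  termination_by l l' => l.length + l'.length

/-- The set of execution sequences of a compositional workflow. -/
def Workflow.execSeqs {S R : Type*} [DecidableEq S] [DecidableEq R] :
    Workflow S R → Finset (List (S ⊕ R))
  | .step s => {[Sum.inl s]}
  | .release r => {[Sum.inr r]}
  | .seq G₁ G₂ => Finset.image₂ (· ++ ·) G₁.execSeqs G₂.execSeqs
  | .par G₁ G₂ =>
      (G₁.execSeqs ×ˢ G₂.execSeqs).biUnion fun x => (interleavings x.1 x.2).toFinset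
  | .xor G₁ G₂ => G₁.execSeqs ∪ G₂.execSeqs

/-! ## Plans and weighted constraints with release points -/

/-- A (partial) plan, i.e. a function from a subset of `S` to `U`; it takes the value `none`
outside that subset. -/
abbrev Plan (S U : Type*) := S → Option U

/-- The domain of a partial plan. -/
def Plan.dom {S U : Type*} (π : Plan S U) : Set S := {s | (π s).isSome}

/-- The restriction of a partial plan to a set of steps. -/
def Plan.restrict {S U : Type*} [DecidableEq S] (T : Finset S) (π : Plan S U) : Plan S U :=
  fun s => if s ∈ T then π s else none

/-- The composition of a permutation of the users with a partial plan. -/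
def Plan.permute {S U : Type*} (φ : Equiv.Perm U) (π : Plan S U) : Plan S U :=
  fun s => (π s).map φ

/-- A constraint `(T, Θ, P)` with release points, together with its weight function.  An execution
sequence cuts the scope `T` into subscopes `T₀, …, T_q` and thereby replaces the constraint by its
restrictions `(Tᵢ, Θ|Tᵢ)`; the weight of a plan is `0` if the plan satisfies all of them and is
positive otherwise. -/
structure WeightedConstraint (S R U : Type*) [DecidableEq S] where
  scope : Finset S
  releases : Finset R
  family : Set (Plan S U)
  dom_family : ∀ θ ∈ family, θ.dom = ↑scope
  weight : List (Finset S) → Plan S U → ℕ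
  weight_eq_zero_iff : ∀ (Ts : List (Finset S)) (π : Plan S U),
    (∀ T ∈ Ts, T ⊆ scope ∧ ↑T ⊆ π.dom) →
      (weight Ts π = 0 ↔ ∀ T ∈ Ts, π.restrict T ∈ Plan.restrict T '' family)

namespace WeightedConstraint

variable {S R U : Type*} [DecidableEq S]

/-- The subscopes `T₀, …, T_q`: the steps of the scope before the first, between consecutive, and
after the last of the release points of the constraint that occur in `σ`. -/
def subscopes [DecidableEq R] (c : WeightedConstraint S R U) (σ : List (S ⊕ R)) :
    List (Finset S) :=
  (σ.splitOnP fun v => v.elim (fun _ => false) fun r => decide (r ∈ c.releases)).map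
    fun l => c.scope ∩ (l.filterMap Sum.getLeft?).toFinset

/-- The weighted constraint is user-independent: neither its family nor its weights change when
the users are permuted. -/
def UserIndependent (c : WeightedConstraint S R U) : Prop :=
  (∀ θ ∈ c.family, ∀ φ : Equiv.Perm U, θ.permute φ ∈ c.family) ∧
  ∀ (Ts : List (Finset S)) (π : Plan S U), (∀ T ∈ Ts, T ⊆ c.scope ∧ ↑T ⊆ π.dom) →
    ∀ φ : Equiv.Perm U, c.weight Ts (π.permute φ) = c.weight Ts π

end WeightedConstraint

/-- A constrained compositional workflow schema with steps `S`, release points `R`, users `U`, and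
with weights for its constraints and for its authorization policy.  Every step and every release
point occurs exactly once in the workflow.  The number `authWeight T u` is the cost of having user
`u` perform exactly the steps of `T`. -/
structure Schema (S R U : Type*) [DecidableEq S] where
  workflow : Workflow S R
  nodup_vertices : workflow.vertices.Nodup
  mem_vertices : ∀ v, v ∈ workflow.vertices
  auth : Finset (S × U)
  exists_auth : ∀ s, ∃ u, (s, u) ∈ auth
  constraints : List (WeightedConstraint S R U)
  not_exclusive : ∀ c ∈ constraints, ∀ s ∈ c.scope, ∀ s' ∈ c.scope,
    ¬ workflow.Exclusive (Sum.inl s) (Sum.inl s')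
  authWeight : Finset S → U → ℕ
  authWeight_eq_zero_iff : ∀ T u, authWeight T u = 0 ↔ ∀ s ∈ T, (s, u) ∈ auth

/-- `π` is a plan `S(σ) → U`. -/
def IsPlanFor {S R U : Type*} (σ : List (S ⊕ R)) (π : Plan S U) : Prop :=
  π.dom = {s | Sum.inl s ∈ σ}

namespace Schema

section

variable {S R U : Type*} [Fintype S] [Fintype U] [DecidableEq S] [DecidableEq R] [DecidableEq U]
  (W : Schema S R U)

/-- The cost `w(σ, π)`: the sum of all constraint weights and the authorization weight. -/
def cost (σ : List (S ⊕ R)) (π : Plan S U) : ℕ :=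
  (W.constraints.map fun c => c.weight (c.subscopes σ) π).sum +
    ∑ u : U, W.authWeight (Finset.univ.filter fun s => π s = some u) u

/-- The set of execution sequences of the schema. -/
def execSeqs : Finset (List (S ⊕ R)) := W.workflow.execSeqs

/-- The uniform frequency distribution on the execution sequences. -/
noncomputable def uniformFreq (_σ : List (S ⊕ R)) : ℝ := 1 / (W.execSeqs.card : ℝ)

/-- The relative cost of `(σ, π)` with respect to a frequency distribution `f`. -/
noncomputable def relativeCost (f : List (S ⊕ R) → ℝ) (σ : List (S ⊕ R)) (π : Plan S U) : ℝ :=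
  f σ * (W.cost σ π : ℝ)

/-- Bounded expected cost: there is a choice of one plan for every execution sequence whose
relative costs sum up to at most the budget. -/
def BoundedExpectedCost (f : List (S ⊕ R) → ℝ) (B : ℝ) : Prop :=
  ∃ π : List (S ⊕ R) → Plan S U, (∀ σ ∈ W.execSeqs, IsPlanFor σ (π σ)) ∧
    ∑ σ ∈ W.execSeqs, W.relativeCost f σ (π σ) ≤ B

open Classical in
/-- The set of execution sequences that have a plan of cost at most `B`. -/
noncomputable def withinBudget (B : ℝ) : Finset (List (S ⊕ R)) :=
  W.execSeqs.filter fun σ => ∃ π : Plan S U, IsPlanFor σ π ∧ (W.cost σ π : ℝ) ≤ B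

/-- The schema has probability `p` of completing within budget `B`. -/
def CompletesWithinBudget (f : List (S ⊕ R) → ℝ) (B p : ℝ) : Prop :=
  p ≤ ∑ σ ∈ W.withinBudget B, f σ

end

end Schema

/-! ## Execution arrangements -/

section

variable {S R : Type*} [DecidableEq S] [DecidableEq R]

/-- The sequence of release points of `σ`. -/
def releaseSeq (σ : List (S ⊕ R)) : List R := σ.filterMap Sum.getRight?

/-- The part of `σ` to the right of the vertex `v`. -/
def rightOf (σ : List (S ⊕ R)) (v : S ⊕ R) : List (S ⊕ R) :=
  (σ.dropWhile fun v' => decide (v' ≠ v)).tail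

/-- Equivalence of execution sequences: the same sequence of release points, the same set of steps,
and every step has the same set of release points to its right. -/
def SeqEquiv (σ σ' : List (S ⊕ R)) : Prop :=
  releaseSeq σ = releaseSeq σ' ∧
  (∀ s : S, Sum.inl s ∈ σ ↔ Sum.inl s ∈ σ') ∧
  ∀ s : S, Sum.inl s ∈ σ →
    ∀ r : R, Sum.inr r ∈ rightOf σ (Sum.inl s) ↔ Sum.inr r ∈ rightOf σ' (Sum.inl s)

open Classical in
/-- The execution arrangements of a schema, i.e. the equivalence classes of its execution
sequences. -/
noncomputable def Schema.arrangements {U : Type*} (W : Schema S R U) :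
    Finset (Finset (List (S ⊕ R))) :=
  W.execSeqs.image fun σ => W.execSeqs.filter fun σ' => SeqEquiv σ σ'

end

/-! ## The machine model

Programs of a small while-language work on binary trees with natural numbers at the leaves.  Trees
are pointer structures, so that forming a pair and selecting a component take one step each, whereas
arithmetic is charged by the bit lengths of its operands.  A program may also call a subroutine
`O`; every call costs `κ` plus the size of the argument. -/

/-- Data: binary trees with natural numbers at the leaves. -/
inductive Val where
  | nat (n : ℕ)
  | pair (a b : Val)
  deriving DecidableEq

namespace Val

/-- The size of a tree: the number of nodes plus the total bit length of the numbers. -/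
def size : Val → ℕ
  | nat n => 1 + Nat.size n
  | pair a b => 1 + a.size + b.size

def fst : Val → Val
  | nat _ => nat 0
  | pair a _ => a

def snd : Val → Val
  | nat _ => nat 0
  | pair _ b => b

/-- The number at a leaf (`0` for a pair). -/
def num : Val → ℕ
  | nat n => n
  | pair _ _ => 0

/-- `1` for a pair and `0` for a leaf. -/
def isPair : Val → ℕ
  | nat _ => 0
  | pair _ _ => 1

/-- Lists as right-nested pairs that end in the leaf `0`. -/
def ofList : List Val → Val
  | [] => nat 0
  | a :: l => pair a (ofList l)

def toList : Val → List Val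
  | nat _ => []
  | pair a b => a :: b.toList

end Val

/-- Programs.  A binary arithmetic operation is applied to the two components of a pair. -/
inductive Prog where
  | const (n : ℕ)
  | id
  | fst
  | snd
  | isPair
  | add
  | sub
  | mul
  | le
  | call
  | pair (P Q : Prog)
  | comp (Q P : Prog)
  | ite (C P Q : Prog)
  | loop (C P : Prog)

/-- `Run O κ P v w t`: with subroutine `O` and cost `κ` per call, the program `P` halts on input
`v` with output `w` after exactly `t` steps. -/
inductive Run (O : Val → ℕ) (κ : ℕ) : Prog → Val → Val → ℕ → Prop where
  | const (n : ℕ) (v : Val) : Run O κ (.const n) v (.nat n) 1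
  | id (v : Val) : Run O κ .id v v 1
  | fst (v : Val) : Run O κ .fst v v.fst 1
  | snd (v : Val) : Run O κ .snd v v.snd 1
  | isPair (v : Val) : Run O κ .isPair v (.nat v.isPair) 1
  | add (v : Val) : Run O κ .add v (.nat (v.fst.num + v.snd.num))
      (1 + Nat.size v.fst.num + Nat.size v.snd.num)
  | sub (v : Val) : Run O κ .sub v (.nat (v.fst.num - v.snd.num))
      (1 + Nat.size v.fst.num + Nat.size v.snd.num)
  | mul (v : Val) : Run O κ .mul v (.nat (v.fst.num * v.snd.num))
      (1 + Nat.size v.fst.num * Nat.size v.snd.num)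
  | le (v : Val) : Run O κ .le v (.nat (if v.fst.num ≤ v.snd.num then 1 else 0))
      (1 + Nat.size v.fst.num + Nat.size v.snd.num)
  | call (v : Val) : Run O κ .call v (.nat (O v)) (1 + κ + v.size)
  | pair {P Q : Prog} {v a b : Val} {s t : ℕ} :
      Run O κ P v a s → Run O κ Q v b t → Run O κ (.pair P Q) v (.pair a b) (1 + s + t)
  | comp {P Q : Prog} {v a b : Val} {s t : ℕ} :
      Run O κ P v a s → Run O κ Q a b t → Run O κ (.comp Q P) v b (1 + s + t)
  | iteTrue {C P Q : Prog} {v c w : Val} {s t : ℕ} :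
      Run O κ C v c s → c.num ≠ 0 → Run O κ P v w t → Run O κ (.ite C P Q) v w (1 + s + t)
  | iteFalse {C P Q : Prog} {v c w : Val} {s t : ℕ} :
      Run O κ C v c s → c.num = 0 → Run O κ Q v w t → Run O κ (.ite C P Q) v w (1 + s + t)
  | loopDone {C P : Prog} {v c : Val} {s : ℕ} :
      Run O κ C v c s → c.num = 0 → Run O κ (.loop C P) v v (1 + s)
  | loopStep {C P : Prog} {v c v' w : Val} {s t r : ℕ} :
      Run O κ C v c s → c.num ≠ 0 → Run O κ P v v' t → Run O κ (.loop C P) v' w r →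
      Run O κ (.loop C P) v w (1 + s + t + r)

/-! ## Schemas as inputs of programs -/

/-- A finite schema whose steps, release points and users are numbered, and all of whose weighted
constraints are user-independent. -/
structure CCWS where
  numSteps : ℕ
  numReleases : ℕ
  numUsers : ℕ
  schema : Schema (Fin numSteps) (Fin numReleases) (Fin numUsers)
  userIndependent : ∀ c ∈ schema.constraints, c.UserIndependent

/-- A workflow in reverse Polish notation. -/
def Workflow.code {k m : ℕ} : Workflow (Fin k) (Fin m) → List Val
  | .step s => [.pair (.nat 0) (.nat s)]
  | .release r => [.pair (.nat 1) (.nat r)]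
  | .seq G₁ G₂ => G₁.code ++ G₂.code ++ [.nat 0]
  | .par G₁ G₂ => G₁.code ++ G₂.code ++ [.nat 1]
  | .xor G₁ G₂ => G₁.code ++ G₂.code ++ [.nat 2]

/-- A set of numbers, as an increasing list. -/
def codeFinset {n : ℕ} (T : Finset (Fin n)) : Val :=
  .ofList (((List.finRange n).filter fun i => decide (i ∈ T)).map fun i => .nat i)

/-- An authorization policy, as a list of pairs. -/
def codeAuth {k n : ℕ} (A : Finset (Fin k × Fin n)) : Val :=
  .ofList ((((List.finRange k).product (List.finRange n)).filter fun x => decide (x ∈ A)).map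
    fun x => .pair (.nat x.1) (.nat x.2))

namespace CCWS

/-- The encoding of a schema: the workflow, the list of users, the authorization policy, and the
scope and the release points of every constraint.  Weights are not part of it: they are accessed
through the subroutine `weightOracle`. -/
def code (I : CCWS) : Val :=
  .ofList [
    .ofList I.schema.workflow.code,
    .ofList ((List.finRange I.numUsers).map fun u => .nat u),
    codeAuth I.schema.auth,
    .ofList (I.schema.constraints.map fun c => .pair (codeFinset c.scope) (codeFinset c.releases))]

/-- The set of steps whose numbers occur in a list. -/
def decodeSteps {k : ℕ} (v : Val) : Finset (Fin k) :=
  Finset.univ.filter fun s => Val.nat s ∈ v.toList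

/-- The partial plan given by a list of pairs (step, user). -/
def decodePlan {k n : ℕ} (v : Val) : Plan (Fin k) (Fin n) :=
  fun s => (List.finRange n).find? fun u => decide (Val.pair (.nat s) (.nat u) ∈ v.toList)

/-- The subroutine that evaluates weights.  The argument `(0, (j, (Ts, π)))` asks for the weight of
the `j`-th constraint with subscopes `Ts` at the partial plan `π`; the argument `(1, (T, u))` asks
for the cost of having user `u` perform the steps of `T`. -/
def weightOracle (I : CCWS) : Val → ℕ
  | .pair (.nat 0) (.pair (.nat j) (.pair Ts π)) =>
      match I.schema.constraints[j]? with
      | some c => c.weight (Ts.toList.map decodeSteps) (decodePlan π)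
      | none => 0
  | .pair (.nat 1) (.pair T (.nat u)) =>
      if h : u < I.numUsers then I.schema.authWeight (decodeSteps T) ⟨u, h⟩ else 0
  | _ => 0

/-- All weights have at most `κ` bits. -/
def WeightBitsLE (I : CCWS) (κ : ℕ) : Prop :=
  (∀ c ∈ I.schema.constraints, ∀ (Ts : List (Finset (Fin I.numSteps)))
    (π : Plan (Fin I.numSteps) (Fin I.numUsers)), (∀ T ∈ Ts, T ⊆ c.scope ∧ ↑T ⊆ π.dom) →
      Nat.size (c.weight Ts π) ≤ κ) ∧
  ∀ T u, Nat.size (I.schema.authWeight T u) ≤ κ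

/-- The number of xor branchings. -/
def numXor (I : CCWS) : ℕ := I.schema.workflow.numXor

/-- The parameter: the number of steps, release points and xor branchings. -/
def parameter (I : CCWS) : ℕ := I.numSteps + I.numReleases + I.numXor

/-- The non-polynomial factor `2^|ℬ| |R|! (|R|+1)^|S| |S|^|S|`. -/
def timeFactor (I : CCWS) : ℕ :=
  2 ^ I.numXor * Nat.factorial I.numReleases * (I.numReleases + 1) ^ I.numSteps *
    I.numSteps ^ I.numSteps

end CCWS

/-! ## Decision problems -/

/-- A decision problem on schemas, whose instances carry additional numerical input. -/
structure DecisionProblem where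
  Input : Type
  codeInput : Input → Val
  IsYes : CCWS → Input → Prop

def codeNNRat (q : NNRat) : Val := .pair (.nat q.num) (.nat q.den)

/-- Bounded Expected Cost WSP; the additional input is the budget. -/
noncomputable def becWSP : DecisionProblem where
  Input := NNRat
  codeInput := codeNNRat
  IsYes I B := I.schema.BoundedExpectedCost I.schema.uniformFreq (B : ℝ)

/-- Approximate BC-WSP; the additional input is the budget and the probability. -/
noncomputable def approxBCWSP : DecisionProblem where
  Input := NNRat × {p : NNRat // p ≤ 1}
  codeInput x := .pair (codeNNRat x.1) (codeNNRat x.2)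
  IsYes I x := I.schema.CompletesWithinBudget I.schema.uniformFreq (x.1 : ℝ) ((x.2 : NNRat) : ℝ)

namespace DecisionProblem

/-- The encoding of an instance. -/
def codeInstance (D : DecisionProblem) (I : CCWS) (x : D.Input) : Val :=
  .pair I.code (D.codeInput x)

/-- The problem can be solved in time `O*(T)`: there is one program that decides all instances such
that, whenever the weights are evaluated in time `q(n)` per call with `q` a polynomial and `n` the
size of the instance, its running time is at most `T` times a polynomial of `n`. -/
def SolvableInOStar (D : DecisionProblem) (T : CCWS → ℕ) : Prop :=
  ∃ P : Prog, ∀ q : Polynomial ℕ, ∃ p : Polynomial ℕ, ∀ (I : CCWS) (x : D.Input),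
    I.WeightBitsLE (q.eval (D.codeInstance I x).size) →
      ∃ (b : Bool) (t : ℕ),
        Run I.weightOracle (q.eval (D.codeInstance I x).size) P (D.codeInstance I x)
          (.nat b.toNat) t ∧
        (b = true ↔ D.IsYes I x) ∧
        t ≤ T I * p.eval (D.codeInstance I x).size

/-- The problem is fixed-parameter tractable with respect to the parameter `κ`. -/
def IsFPT (D : DecisionProblem) (κ : CCWS → ℕ) : Prop :=
  ∃ f : ℕ → ℕ, Computable f ∧ D.SolvableInOStar fun I => f (κ I)

end DecisionProblem

end WSP

/-!
The characterizations by execution arrangements rest on one observation. Let `σ` and `σ'` be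
equivalent execution sequences. The index of the subscope of a constraint that contains a step `s`
is determined by the number of release points of the constraint to the right of `s`
(`mem_splitOnP_getElem_iff`), so `σ` and `σ'` have the same subscopes and the same plans, and plans
have the same cost for both. The minimum cost `Schema.minCost` is thus constant on every execution
arrangement (`Schema.minCost_eq_of_seqEquiv`). As the plans of different execution sequences are
chosen independently, the least expected cost is the average of the minimum costs, and both problems
become statements about sums over the arrangements (`arrangement_formulas`).

For the running times, a program of the machine model has to be exhibited. It is written in a small
total language with a fold over lists, `Exp`, whose compilation to machine programs is correct with
an exact running time (`Exp.run_compile`). The statements `Exp.Ev O κ e v w t` (the expression `e`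
evaluates to `w` in the environment `v` within `t` steps) are built up compositionally. All
polynomial factors are expressed by powers of a number `N ≥ 1000` that bounds the size of the input
and the cost and the bit length of the weights (`CCWS.Fits`); constant factors are absorbed by
raising the exponent.

* All execution sequences are listed. Their number is at most `2 ^ |ℬ| * (|S| + |R|)!`
  (`Schema.length_seqs_le`), and `(|S| + |R|)! ≤ |R|! * (|R| + 1) ^ |S| * |S|!`
  (`factorial_add_le`), which is within the time bound.
* The sequences are grouped by a key that records for each vertex whether it occurs and how many
  release points follow it. Sequences with the same key are equivalent (`seqEquiv_of_key_eq`), so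
  the minimum cost has to be computed only once for each group. There are at most
  `2 ^ |ℬ| * |R|! * (|R| + 1) ^ |S|` keys (`Schema.card_image_key_le`). The groups refine the
  execution arrangements, and this is all that the sums in the two formulas require.
* For a single sequence, user-independence makes the weights of the constraints invariant under
  renaming of the users, so it suffices to go through the patterns of plans (`pats`), and to rename
  the `j` used users of each pattern by an injective map that minimizes the authorization weights
  (`Schema.minL_planCosts`). This assignment problem is solved by a dynamic program over the sets of
  used users, which takes `4 ^ j` steps up to a polynomial factor (`injCosts_append`,
  `isTable_table`). The sum of `4 ^ j` over all patterns is at most `(|S| + 3)!`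
  (`sum_four_pow_pats`), which is at most `|S| ^ |S|` times a polynomial.
* The decision compares two products of integers (`Exp.ev_becE`, `Exp.ev_approxE`).

Fixed-parameter tractability follows, because the time factor is at most `(n + 2) ^ (4 * n)` for the
parameter `n` (`CCWS.timeFactor_le`), a computable function.
-/

namespace WSP

/-! ### Execution sequences -/

theorem perm_append_of_mem_interleavings {α : Type*} :
    ∀ (a b : List α), ∀ l ∈ interleavings a b, l.Perm (a ++ b)
  | [], b, l, h => by
    simp only [interleavings, List.mem_singleton] at h
    simp [h]
  | x :: a, [], l, h => by
    simp only [interleavings, List.mem_singleton] at h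
    simp [h]
  | x :: a, y :: b, l, h => by
    simp only [interleavings, List.mem_append, List.mem_map] at h
    rcases h with ⟨l, h, rfl⟩ | ⟨l, h, rfl⟩
    · exact (perm_append_of_mem_interleavings a (y :: b) l h).cons x
    · exact ((perm_append_of_mem_interleavings (x :: a) b l h).cons y).trans
        List.perm_middle.symm
  termination_by a b => a.length + b.length

theorem interleavings_ne_nil {α : Type*} : ∀ (a b : List α), interleavings a b ≠ []
  | [], b => by simp [interleavings]
  | x :: a, [] => by simp [interleavings]
  | x :: a, y :: b => by
    have := interleavings_ne_nil a (y :: b)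
    simp [interleavings, this]
  termination_by a b => a.length + b.length

section

variable {S R : Type*} [DecidableEq S] [DecidableEq R]

theorem Workflow.subperm_vertices (G : Workflow S R) :
    ∀ σ ∈ G.execSeqs, σ.Subperm G.vertices := by
  induction G with
  | step s => simp [Workflow.execSeqs, Workflow.vertices]
  | release r => simp [Workflow.execSeqs, Workflow.vertices]
  | seq G₁ G₂ h₁ h₂ =>
    intro σ hσ
    simp only [Workflow.execSeqs, Finset.mem_image₂] at hσ
    obtain ⟨a, ha, b, hb, rfl⟩ := hσ
    exact (h₁ a ha).append (h₂ b hb)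
  | par G₁ G₂ h₁ h₂ =>
    intro σ hσ
    simp only [Workflow.execSeqs, Finset.mem_biUnion, Finset.mem_product, List.mem_toFinset]
      at hσ
    obtain ⟨⟨a, b⟩, ⟨ha, hb⟩, h⟩ := hσ
    exact (perm_append_of_mem_interleavings a b σ h).subperm.trans ((h₁ a ha).append (h₂ b hb))
  | xor G₁ G₂ h₁ h₂ =>
    intro σ hσ
    simp only [Workflow.execSeqs, Finset.mem_union] at hσ
    rcases hσ with hσ | hσ
    · exact (h₁ σ hσ).trans (List.sublist_append_left _ _).subperm
    · exact (h₂ σ hσ).trans (List.sublist_append_right _ _).subperm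

theorem Workflow.execSeqs_nonempty (G : Workflow S R) : G.execSeqs.Nonempty := by
  induction G with
  | step s => simp [Workflow.execSeqs]
  | release r => simp [Workflow.execSeqs]
  | seq G₁ G₂ h₁ h₂ => exact Finset.Nonempty.image₂ h₁ h₂
  | par G₁ G₂ h₁ h₂ =>
    obtain ⟨a, ha⟩ := h₁
    obtain ⟨b, hb⟩ := h₂
    obtain ⟨l, hl⟩ := List.exists_mem_of_ne_nil _ (interleavings_ne_nil a b)
    exact ⟨l, by
      simp only [Workflow.execSeqs, Finset.mem_biUnion, Finset.mem_product, List.mem_toFinset]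
      exact ⟨(a, b), ⟨ha, hb⟩, hl⟩⟩
  | xor G₁ G₂ h₁ h₂ => exact h₁.mono Finset.subset_union_left

theorem Schema.nodup_of_mem_execSeqs {U : Type*} (W : Schema S R U) {σ : List (S ⊕ R)}
    (h : σ ∈ W.execSeqs) : σ.Nodup := by
  obtain ⟨l, hl, hs⟩ := W.workflow.subperm_vertices σ h
  exact hl.nodup_iff.mp (hs.nodup W.nodup_vertices)

end

/-! ### Equivalent execution sequences have the same subscopes -/

/-- The number of release points of `P` to the right of a step is determined by the set of release
points to its right. -/
theorem countP_eq_of_mem_iff {S R : Type*} {p : S ⊕ R → Bool} (hp : ∀ s, p (Sum.inl s) = false)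
    {l l' : List (S ⊕ R)} (hl : l.Nodup) (hl' : l'.Nodup)
    (h : ∀ r : R, Sum.inr r ∈ l ↔ Sum.inr r ∈ l') : l.countP p = l'.countP p := by
  rw [List.countP_eq_length_filter, List.countP_eq_length_filter]
  refine List.Perm.length_eq
    ((List.perm_ext_iff_of_nodup (hl.filter _) (hl'.filter _)).mpr fun v => ?_)
  rcases v with s | r
  · simp [hp]
  · simp [h]

theorem mem_releaseSeq {S R : Type*} {σ : List (S ⊕ R)} {r : R} :
    r ∈ releaseSeq σ ↔ Sum.inr r ∈ σ := by
  simp only [releaseSeq, List.mem_filterMap]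
  constructor
  · rintro ⟨v, hv, h⟩
    rcases v with s | r'
    · simp at h
    · simp only [Sum.getRight?_inr, Option.some.injEq] at h
      exact h ▸ hv
  · exact fun h => ⟨_, h, rfl⟩

section

variable {S R : Type*} [DecidableEq S] [DecidableEq R]

theorem rightOf_cons_self (v : S ⊕ R) (l : List (S ⊕ R)) : rightOf (v :: l) v = l := by
  simp [rightOf]

theorem rightOf_cons_of_ne {v x : S ⊕ R} (h : x ≠ v) (l : List (S ⊕ R)) :
    rightOf (x :: l) v = rightOf l v := by
  simp [rightOf, h]

theorem rightOf_sublist (l : List (S ⊕ R)) (v : S ⊕ R) : (rightOf l v).Sublist l :=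
  (List.tail_sublist _).trans (List.dropWhile_sublist _)

/-- A step lies in the `i`-th piece cut out by the separators `p` if and only if all but `i` of the
separators are to its right. -/
theorem mem_splitOnP_getElem_iff (p : S ⊕ R → Bool) (hp : ∀ s, p (Sum.inl s) = false) (s : S) :
    ∀ (σ : List (S ⊕ R)), σ.Nodup → ∀ (i : ℕ) (l : List (S ⊕ R)), (σ.splitOnP p)[i]? = some l →
      (Sum.inl s ∈ l ↔ Sum.inl s ∈ σ ∧ (rightOf σ (Sum.inl s)).countP p + i = σ.countP p) := by
  intro σ
  induction σ with
  | nil =>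
    intro _ i l h
    rcases i with _ | i
    · simp only [List.splitOnP_nil, List.getElem?_cons_zero, Option.some.injEq] at h
      simp [← h]
    · simp at h
  | cons x xs ih =>
    intro hn i l h
    obtain ⟨hx, hxs'⟩ := List.nodup_cons.mp hn
    have hle : (rightOf xs (Sum.inl s)).countP p ≤ xs.countP p :=
      (rightOf_sublist xs _).countP_le
    rw [List.splitOnP_cons_eq_if_modifyHead] at h
    by_cases hpx : p x = true
    · have hne : x ≠ Sum.inl s := by
        rintro rfl
        simp [hp] at hpx
      rw [if_pos hpx] at h
      rw [rightOf_cons_of_ne hne, List.countP_cons_of_pos hpx]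
      rcases i with _ | i
      · simp only [List.getElem?_cons_zero, Option.some.injEq] at h
        subst h
        simp only [List.not_mem_nil, false_iff]
        omega
      · rw [List.getElem?_cons_succ] at h
        rw [ih hxs' i l h, List.mem_cons]
        constructor
        · rintro ⟨h₁, h₂⟩
          exact ⟨Or.inr h₁, by omega⟩
        · rintro ⟨h₁, h₂⟩
          exact ⟨h₁.resolve_left (Ne.symm hne), by omega⟩
    · rw [if_neg hpx] at h
      rw [List.countP_cons_of_neg hpx]
      have hne : xs.splitOnP p ≠ [] := List.splitOnP_ne_nil p xs
      obtain ⟨y, ys, hy⟩ := List.exists_cons_of_ne_nil hne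
      rw [hy, List.modifyHead_cons] at h
      rw [hy] at ih
      -- a vertex that does not separate belongs to the first piece
      by_cases hxs : x = Sum.inl s
      · subst hxs
        rw [rightOf_cons_self]
        rcases i with _ | i
        · simp only [List.getElem?_cons_zero, Option.some.injEq] at h
          subst h
          simp
        · rw [List.getElem?_cons_succ] at h
          have := ih hxs' (i + 1) l (by simpa using h)
          rw [this]
          constructor
          · rintro ⟨h₁, _⟩
            exact absurd h₁ hx
          · rintro ⟨_, h₂⟩
            omega
      · rw [rightOf_cons_of_ne hxs]
        have hm : (Sum.inl s ∈ x :: xs) ↔ Sum.inl s ∈ xs := by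
          simp [Ne.symm hxs]
        rw [hm]
        rcases i with _ | i
        · simp only [List.getElem?_cons_zero, Option.some.injEq] at h
          subst h
          rw [← ih hxs' 0 y (by simp)]
          simp [Ne.symm hxs]
        · rw [List.getElem?_cons_succ] at h
          exact ih hxs' (i + 1) l (by simpa using h)

theorem length_splitOnP {α : Type*} (p : α → Bool) (l : List α) :
    (l.splitOnP p).length = l.countP p + 1 := by
  induction l with
  | nil => simp
  | cons x xs ih =>
    rw [List.splitOnP_cons_eq_if_modifyHead]
    by_cases h : p x = true
    · simp [h, ih]
    · simp [h, ih]

/-- By `mem_splitOnP_getElem_iff`, the index of the subscope of a step is determined by the number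
of release points to its right, so equivalent sequences have the same subscopes. -/
theorem WeightedConstraint.subscopes_eq {U : Type*} (c : WeightedConstraint S R U)
    {σ σ' : List (S ⊕ R)} (hσ : σ.Nodup) (hσ' : σ'.Nodup) (h : SeqEquiv σ σ') :
    c.subscopes σ = c.subscopes σ' := by
  obtain ⟨h₁, h₂, h₃⟩ := h
  set p : S ⊕ R → Bool := fun v => v.elim (fun _ => false) fun r => decide (r ∈ c.releases)
    with hp
  have hps : ∀ s, p (Sum.inl s) = false := fun s => rfl
  -- the sequences have the same number of release points of `P`, hence of subscopes
  have hcount : σ.countP p = σ'.countP p :=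
    countP_eq_of_mem_iff hps hσ hσ' fun r => by rw [← mem_releaseSeq, ← mem_releaseSeq, h₁]
  unfold subscopes
  rw [← hp]
  refine List.ext_getElem (by simp [length_splitOnP, hcount]) fun i hi hi' => ?_
  simp only [List.length_map] at hi hi'
  simp only [List.getElem_map]
  ext s
  have key : Sum.inl s ∈ (σ.splitOnP p)[i] ↔ Sum.inl s ∈ (σ'.splitOnP p)[i] := by
    rw [mem_splitOnP_getElem_iff p hps s σ hσ i _ (List.getElem?_eq_getElem hi),
      mem_splitOnP_getElem_iff p hps s σ' hσ' i _ (List.getElem?_eq_getElem hi'), ← h₂ s, hcount]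
    refine and_congr_right fun hs => ?_
    rw [countP_eq_of_mem_iff hps (hσ.sublist (rightOf_sublist _ _))
      (hσ'.sublist (rightOf_sublist _ _)) (h₃ s hs)]
  have hmem : ∀ l : List (S ⊕ R), s ∈ l.filterMap Sum.getLeft? ↔ Sum.inl s ∈ l := by
    intro l
    simp only [List.mem_filterMap]
    constructor
    · rintro ⟨v, hv, h⟩
      rcases v with s' | r'
      · simp only [Sum.getLeft?_inl, Option.some.injEq] at h
        exact h ▸ hv
      · simp at h
    · exact fun h => ⟨_, h, rfl⟩
  simp only [Finset.mem_inter, List.mem_toFinset, hmem, key]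

theorem SeqEquiv.symm {σ σ' : List (S ⊕ R)} (h : SeqEquiv σ σ') : SeqEquiv σ' σ :=
  ⟨h.1.symm, fun s => (h.2.1 s).symm, fun s hs r => (h.2.2 s ((h.2.1 s).mpr hs) r).symm⟩

theorem SeqEquiv.trans {σ σ' σ'' : List (S ⊕ R)} (h : SeqEquiv σ σ') (h' : SeqEquiv σ' σ'') :
    SeqEquiv σ σ'' :=
  ⟨h.1.trans h'.1, fun s => (h.2.1 s).trans (h'.2.1 s),
    fun s hs r => (h.2.2 s hs r).trans (h'.2.2 s ((h.2.1 s).mp hs) r)⟩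

theorem SeqEquiv.refl (σ : List (S ⊕ R)) : SeqEquiv σ σ :=
  ⟨rfl, fun _ => Iff.rfl, fun _ _ _ => Iff.rfl⟩

end

/-! ### Minimum costs -/

section

variable {S R U : Type*} [Fintype S] [Fintype U] [DecidableEq S] [DecidableEq R] [DecidableEq U]
  (W : Schema S R U)

/-- The minimum cost of a plan for the execution sequence `σ`. -/
noncomputable def Schema.minCost (σ : List (S ⊕ R)) : ℕ :=
  sInf {w : ℕ | ∃ π : Plan S U, IsPlanFor σ π ∧ W.cost σ π = w}

/-- Plans exist because every step has an authorized user. -/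
theorem Schema.exists_plan {S R U : Type*} [DecidableEq S] (W : Schema S R U)
    (σ : List (S ⊕ R)) : ∃ π : Plan S U, IsPlanFor σ π := by
  classical
  choose u _ using W.exists_auth
  refine ⟨fun s => if Sum.inl s ∈ σ then some (u s) else none, ?_⟩
  ext s
  by_cases h : Sum.inl s ∈ σ <;> simp [Plan.dom, h]

theorem Schema.minCost_isLeast (σ : List (S ⊕ R)) :
    IsLeast {w : ℕ | ∃ π : Plan S U, IsPlanFor σ π ∧ W.cost σ π = w} (W.minCost σ) := by
  obtain ⟨π, hπ⟩ := W.exists_plan σ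
  have hne : {w : ℕ | ∃ π : Plan S U, IsPlanFor σ π ∧ W.cost σ π = w}.Nonempty :=
    ⟨_, π, hπ, rfl⟩
  exact ⟨Nat.sInf_mem hne, fun w hw => Nat.sInf_le hw⟩

/-- The minimum cost is an invariant of the execution arrangement: equivalent sequences have the
same plans and the same subscopes, hence plans of the same cost. -/
theorem Schema.minCost_eq_of_seqEquiv {σ σ' : List (S ⊕ R)} (hσ : σ ∈ W.execSeqs)
    (hσ' : σ' ∈ W.execSeqs) (h : SeqEquiv σ σ') : W.minCost σ = W.minCost σ' := by
  unfold Schema.minCost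
  congr 1
  ext w
  refine exists_congr fun π => and_congr ?_ ?_
  · unfold IsPlanFor
    have : {s | Sum.inl s ∈ σ} = {s | Sum.inl s ∈ σ'} := Set.ext h.2.1
    rw [this]
  · unfold Schema.cost
    rw [List.map_congr_left fun c _ => by
      rw [c.subscopes_eq (W.nodup_of_mem_execSeqs hσ) (W.nodup_of_mem_execSeqs hσ') h]]

/-- The expected cost of the best choice of plans is the average of the minimum costs. -/
theorem Schema.boundedExpectedCost_iff (B : ℝ) :
    W.BoundedExpectedCost W.uniformFreq B ↔
      (∑ σ ∈ W.execSeqs, (W.minCost σ : ℝ)) / (W.execSeqs.card : ℝ) ≤ B := by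
  have hsum : ∀ g : List (S ⊕ R) → ℝ, ∑ σ ∈ W.execSeqs, 1 / (W.execSeqs.card : ℝ) * g σ =
      (∑ σ ∈ W.execSeqs, g σ) / (W.execSeqs.card : ℝ) := fun g => by
    rw [← Finset.mul_sum]
    ring
  unfold Schema.BoundedExpectedCost Schema.relativeCost Schema.uniformFreq
  constructor
  · rintro ⟨π, hπ, h⟩
    refine le_trans ?_ h
    rw [hsum]
    gcongr with σ hσ
    exact_mod_cast (W.minCost_isLeast σ).2 ⟨π σ, hπ σ hσ, rfl⟩
  · intro h
    choose π hπ using fun σ => (W.minCost_isLeast σ).1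
    refine ⟨π, fun σ _ => (hπ σ).1, ?_⟩
    rw [hsum]
    simpa only [(hπ _).2] using h

/-- An execution sequence has a plan within the budget if and only if its minimum cost is within the
budget. -/
theorem Schema.completesWithinBudget_iff (B p : ℝ) :
    W.CompletesWithinBudget W.uniformFreq B p ↔
      p ≤ ((W.execSeqs.filter fun σ => (W.minCost σ : ℝ) ≤ B).card : ℝ) /
        (W.execSeqs.card : ℝ) := by
  have : W.withinBudget B = W.execSeqs.filter fun σ => (W.minCost σ : ℝ) ≤ B := by
    ext σ
    simp only [Schema.withinBudget, Finset.mem_filter]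
    refine and_congr_right fun _ => ⟨?_, fun h => ?_⟩
    · rintro ⟨π, hπ, h⟩
      refine le_trans ?_ h
      exact_mod_cast (W.minCost_isLeast σ).2 ⟨π, hπ, rfl⟩
    · obtain ⟨π, hπ, h'⟩ := (W.minCost_isLeast σ).1
      exact ⟨π, hπ, h' ▸ h⟩
  unfold Schema.CompletesWithinBudget Schema.uniformFreq
  rw [this, Finset.sum_const, nsmul_eq_mul, mul_one_div]

/-! ### Sums over the execution arrangements -/

theorem Schema.mem_arrangement {S R U : Type*} [DecidableEq S] [DecidableEq R]
    (W : Schema S R U) {X : Finset (List (S ⊕ R))} (hX : X ∈ W.arrangements)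
    {σ : List (S ⊕ R)} (hσ : σ ∈ X) (σ' : List (S ⊕ R)) :
    σ' ∈ X ↔ σ' ∈ W.execSeqs ∧ SeqEquiv σ σ' := by
  simp only [Schema.arrangements, Finset.mem_image] at hX
  obtain ⟨τ, _, rfl⟩ := hX
  simp only [Finset.mem_filter] at hσ ⊢
  exact and_congr_right fun _ => ⟨fun h => hσ.2.symm.trans h, fun h => hσ.2.trans h⟩

/-- The execution arrangements partition the set of execution sequences. -/
theorem Schema.sum_arrangements {S R U : Type*} [DecidableEq S] [DecidableEq R]
    (W : Schema S R U) (g : List (S ⊕ R) → ℝ) :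
    ∑ X ∈ W.arrangements, ∑ σ ∈ X, g σ = ∑ σ ∈ W.execSeqs, g σ := by
  classical
  have hmaps : ∀ σ ∈ W.execSeqs, (W.execSeqs.filter fun σ' => SeqEquiv σ σ') ∈ W.arrangements :=
    fun σ hσ => by
      unfold Schema.arrangements
      convert Finset.mem_image_of_mem _ hσ using 1
  rw [← Finset.sum_fiberwise_of_maps_to hmaps]
  refine Finset.sum_congr rfl fun X hX => Finset.sum_congr ?_ fun _ _ => rfl
  ext σ
  have hX' := hX
  simp only [Schema.arrangements, Finset.mem_image] at hX'
  obtain ⟨τ, hτ, hτX⟩ := hX'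
  have hτX : W.execSeqs.filter (fun σ' => SeqEquiv τ σ') = X := by
    rw [← hτX]
  simp only [Finset.mem_filter]
  constructor
  · intro h
    have h' := h
    rw [← hτX, Finset.mem_filter] at h'
    refine ⟨h'.1, ?_⟩
    ext σ'
    rw [W.mem_arrangement hX h, Finset.mem_filter]
  · rintro ⟨hσ, h⟩
    rw [← h, Finset.mem_filter]
    exact ⟨hσ, SeqEquiv.refl σ⟩

end

open Classical in
/-- The characterizations of the two problems by the sizes and the minimum costs of the execution
arrangements. -/
theorem arrangement_formulas {S R U : Type*} [Fintype S] [Fintype U]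
    [DecidableEq S] [DecidableEq R] [DecidableEq U] (W : Schema S R U) :
    ∃ wstar : Finset (List (S ⊕ R)) → ℕ,
      (∀ X ∈ W.arrangements, ∀ σ ∈ X,
        IsLeast {w : ℕ | ∃ π : Plan S U, IsPlanFor σ π ∧ W.cost σ π = w} (wstar X)) ∧
      (∀ B : ℝ, 0 ≤ B →
        (W.BoundedExpectedCost W.uniformFreq B ↔
          (∑ X ∈ W.arrangements, (X.card : ℝ) * (wstar X : ℝ)) /
            (∑ X ∈ W.arrangements, (X.card : ℝ)) ≤ B)) ∧
      (∀ B p : ℝ, 0 ≤ B → 0 ≤ p → p ≤ 1 →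
        (W.CompletesWithinBudget W.uniformFreq B p ↔
          p ≤ (∑ X ∈ W.arrangements with (wstar X : ℝ) ≤ B, (X.card : ℝ)) /
            (∑ X ∈ W.arrangements, (X.card : ℝ)))) := by
  let wstar : Finset (List (S ⊕ R)) → ℕ := fun X =>
    if h : X.Nonempty then W.minCost h.choose else 0
  have hstar : ∀ X ∈ W.arrangements, ∀ σ ∈ X, wstar X = W.minCost σ := by
    intro X hX σ hσ
    have hne : X.Nonempty := ⟨σ, hσ⟩
    have h₁ := (W.mem_arrangement hX hne.choose_spec σ).mp hσ
    have h₂ := (W.mem_arrangement hX hσ hne.choose).mp hne.choose_spec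
    simp only [wstar, hne, ↓reduceDIte]
    exact W.minCost_eq_of_seqEquiv h₂.1 h₁.1 h₁.2
  have hcard : ∑ X ∈ W.arrangements, (X.card : ℝ) = (W.execSeqs.card : ℝ) := by
    rw [← Finset.sum_congr rfl fun X _ => ?_, W.sum_arrangements fun _ => 1]
    · simp
    · simp
  have hsum : ∑ X ∈ W.arrangements, (X.card : ℝ) * (wstar X : ℝ) =
      ∑ σ ∈ W.execSeqs, (W.minCost σ : ℝ) := by
    rw [← W.sum_arrangements]
    refine Finset.sum_congr rfl fun X hX => ?_
    rw [Finset.sum_congr rfl fun σ hσ => by rw [← hstar X hX σ hσ], Finset.sum_const,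
      nsmul_eq_mul]
  have hfilter : ∀ B : ℝ, ∑ X ∈ W.arrangements with (wstar X : ℝ) ≤ B, (X.card : ℝ) =
      ((W.execSeqs.filter fun σ => (W.minCost σ : ℝ) ≤ B).card : ℝ) := by
    intro B
    rw [Finset.sum_filter, Finset.card_filter, Nat.cast_sum, ← W.sum_arrangements]
    refine Finset.sum_congr rfl fun X hX => ?_
    rw [Finset.sum_congr rfl fun σ hσ => by rw [← hstar X hX σ hσ], Finset.sum_const,
      nsmul_eq_mul]
    split_ifs <;> simp
  refine ⟨wstar, fun X hX σ hσ => hstar X hX σ hσ ▸ W.minCost_isLeast σ, fun B _ => ?_,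
    fun B p _ _ _ => ?_⟩
  · rw [W.boundedExpectedCost_iff, hcard, hsum]
  · rw [W.completesWithinBudget_iff, hcard, hfilter]

/-! ### A total programming language -/

/-- Expressions of a total language that compiles to the programs of the machine model.  An
expression is evaluated in an environment, a value whose components `v.fst`, `v.snd.fst`,
`v.snd.snd.fst`, … are the values of the variables `var 0`, `var 1`, `var 2`, ….  The body of a
`fold` is evaluated in the environment extended by the current list element (`var 0`) and the
accumulator (`var 1`); `app f e` evaluates `f` in the environment that is the value of `e`. -/
inductive Exp where
  | const (n : ℕ)
  | env
  | var (i : ℕ)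
  | fst (e : Exp)
  | snd (e : Exp)
  | isPair (e : Exp)
  | add (a b : Exp)
  | mul (a b : Exp)
  | le (a b : Exp)
  | call (e : Exp)
  | pair (a b : Exp)
  | ite (c a b : Exp)
  | app (f e : Exp)
  | fold (l i b : Exp)

namespace Exp

/-- The value of a variable. -/
def lookup : ℕ → Val → Val
  | 0, v => v.fst
  | i + 1, v => lookup i v.snd

/-- The value of an expression, with subroutine `O`. -/
def eval (O : Val → ℕ) : Exp → Val → Val
  | const n, _ => .nat n
  | env, v => v
  | var i, v => lookup i v
  | fst e, v => (eval O e v).fst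
  | snd e, v => (eval O e v).snd
  | isPair e, v => .nat (eval O e v).isPair
  | add a b, v => .nat ((eval O a v).num + (eval O b v).num)
  | mul a b, v => .nat ((eval O a v).num * (eval O b v).num)
  | le a b, v => .nat (if (eval O a v).num ≤ (eval O b v).num then 1 else 0)
  | call e, v => .nat (O (eval O e v))
  | pair a b, v => .pair (eval O a v) (eval O b v)
  | ite c a b, v => if (eval O c v).num = 0 then eval O b v else eval O a v
  | app f e, v => eval O f (eval O e v)
  | fold l i b, v =>
      (eval O l v).toList.foldl (fun acc x => eval O b (.pair x (.pair acc v))) (eval O i v)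

/-- The running time of a loop over a list, where `f` and `t` are the value and the running time of
the body as functions of the list element and the accumulator. -/
def foldTime (f : Val → Val → Val) (t : Val → Val → ℕ) : List Val → Val → ℕ
  | [], _ => 4
  | x :: l, acc => 18 + t x acc + foldTime f t l (f x acc)

/-- The running time of an expression, with subroutine `O` and cost `κ` per call. -/
def time (O : Val → ℕ) (κ : ℕ) : Exp → Val → ℕ
  | const _, _ => 1
  | env, _ => 1
  | var i, _ => 2 * i + 1
  | fst e, v => time O κ e v + 2
  | snd e, v => time O κ e v + 2
  | isPair e, v => time O κ e v + 2
  | add a b, v => time O κ a v + time O κ b v + Nat.size (eval O a v).num +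
      Nat.size (eval O b v).num + 3
  | mul a b, v => time O κ a v + time O κ b v + Nat.size (eval O a v).num *
      Nat.size (eval O b v).num + 3
  | le a b, v => time O κ a v + time O κ b v + Nat.size (eval O a v).num +
      Nat.size (eval O b v).num + 3
  | call e, v => time O κ e v + κ + (eval O e v).size + 2
  | pair a b, v => time O κ a v + time O κ b v + 1
  | ite c a b, v => time O κ c v + (if (eval O c v).num = 0 then time O κ b v else time O κ a v) + 1
  | app f e, v => time O κ e v + time O κ f (eval O e v) + 1
  | fold l i b, v => time O κ l v + time O κ i v + 8 +
      foldTime (fun x acc => eval O b (.pair x (.pair acc v)))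
        (fun x acc => time O κ b (.pair x (.pair acc v))) (eval O l v).toList (eval O i v)

/-- The program that looks up a variable. -/
def lookupProg : ℕ → Prog
  | 0 => .fst
  | i + 1 => .comp (lookupProg i) .snd

/-- The translation of expressions to programs.  A `fold` becomes a loop whose state consists of
the rest of the list, the accumulator and the environment. -/
def compile : Exp → Prog
  | const n => .const n
  | env => .id
  | var i => lookupProg i
  | fst e => .comp .fst (compile e)
  | snd e => .comp .snd (compile e)
  | isPair e => .comp .isPair (compile e)
  | add a b => .comp .add (.pair (compile a) (compile b))
  | mul a b => .comp .mul (.pair (compile a) (compile b))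
  | le a b => .comp .le (.pair (compile a) (compile b))
  | call e => .comp .call (compile e)
  | pair a b => .pair (compile a) (compile b)
  | ite c a b => .ite (compile c) (compile a) (compile b)
  | app f e => .comp (compile f) (compile e)
  | fold l i b => .comp (.comp .fst .snd) (.comp
      (.loop (.comp .isPair .fst)
        (.pair (.comp .snd .fst)
          (.pair (.comp (compile b) (.pair (.comp .fst .fst) .snd)) (.comp .snd .snd))))
      (.pair (compile l) (.pair (compile i) .id)))

/-- The machine charges `2 * i + 1` steps for `i` second components, one first component and `i`
compositions. -/
theorem run_lookup (O : Val → ℕ) (κ : ℕ) :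
    ∀ (i : ℕ) (v : Val), Run O κ (lookupProg i) v (lookup i v) (2 * i + 1)
  | 0, v => .fst v
  | i + 1, v => by
    have := Run.comp (.snd v) (run_lookup O κ i v.snd)
    rwa [show 1 + 1 + (2 * i + 1) = 2 * (i + 1) + 1 by ring] at this

/-- Expressions are compiled correctly, and `time` is the exact running time. -/
theorem run_compile (O : Val → ℕ) (κ : ℕ) (e : Exp) :
    ∀ v, Run O κ (compile e) v (eval O e v) (time O κ e v) := by
  have cast : ∀ {P v w s t}, Run O κ P v w s → s = t → Run O κ P v w t := fun h h' => h' ▸ h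
  induction e with
  | const n => exact fun v => .const n v
  | env => exact fun v => .id v
  | var i => exact fun v => run_lookup O κ i v
  | fst e ih => exact fun v => cast (.comp (ih v) (.fst _)) (by simp only [time]; ring)
  | snd e ih => exact fun v => cast (.comp (ih v) (.snd _)) (by simp only [time]; ring)
  | isPair e ih => exact fun v => cast (.comp (ih v) (.isPair _)) (by simp only [time]; ring)
  | add a b iha ihb =>
    exact fun v => cast (.comp (.pair (iha v) (ihb v)) (.add _))
      (by simp only [time, Val.fst, Val.snd]; ring)
  | mul a b iha ihb =>
    exact fun v => cast (.comp (.pair (iha v) (ihb v)) (.mul _))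
      (by simp only [time, Val.fst, Val.snd]; ring)
  | le a b iha ihb =>
    exact fun v => cast (.comp (.pair (iha v) (ihb v)) (.le _))
      (by simp only [time, Val.fst, Val.snd]; ring)
  | call e ih => exact fun v => cast (.comp (ih v) (.call _)) (by simp only [time]; ring)
  | pair a b iha ihb =>
    exact fun v => cast (.pair (iha v) (ihb v)) (by simp only [time]; ring)
  | ite c a b ihc iha ihb =>
    intro v
    by_cases h : (eval O c v).num = 0
    · have := Run.iteFalse (P := compile a) (ihc v) h (ihb v)
      simp only [eval, time, h, if_true, compile]
      exact cast this (by ring)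
    · have := Run.iteTrue (Q := compile b) (ihc v) h (iha v)
      simp only [eval, time, h, if_false, compile]
      exact cast this (by ring)
  | app f e ihf ihe =>
    exact fun v => cast (.comp (ihe v) (ihf _)) (by simp only [time]; ring)
  | fold l i b ihl ihi ihb =>
    intro v
    -- the loop ends when the rest `r` of the list is a number, whatever that number is
    have loop : ∀ (L acc : Val), ∃ r,
        Run O κ (.loop (.comp .isPair .fst)
          (.pair (.comp .snd .fst)
            (.pair (.comp (compile b) (.pair (.comp .fst .fst) .snd)) (.comp .snd .snd))))
          (.pair L (.pair acc v))
          (.pair r (.pair (L.toList.foldl (fun acc x => eval O b (.pair x (.pair acc v))) acc) v))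
          (foldTime (fun x acc => eval O b (.pair x (.pair acc v)))
            (fun x acc => time O κ b (.pair x (.pair acc v))) L.toList acc) := by
      intro L
      induction L with
      | nat n =>
        intro acc
        refine ⟨.nat n, ?_⟩
        exact Run.loopDone (.comp (.fst _) (.isPair _)) rfl
      | pair x L _ ih =>
        intro acc
        obtain ⟨r, hr⟩ := ih (eval O b (.pair x (.pair acc v)))
        refine ⟨r, ?_⟩
        have hbody := Run.pair (Run.comp (Run.fst (O := O) (κ := κ) (.pair (.pair x L)
            (.pair acc v))) (.snd _))
          (.pair (.comp (.pair (.comp (.fst _) (.fst _)) (.snd _)) (ihb (.pair x (.pair acc v))))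
            (.comp (.snd (.pair (.pair x L) (.pair acc v))) (.snd _)))
        refine cast (Run.loopStep (.comp (.fst _) (.isPair _)) Nat.one_ne_zero hbody hr) ?_
        simp only [foldTime, Val.toList]
        ring
    obtain ⟨r, hr⟩ := loop (eval O l v) (eval O i v)
    refine cast (.comp (.comp (.pair (ihl v) (.pair (ihi v) (.id v))) hr)
      (.comp (.snd _) (.fst _))) ?_
    simp only [time]
    ring

/-! ### Evaluation judgements -/

theorem _root_.WSP.Val.fst_pair (a b : Val) : (Val.pair a b).fst = a := rfl

theorem _root_.WSP.Val.snd_pair (a b : Val) : (Val.pair a b).snd = b := rfl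

theorem _root_.WSP.Val.num_nat (n : ℕ) : (Val.nat n).num = n := rfl

theorem ite_one_zero_ne_zero_iff {p : Prop} [Decidable p] :
    (if p then 1 else 0 : ℕ) ≠ 0 ↔ p := by
  split_ifs <;> simp [*]

/-- The expression `e` evaluates to `w` in the environment `v`, in at most `t` steps. -/
def Ev (O : Val → ℕ) (κ : ℕ) (e : Exp) (v w : Val) (t : ℕ) : Prop :=
  eval O e v = w ∧ time O κ e v ≤ t

variable {O : Val → ℕ} {κ : ℕ}

theorem Ev.mono {e : Exp} {v w : Val} {s t : ℕ} (h : Ev O κ e v w s) (hst : s ≤ t) :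
    Ev O κ e v w t :=
  ⟨h.1, h.2.trans hst⟩

theorem Ev.app {f e : Exp} {v w x : Val} {s t : ℕ} (he : Ev O κ e v w s) (hf : Ev O κ f w x t) :
    Ev O κ (.app f e) v x (s + t + 1) := by
  refine ⟨by simp [eval, he.1, hf.1], ?_⟩
  have := he.2
  have := hf.2
  simp only [time, he.1]
  omega

theorem Ev.pair {a b : Exp} {v w x : Val} {s t : ℕ} (ha : Ev O κ a v w s) (hb : Ev O κ b v x t) :
    Ev O κ (.pair a b) v (.pair w x) (s + t + 1) := by
  refine ⟨by simp [eval, ha.1, hb.1], ?_⟩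
  have := ha.2
  have := hb.2
  simp only [time]
  omega

theorem Ev.const (n : ℕ) (v : Val) : Ev O κ (.const n) v (.nat n) 1 := ⟨rfl, le_rfl⟩

theorem Ev.env (v : Val) : Ev O κ .env v v 1 := ⟨rfl, le_rfl⟩

theorem Ev.var (i : ℕ) (v : Val) : Ev O κ (.var i) v (lookup i v) (2 * i + 1) := ⟨rfl, le_rfl⟩

/-- The condition may evaluate to any number `n` that is nonzero exactly when `p` holds. -/
theorem Ev.ite {p : Prop} [Decidable p] {c a b : Exp} {v w x : Val} {n r s t : ℕ}
    (hc : Ev O κ c v (.nat n) r) (hn : n ≠ 0 ↔ p) (ha : p → Ev O κ a v w s)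
    (hb : ¬ p → Ev O κ b v x t) :
    Ev O κ (.ite c a b) v (if p then w else x) (r + max s t + 1) := by
  have h₁ := hc.2
  by_cases hp : p
  · have hn0 := hn.mpr hp
    refine ⟨by simp [eval, hc.1, Val.num, hn0, hp, (ha hp).1], ?_⟩
    have h₂ := (ha hp).2
    have := le_max_left s t
    simp only [time, hc.1, Val.num, hn0, if_false]
    omega
  · have hn0 : n = 0 := by
      by_contra h
      exact hp (hn.mp h)
    refine ⟨by simp [eval, hc.1, Val.num, hn0, hp, (hb hp).1], ?_⟩
    have h₂ := (hb hp).2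
    have := le_max_right s t
    simp only [time, hc.1, Val.num, hn0, if_true]
    omega

theorem Ev.add {a b : Exp} {v : Val} {x y s t : ℕ} (ha : Ev O κ a v (.nat x) s)
    (hb : Ev O κ b v (.nat y) t) :
    Ev O κ (.add a b) v (.nat (x + y)) (s + t + Nat.size x + Nat.size y + 3) := by
  refine ⟨by simp [eval, ha.1, hb.1, Val.num], ?_⟩
  have := ha.2
  have := hb.2
  simp only [time, ha.1, hb.1, Val.num]
  omega

theorem Ev.mul {a b : Exp} {v : Val} {x y s t : ℕ} (ha : Ev O κ a v (.nat x) s)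
    (hb : Ev O κ b v (.nat y) t) :
    Ev O κ (.mul a b) v (.nat (x * y)) (s + t + Nat.size x * Nat.size y + 3) := by
  refine ⟨by simp [eval, ha.1, hb.1, Val.num], ?_⟩
  have := ha.2
  have := hb.2
  simp only [time, ha.1, hb.1, Val.num]
  omega

theorem Ev.le {a b : Exp} {v : Val} {x y s t : ℕ} (ha : Ev O κ a v (.nat x) s)
    (hb : Ev O κ b v (.nat y) t) :
    Ev O κ (.le a b) v (.nat (if x ≤ y then 1 else 0)) (s + t + Nat.size x + Nat.size y + 3) := by
  refine ⟨by simp [eval, ha.1, hb.1, Val.num], ?_⟩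
  have := ha.2
  have := hb.2
  simp only [time, ha.1, hb.1, Val.num]
  omega

theorem Ev.call {e : Exp} {v w : Val} {t : ℕ} (h : Ev O κ e v w t) :
    Ev O κ (.call e) v (.nat (O w)) (t + κ + w.size + 2) := by
  refine ⟨by simp [eval, h.1], ?_⟩
  have := h.2
  simp only [time, h.1]
  omega

theorem _root_.WSP.Val.toList_ofList (l : List Val) : (Val.ofList l).toList = l := by
  induction l with
  | nil => rfl
  | cons a l ih => simp [Val.ofList, Val.toList, ih]

/-- Time bound of a loop whose accumulator satisfies the invariant `P`. -/
theorem foldTime_le {α β : Type*} (f : α → Val) (g : β → Val) (step : β → α → β)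
    (P : β → Prop) {F : Val → Val → Val} {t : Val → Val → ℕ} {T : α → ℕ} {xs : List α}
    (hF : ∀ x ∈ xs, ∀ b, P b → F (f x) (g b) = g (step b x) ∧ t (f x) (g b) ≤ T x ∧ P (step b x)) :
    ∀ b, P b → foldTime F t (xs.map f) (g b) ≤ 4 + (xs.map fun x => 18 + T x).sum := by
  induction xs with
  | nil => exact fun b _ => le_rfl
  | cons x xs ih =>
    intro b hb
    obtain ⟨h₁, h₂, h₃⟩ := hF x (by simp) b hb
    have := ih (fun y hy => hF y (by simp [hy])) _ h₃
    simp only [List.map_cons, foldTime, List.sum_cons, h₁]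
    omega

/-- A fold with an invariant `P` of the accumulator. -/
theorem Ev.fold {α β : Type*} (f : α → Val) (g : β → Val) (step : β → α → β) (P : β → Prop)
    {l i b : Exp} {v : Val} {xs : List α} {b₀ : β} {s t : ℕ} {T : α → ℕ}
    (hl : Ev O κ l v (.ofList (xs.map f)) s) (hi : Ev O κ i v (g b₀) t) (h₀ : P b₀)
    (hb : ∀ x ∈ xs, ∀ b', P b' →
      Ev O κ b (.pair (f x) (.pair (g b') v)) (g (step b' x)) (T x) ∧ P (step b' x)) :
    Ev O κ (.fold l i b) v (g (xs.foldl step b₀))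
      (s + t + 12 + (xs.map fun x => 18 + T x).sum) := by
  constructor
  · simp only [eval, hl.1, hi.1, Val.toList_ofList]
    clear hl hi
    induction xs generalizing b₀ with
    | nil => rfl
    | cons x xs ih =>
      have h := hb x (by simp) b₀ h₀
      rw [List.map_cons, List.foldl_cons, h.1.1, List.foldl_cons]
      exact ih h.2 fun y hy => hb y (by simp [hy])
  · have h₁ := hl.2
    have h₂ := hi.2
    have h₃ := foldTime_le f g step P (T := T) (xs := xs)
      (F := fun x acc => eval O b (.pair x (.pair acc v)))
      (t := fun x acc => time O κ b (.pair x (.pair acc v)))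
      (fun x hx b' hb' => ⟨(hb x hx b' hb').1.1, (hb x hx b' hb').1.2, (hb x hx b' hb').2⟩) b₀ h₀
    simp only [time, hl.1, hi.1, Val.toList_ofList]
    omega

theorem sum_map_le_length_mul {α : Type*} {xs : List α} {T : α → ℕ} {c : ℕ}
    (h : ∀ x ∈ xs, T x ≤ c) : (xs.map T).sum ≤ xs.length * c := by
  have := List.sum_le_card_nsmul (xs.map T) c (by simpa using h)
  simpa using this

theorem Ev.foldConst {α β : Type*} (f : α → Val) (g : β → Val) (step : β → α → β) (P : β → Prop)
    {l i b : Exp} {v : Val} {xs : List α} {b₀ : β} {s t T : ℕ}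
    (hl : Ev O κ l v (.ofList (xs.map f)) s) (hi : Ev O κ i v (g b₀) t) (h₀ : P b₀)
    (hb : ∀ x ∈ xs, ∀ b', P b' →
      Ev O κ b (.pair (f x) (.pair (g b') v)) (g (step b' x)) T ∧ P (step b' x)) :
    Ev O κ (.fold l i b) v (g (xs.foldl step b₀)) (s + t + 12 + xs.length * (18 + T)) := by
  refine (Ev.fold f g step P hl hi h₀ hb).mono ?_
  have := sum_map_le_length_mul (xs := xs) (T := fun _ => 18 + T) fun _ _ => le_rfl
  omega

/-- A fold with an invariant that also depends on the rest of the list. -/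
theorem Ev.foldRem {α β : Type*} (f : α → Val) (g : β → Val) (step : β → α → β)
    (P : List α → β → Prop) {l i b : Exp} {v : Val} {xs : List α} {b₀ : β} {s t T : ℕ}
    (hl : Ev O κ l v (.ofList (xs.map f)) s) (hi : Ev O κ i v (g b₀) t) (h₀ : P xs b₀)
    (hb : ∀ x ∈ xs, ∀ rest b', P (x :: rest) b' →
      Ev O κ b (.pair (f x) (.pair (g b') v)) (g (step b' x)) T ∧ P rest (step b' x)) :
    Ev O κ (.fold l i b) v (g (xs.foldl step b₀)) (s + t + 12 + xs.length * (18 + T)) := by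
  have key : (xs.map f).foldl (fun acc x => eval O b (.pair x (.pair acc v))) (g b₀) =
      g (xs.foldl step b₀) ∧
      foldTime (fun x acc => eval O b (.pair x (.pair acc v)))
        (fun x acc => time O κ b (.pair x (.pair acc v))) (xs.map f) (g b₀) ≤
      4 + xs.length * (18 + T) := by
    clear hl hi
    induction xs generalizing b₀ with
    | nil => exact ⟨rfl, by simp [foldTime]⟩
    | cons x xs ih =>
      obtain ⟨h₁, h₂⟩ := hb x (by simp) xs b₀ h₀
      obtain ⟨h₃, h₄⟩ := ih h₂ fun y hy => hb y (by simp [hy])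
      have h₅ := h₁.2
      simp only [List.map_cons, List.foldl_cons, foldTime, h₁.1, List.length_cons]
      refine ⟨h₃, ?_⟩
      have : (xs.length + 1) * (18 + T) = xs.length * (18 + T) + (18 + T) := by ring
      omega
  have h₁ := hl.2
  have h₂ := hi.2
  refine ⟨?_, ?_⟩
  · simp only [eval, hl.1, hi.1, Val.toList_ofList, key.1]
  · have h₃ := key.2
    simp only [time, hl.1, hi.1, Val.toList_ofList]
    omega

/-! ### List operations -/

theorem foldl_cons_eq {α : Type*} (xs acc : List α) :
    xs.foldl (fun l x => x :: l) acc = xs.reverse ++ acc := by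
  induction xs generalizing acc with
  | nil => rfl
  | cons x xs ih => simp [ih]

/-- Reversal of the list that is the whole environment. -/
def revE : Exp := .fold .env (.const 0) (.pair (.var 0) (.var 1))

/-- The empty list is encoded by `.nat 0`, the initial accumulator. -/
theorem ev_revE {α : Type*} (f : α → Val) (xs : List α) :
    Ev O κ revE (.ofList (xs.map f)) (.ofList (xs.reverse.map f)) (14 + xs.length * 23) := by
  have := Ev.foldConst (O := O) (κ := κ) f (fun l : List α => Val.ofList (l.map f))
    (fun l x => x :: l) (fun _ => True) (T := 5)
    (Ev.env (.ofList (xs.map f))) (b₀ := []) (Ev.const 0 _) trivial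
    (fun x _ b _ => ⟨(Ev.var 0 _).pair (Ev.var 1 _), trivial⟩)
  rw [foldl_cons_eq, List.append_nil] at this
  exact this.mono (by omega)

/-- The concatenation of the lists `b`, where `var 0` runs through the list `l`. -/
def bindE (l b : Exp) : Exp :=
  .app revE (.fold l (.const 0)
    (.fold (.app b (.pair (.var 0) (.snd (.snd .env)))) (.var 1) (.pair (.var 0) (.var 1))))

/-- Every element of the output is moved twice: into the accumulator of the fold, in reversed order,
and by the final reversal. -/
theorem Ev.bind {α β : Type*} (f : α → Val) (h : β → Val) (g : α → List β) {l b : Exp} {v : Val}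
    {xs : List α} {s : ℕ} {T : α → ℕ} (hl : Ev O κ l v (.ofList (xs.map f)) s)
    (hb : ∀ x ∈ xs, Ev O κ b (.pair (f x) v) (.ofList ((g x).map h)) (T x)) :
    Ev O κ (bindE l b) v (.ofList ((xs.flatMap g).map h))
      (s + 40 + (xs.map fun x => T x + 60 + 50 * (g x).length).sum) := by
  have h₁ := Ev.fold (O := O) (κ := κ) f (fun l : List β => Val.ofList (l.map h))
    (fun l x => (g x).reverse ++ l) (fun _ => True) (T := fun x => T x + 23 + 23 * (g x).length)
    hl (i := .const 0) (b₀ := []) (Ev.const 0 _) trivial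
    (b := .fold (.app b (.pair (.var 0) (.snd (.snd .env)))) (.var 1) (.pair (.var 0) (.var 1)))
    (fun x hx acc _ => ⟨by
      have h₂ : Ev O κ (.app b (.pair (.var 0) (.snd (.snd .env))))
          (.pair (f x) (.pair (.ofList (acc.map h)) v)) (.ofList ((g x).map h)) (T x + 8) := by
        refine (Ev.app (s := 7) (w := .pair (f x) v) ⟨rfl, ?_⟩ (hb x hx)).mono (by omega)
        simp [time]
      have h₃ := Ev.foldConst (O := O) (κ := κ) h (fun l : List β => Val.ofList (l.map h))
        (fun l x => x :: l) (fun _ => True) (T := 5) h₂ (b₀ := acc) (i := .var 1)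
        ⟨rfl, le_rfl⟩ trivial
        (fun x _ b _ => ⟨(Ev.var 0 _).pair (Ev.var 1 _), trivial⟩)
      rw [foldl_cons_eq] at h₃
      refine h₃.mono ?_
      simp only [time]
      omega, trivial⟩)
  have h₄ : ∀ acc : List β, xs.foldl (fun l x => (g x).reverse ++ l) acc =
      (xs.flatMap g).reverse ++ acc := by
    clear hl hb h₁
    induction xs with
    | nil => simp
    | cons x xs ih => simp [ih]
  rw [h₄, List.append_nil] at h₁
  have h₅ := h₁.app (ev_revE h (xs.flatMap g).reverse)
  rw [List.reverse_reverse] at h₅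
  refine h₅.mono ?_
  have h₆ : (xs.map fun x => 18 + (T x + 23 + 23 * (g x).length)).sum +
      (xs.flatMap g).length * 23 ≤ (xs.map fun x => T x + 60 + 50 * (g x).length).sum := by
    clear hl hb h₁ h₄ h₅
    induction xs with
    | nil => simp
    | cons x xs ih =>
      simp only [List.map_cons, List.sum_cons, List.flatMap_cons, List.length_append]
      omega
  rw [List.length_reverse]
  omega

theorem Ev.bindConst {α β : Type*} (f : α → Val) (h : β → Val) (g : α → List β) {l b : Exp}
    {v : Val} {xs : List α} {s T : ℕ} (hl : Ev O κ l v (.ofList (xs.map f)) s)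
    (hb : ∀ x ∈ xs, Ev O κ b (.pair (f x) v) (.ofList ((g x).map h)) T) :
    Ev O κ (bindE l b) v (.ofList ((xs.flatMap g).map h))
      (s + 40 + xs.length * (T + 60) + 50 * (xs.flatMap g).length) := by
  refine (Ev.bind f h g hl hb).mono ?_
  have : (xs.map fun x => T + 60 + 50 * (g x).length).sum =
      xs.length * (T + 60) + 50 * (xs.flatMap g).length := by
    clear hl hb
    induction xs with
    | nil => simp
    | cons x xs ih =>
      simp only [List.map_cons, List.sum_cons, List.flatMap_cons, List.length_append, ih,
        List.length_cons]
      ring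
  omega

/-- The list of the values of `b`, where `var 0` runs through the list `l`. -/
def mapE (l b : Exp) : Exp := bindE l (.pair b (.const 0))

theorem Ev.map {α β : Type*} (f : α → Val) (h : β → Val) (g : α → β) {l b : Exp}
    {v : Val} {xs : List α} {s : ℕ} {T : α → ℕ} (hl : Ev O κ l v (.ofList (xs.map f)) s)
    (hb : ∀ x ∈ xs, Ev O κ b (.pair (f x) v) (h (g x)) (T x)) :
    Ev O κ (mapE l b) v (.ofList ((xs.map g).map h))
      (s + 40 + (xs.map fun x => T x + 120).sum) := by
  have := Ev.bind f h (fun x => [g x]) (T := fun x => T x + 2) hl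
    (fun x hx => ((hb x hx).pair (Ev.const 0 _)).mono (by omega))
  rw [← List.map_eq_flatMap] at this
  refine this.mono ?_
  have : (xs.map fun x => T x + 2 + 60 + 50 * [g x].length).sum ≤
      (xs.map fun x => T x + 120).sum :=
    List.sum_le_sum fun x _ => by simp
  omega

theorem Ev.mapConst {α β : Type*} (f : α → Val) (h : β → Val) (g : α → β) {l b : Exp}
    {v : Val} {xs : List α} {s T : ℕ} (hl : Ev O κ l v (.ofList (xs.map f)) s)
    (hb : ∀ x ∈ xs, Ev O κ b (.pair (f x) v) (h (g x)) T) :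
    Ev O κ (mapE l b) v (.ofList ((xs.map g).map h)) (s + 40 + xs.length * (T + 120)) := by
  refine (Ev.map f h g hl hb).mono ?_
  have := sum_map_le_length_mul (xs := xs) (T := fun _ => T + 120) fun _ _ => le_rfl
  omega

/-- Concatenation of the lists `var 0` and `var 1`. -/
def appendE : Exp := .fold (.app revE (.var 0)) (.var 1) (.pair (.var 0) (.var 1))

theorem ev_appendE {α : Type*} (f : α → Val) (xs ys : List α) (ρ : Val) :
    Ev O κ appendE (.pair (.ofList (xs.map f)) (.pair (.ofList (ys.map f)) ρ))
      (.ofList ((xs ++ ys).map f)) (40 + xs.length * 50) := by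
  have h := Ev.foldConst (O := O) (κ := κ) f (fun l : List α => Val.ofList (l.map f))
    (fun l x => x :: l) (fun _ => True) (T := 5)
    ((Ev.var 0 (.pair (.ofList (xs.map f)) (.pair (.ofList (ys.map f)) ρ))).app (ev_revE f xs))
    (b₀ := ys) (Ev.var 1 _) trivial (fun x _ b _ => ⟨(Ev.var 0 _).pair (Ev.var 1 _), trivial⟩)
  rw [foldl_cons_eq, List.reverse_reverse] at h
  refine h.mono ?_
  rw [List.length_reverse]
  omega

/-- Equality of two numbers. -/
def eqE (a b : Exp) : Exp := .ite (.le a b) (.le b a) (.const 0)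

theorem Ev.eq {a b : Exp} {v : Val} {x y s t : ℕ} (ha : Ev O κ a v (.nat x) s)
    (hb : Ev O κ b v (.nat y) t) :
    Ev O κ (eqE a b) v (.nat (if x = y then 1 else 0))
      (2 * (s + t + Nat.size x + Nat.size y) + 8) := by
  have h := Ev.ite (p := x ≤ y) (ha.le hb) (by split_ifs <;> simp [*]) (fun _ => hb.le ha)
    (fun _ => Ev.const 0 v)
  have h' : (if x ≤ y then Val.nat (if y ≤ x then 1 else 0) else Val.nat 0) =
      .nat (if x = y then 1 else 0) := by
    split_ifs <;> first | rfl | omega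
  rw [h'] at h
  refine h.mono ?_
  have : max (t + s + Nat.size y + Nat.size x + 3) 1 = t + s + Nat.size y + Nat.size x + 3 :=
    max_eq_left (by omega)
  omega

/-- Membership of the number `var 0` in the list `var 1` of numbers. -/
def memE : Exp := .fold (.var 1) (.const 0) (.ite (eqE (.var 0) (.var 2)) (.const 1) (.var 1))

theorem size_le_of_le {n N : ℕ} (h : n ≤ N) : Nat.size n ≤ N := by
  rcases Nat.eq_zero_or_pos n with rfl | hn
  · simp
  · exact (Nat.size_le.mpr n.lt_two_pow_self).trans h

theorem ev_memE {N : ℕ} (x : ℕ) (hx : x ≤ N) (xs : List ℕ) (hxs : ∀ y ∈ xs, y ≤ N) (ρ : Val) :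
    Ev O κ memE (.pair (.nat x) (.pair (.ofList (xs.map .nat)) ρ))
      (.nat (if x ∈ xs then 1 else 0)) (20 + xs.length * (60 + 4 * N)) := by
  have h := Ev.foldConst (O := O) (κ := κ) Val.nat (fun b : Bool => Val.nat b.toNat)
    (fun b y => decide (y = x) || b) (fun _ => True) (T := 30 + 4 * N)
    (Ev.var 1 (.pair (.nat x) (.pair (.ofList (xs.map .nat)) ρ))) (b₀ := false)
    (i := .const 0) (Ev.const 0 _) trivial
    (b := .ite (eqE (.var 0) (.var 2)) (.const 1) (.var 1))
    (fun y hy b _ => ⟨by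
      have h₁ := Ev.ite (O := O) (κ := κ) (p := y = x)
        (Ev.eq (x := y) (y := x) (Ev.var 0 (.pair (.nat y) (.pair (.nat b.toNat)
          (.pair (.nat x) (.pair (.ofList (xs.map .nat)) ρ))))) (Ev.var 2 _))
        (by split_ifs <;> simp [*]) (fun _ => Ev.const 1 _) (fun _ => Ev.var 1 _)
      have h₂ := size_le_of_le hx
      have h₃ := size_le_of_le (hxs y hy)
      refine ⟨?_, h₁.2.trans ?_⟩
      · rw [h₁.1]
        by_cases hyx : y = x <;> simp [hyx, lookup, Val.fst, Val.snd]
      · simp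
        omega, trivial⟩)
  have h' : ∀ b : Bool, xs.foldl (fun b y => decide (y = x) || b) b = (decide (x ∈ xs) || b) := by
    clear h hxs
    induction xs with
    | nil => simp
    | cons y ys ih =>
      intro b
      rw [List.foldl_cons, ih, Bool.eq_iff_iff]
      simp only [Bool.or_eq_true, decide_eq_true_eq, List.mem_cons, eq_comm (a := y)]
      tauto
  rw [h', Bool.or_false] at h
  refine ⟨h.1.trans ?_, h.2.trans (by ring_nf; omega)⟩
  by_cases hx : x ∈ xs <;> simp [hx]

end Exp

/-! ### Listing the execution sequences -/

/-- The list of all execution sequences. -/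
def Workflow.seqs {S R : Type*} : Workflow S R → List (List (S ⊕ R))
  | .step s => [[Sum.inl s]]
  | .release r => [[Sum.inr r]]
  | .seq G₁ G₂ => G₁.seqs.flatMap fun a => G₂.seqs.map (a ++ ·)
  | .par G₁ G₂ => G₁.seqs.flatMap fun a => G₂.seqs.flatMap fun b => interleavings a b
  | .xor G₁ G₂ => G₁.seqs ++ G₂.seqs

/-- If a predicate separates the entries of `a` from those of `b`, both can be recovered from an
interleaving. -/
theorem filter_eq_of_mem_interleavings {α : Type*} (p : α → Bool) :
    ∀ (a b : List α), (∀ x ∈ a, p x = true) → (∀ x ∈ b, p x = false) →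
      ∀ l ∈ interleavings a b, l.filter p = a ∧ l.filter (fun x => !p x) = b
  | [], b, _, hb, l, h => by
    simp only [interleavings, List.mem_singleton] at h
    subst h
    simp only [List.filter_eq_nil_iff, List.filter_eq_self]
    simpa using hb
  | x :: a, [], ha, _, l, h => by
    simp only [interleavings, List.mem_singleton] at h
    subst h
    simp only [List.filter_eq_nil_iff, List.filter_eq_self]
    simpa using ha
  | x :: a, y :: b, ha, hb, l, h => by
    simp only [interleavings, List.mem_append, List.mem_map] at h
    rcases h with ⟨l, h, rfl⟩ | ⟨l, h, rfl⟩
    · have := filter_eq_of_mem_interleavings p a (y :: b)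
        (fun z hz => ha z (by simp [hz])) hb l h
      simp [ha x, this]
    · have := filter_eq_of_mem_interleavings p (x :: a) b ha
        (fun z hz => hb z (by simp [hz])) l h
      simp [hb y, this]
  termination_by a b => a.length + b.length

/-- Sequences with separated entries have pairwise different interleavings. -/
theorem nodup_interleavings {α : Type*} (p : α → Bool) :
    ∀ (a b : List α), (∀ x ∈ a, p x = true) → (∀ x ∈ b, p x = false) →
      (interleavings a b).Nodup
  | [], b, _, hb => by simp [interleavings]
  | x :: a, [], ha, _ => by simp [interleavings]
  | x :: a, y :: b, ha, hb => by
    have h₁ := nodup_interleavings p a (y :: b) (fun z hz => ha z (by simp [hz])) hb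
    have h₂ := nodup_interleavings p (x :: a) b ha (fun z hz => hb z (by simp [hz]))
    have hxy : x ≠ y := by
      rintro rfl
      have := ha x (by simp)
      rw [hb x (by simp)] at this
      exact Bool.noConfusion this
    simp only [interleavings]
    refine List.Nodup.append (h₁.map (List.cons_injective))
      (h₂.map (List.cons_injective)) fun l hl hl' => ?_
    simp only [List.mem_map] at hl hl'
    obtain ⟨u, _, rfl⟩ := hl
    obtain ⟨w, _, h⟩ := hl'
    simp only [List.cons.injEq] at h
    exact hxy h.1.symm
  termination_by a b => a.length + b.length

theorem Workflow.ne_nil_of_mem_seqs {S R : Type*} {G : Workflow S R} :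
    ∀ {σ : List (S ⊕ R)}, σ ∈ G.seqs → σ ≠ [] := by
  induction G with
  | step s => simp [Workflow.seqs]
  | release r => simp [Workflow.seqs]
  | seq G₁ G₂ h₁ h₂ =>
    intro σ h
    simp only [Workflow.seqs, List.mem_flatMap, List.mem_map] at h
    obtain ⟨a, ha, b, hb, rfl⟩ := h
    simp [h₁ ha]
  | par G₁ G₂ h₁ h₂ =>
    intro σ h
    simp only [Workflow.seqs, List.mem_flatMap] at h
    obtain ⟨a, ha, b, hb, h⟩ := h
    have hp := perm_append_of_mem_interleavings a b σ h
    rintro rfl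
    exact h₁ ha (List.append_eq_nil_iff.mp hp.nil_eq.symm).1
  | xor G₁ G₂ h₁ h₂ =>
    intro σ h
    simp only [Workflow.seqs, List.mem_append] at h
    exact h.elim h₁ h₂

section

variable {S R : Type*} [DecidableEq S] [DecidableEq R]

theorem Workflow.mem_seqs (G : Workflow S R) (σ : List (S ⊕ R)) :
    σ ∈ G.seqs ↔ σ ∈ G.execSeqs := by
  induction G generalizing σ with
  | step s => simp [Workflow.seqs, Workflow.execSeqs]
  | release r => simp [Workflow.seqs, Workflow.execSeqs]
  | seq G₁ G₂ h₁ h₂ => simp [Workflow.seqs, Workflow.execSeqs, h₁, h₂]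
  | par G₁ G₂ h₁ h₂ => simp [Workflow.seqs, Workflow.execSeqs, h₁, h₂]
  | xor G₁ G₂ h₁ h₂ => simp [Workflow.seqs, Workflow.execSeqs, h₁, h₂]

theorem Workflow.subset_vertices {G : Workflow S R} {σ : List (S ⊕ R)} (h : σ ∈ G.seqs) :
    σ ⊆ G.vertices :=
  (G.subperm_vertices σ ((G.mem_seqs σ).mp h)).subset

/-- Since the vertices are distinct, no execution sequence is listed twice; the length of the list
`seqs` is the number of execution sequences. -/
theorem Workflow.nodup_seqs (G : Workflow S R) (h : G.vertices.Nodup) : G.seqs.Nodup := by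
  classical
  induction G with
  | step s => simp [Workflow.seqs]
  | release r => simp [Workflow.seqs]
  | seq G₁ G₂ h₁ h₂ =>
    obtain ⟨n₁, n₂, hd⟩ := List.nodup_append'.mp h
    refine List.nodup_flatMap.mpr ⟨fun a _ => (h₂ n₂).map (List.append_right_injective a), ?_⟩
    refine (h₁ n₁).imp_of_mem fun {a a'} ha ha' hne l hl hl' => hne ?_
    simp only [List.mem_map] at hl hl'
    obtain ⟨b, hb, rfl⟩ := hl
    obtain ⟨b', hb', he⟩ := hl'
    -- the two parts of a concatenation are recovered by a filter, as their vertices are disjoint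
    have key : ∀ a b : List (S ⊕ R), a ∈ G₁.seqs → b ∈ G₂.seqs →
        (a ++ b).filter (fun v => decide (v ∈ G₁.vertices)) = a := by
      intro a b ha hb
      rw [List.filter_append, List.filter_eq_self.mpr, List.filter_eq_nil_iff.mpr,
        List.append_nil]
      · intro v hv
        simpa using fun hv' => hd hv' (Workflow.subset_vertices hb hv)
      · intro v hv
        simpa using Workflow.subset_vertices ha hv
    rw [← key a b ha hb, ← he, key a' b' ha' hb']
  | par G₁ G₂ h₁ h₂ =>
    obtain ⟨n₁, n₂, hd⟩ := List.nodup_append'.mp h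
    have key : ∀ a b : List (S ⊕ R), a ∈ G₁.seqs → b ∈ G₂.seqs →
        (∀ v ∈ a, decide (v ∈ G₁.vertices) = true) ∧
          ∀ v ∈ b, decide (v ∈ G₁.vertices) = false := by
      intro a b ha hb
      refine ⟨fun v hv => ?_, fun v hv => ?_⟩
      · simpa using Workflow.subset_vertices ha hv
      · simpa using fun hv' => hd hv' (Workflow.subset_vertices hb hv)
    refine List.nodup_flatMap.mpr ⟨fun a ha => List.nodup_flatMap.mpr ⟨fun b hb => ?_, ?_⟩, ?_⟩
    · exact nodup_interleavings _ a b (key a b ha hb).1 (key a b ha hb).2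
    · refine (h₂ n₂).imp_of_mem fun {b b'} hb hb' hne l hl hl' => hne ?_
      rw [← (filter_eq_of_mem_interleavings _ a b (key a b ha hb).1 (key a b ha hb).2 l hl).2,
        ← (filter_eq_of_mem_interleavings _ a b' (key a b' ha hb').1 (key a b' ha hb').2 l hl').2]
    · refine (h₁ n₁).imp_of_mem fun {a a'} ha ha' hne l hl hl' => hne ?_
      simp only [List.mem_flatMap] at hl hl'
      obtain ⟨b, hb, hl⟩ := hl
      obtain ⟨b', hb', hl'⟩ := hl'
      rw [← (filter_eq_of_mem_interleavings _ a b (key a b ha hb).1 (key a b ha hb).2 l hl).1,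
        ← (filter_eq_of_mem_interleavings _ a' b' (key a' b' ha' hb').1
          (key a' b' ha' hb').2 l hl').1]
  | xor G₁ G₂ h₁ h₂ =>
    obtain ⟨n₁, n₂, hd⟩ := List.nodup_append'.mp h
    refine List.Nodup.append (h₁ n₁) (h₂ n₂) fun l hl hl' => ?_
    -- a common sequence of both branches would have a common vertex, since it is not empty
    obtain ⟨v, hv⟩ := List.exists_mem_of_ne_nil _ (Workflow.ne_nil_of_mem_seqs hl)
    exact hd (Workflow.subset_vertices hl hv) (Workflow.subset_vertices hl' hv)

theorem Schema.sum_seqs {U M : Type*} [AddCommMonoid M] (W : Schema S R U)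
    (g : List (S ⊕ R) → M) :
    (W.workflow.seqs.map g).sum = ∑ σ ∈ W.execSeqs, g σ := by
  rw [← List.sum_toFinset g (W.workflow.nodup_seqs W.nodup_vertices)]
  refine Finset.sum_congr ?_ fun _ _ => rfl
  ext σ
  rw [List.mem_toFinset, Workflow.mem_seqs]
  rfl

/-! ### The number of execution sequences -/

/-- A choice of a branch at every xor branching determines the set of executed vertices. -/
theorem Workflow.card_image_toFinset_le (G : Workflow S R) :
    (G.execSeqs.image List.toFinset).card ≤ 2 ^ G.numXor := by
  -- serial and parallel composition multiply the numbers of vertex sets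
  have union : ∀ G₁ G₂ : Workflow S R,
      (G₁.execSeqs.image List.toFinset).card ≤ 2 ^ G₁.numXor →
      (G₂.execSeqs.image List.toFinset).card ≤ 2 ^ G₂.numXor →
      ∀ A : Finset (Finset (S ⊕ R)),
        (∀ V ∈ A, ∃ a ∈ G₁.execSeqs, ∃ b ∈ G₂.execSeqs, V = a.toFinset ∪ b.toFinset) →
        A.card ≤ 2 ^ (G₁.numXor + G₂.numXor) := by
    intro G₁ G₂ h₁ h₂ A hA
    refine (Finset.card_le_card (t := Finset.image₂ (· ∪ ·) (G₁.execSeqs.image List.toFinset)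
      (G₂.execSeqs.image List.toFinset)) fun V hV => ?_).trans ?_
    · obtain ⟨a, ha, b, hb, rfl⟩ := hA V hV
      exact Finset.mem_image₂_of_mem (Finset.mem_image_of_mem _ ha) (Finset.mem_image_of_mem _ hb)
    · refine (Finset.card_image₂_le _ _ _).trans ?_
      rw [pow_add]
      exact Nat.mul_le_mul h₁ h₂
  induction G with
  | step s => simp [Workflow.execSeqs, Workflow.numXor]
  | release r => simp [Workflow.execSeqs, Workflow.numXor]
  | seq G₁ G₂ h₁ h₂ =>
    refine union G₁ G₂ h₁ h₂ _ fun V hV => ?_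
    simp only [Workflow.execSeqs, Finset.mem_image, Finset.mem_image₂] at hV
    obtain ⟨_, ⟨a, ha, b, hb, rfl⟩, rfl⟩ := hV
    exact ⟨a, ha, b, hb, List.toFinset_append⟩
  | par G₁ G₂ h₁ h₂ =>
    refine union G₁ G₂ h₁ h₂ _ fun V hV => ?_
    simp only [Workflow.execSeqs, Finset.mem_image, Finset.mem_biUnion, Finset.mem_product,
      List.mem_toFinset] at hV
    obtain ⟨l, ⟨⟨a, b⟩, ⟨ha, hb⟩, hl⟩, rfl⟩ := hV
    refine ⟨a, ha, b, hb, ?_⟩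
    rw [← List.toFinset_append]
    exact List.toFinset_eq_of_perm _ _ (perm_append_of_mem_interleavings a b l hl)
  | xor G₁ G₂ h₁ h₂ =>
    -- `2 ^ a + 2 ^ b ≤ 2 ^ (a + b + 1)`
    rw [Workflow.execSeqs, Finset.image_union, Workflow.numXor]
    refine (Finset.card_union_le _ _).trans ((add_le_add h₁ h₂).trans ?_)
    rw [pow_succ, pow_add]
    have := Nat.one_le_two_pow (n := G₁.numXor)
    have := Nat.one_le_two_pow (n := G₂.numXor)
    nlinarith

/-- There are at most `2 ^ |ℬ|` sets of executed vertices, and a set with at most `|S| + |R|`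
members has at most `(|S| + |R|)!` orderings. -/
theorem Schema.length_seqs_le {U : Type*} [Fintype S] [Fintype R] (W : Schema S R U) :
    W.workflow.seqs.length ≤
      2 ^ W.workflow.numXor * Nat.factorial (Fintype.card S + Fintype.card R) := by
  rw [← List.toFinset_card_of_nodup (W.workflow.nodup_seqs W.nodup_vertices)]
  refine (Finset.card_le_card (t := (W.workflow.execSeqs.image List.toFinset).biUnion
    fun V => V.toList.permutations.toFinset) fun σ hσ => ?_).trans ?_
  · rw [List.mem_toFinset, Workflow.mem_seqs] at hσ
    rw [Finset.mem_biUnion]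
    refine ⟨σ.toFinset, Finset.mem_image_of_mem _ hσ, ?_⟩
    rw [List.mem_toFinset, List.mem_permutations]
    exact (List.toFinset_toList (W.nodup_of_mem_execSeqs hσ)).symm
  · refine Finset.card_biUnion_le_card_mul _ _ _ (fun V _ => ?_) |>.trans
      (Nat.mul_le_mul_right _ W.workflow.card_image_toFinset_le)
    refine (List.toFinset_card_le _).trans ?_
    rw [List.length_permutations, Finset.length_toList]
    refine Nat.factorial_le ((Finset.card_le_univ V).trans ?_)
    rw [Fintype.card_sum]

end

/-- The step from `m!` to `(m + k)!` costs at most a factor `(m + 1) ^ k * k!`. -/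
theorem factorial_add_le (m k : ℕ) :
    Nat.factorial (k + m) ≤ Nat.factorial m * (m + 1) ^ k * Nat.factorial k := by
  induction k with
  | zero => simp
  | succ k ih =>
    rw [show k + 1 + m = (k + m) + 1 by ring, Nat.factorial_succ, Nat.factorial_succ]
    calc (k + m + 1) * Nat.factorial (k + m)
        ≤ ((m + 1) * (k + 1)) * (Nat.factorial m * (m + 1) ^ k * Nat.factorial k) :=
          Nat.mul_le_mul (by nlinarith [Nat.zero_le (m * k)]) ih
      _ = _ := by ring

namespace Exp

variable {O : Val → ℕ} {κ : ℕ}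

/-! ### Programs that list the execution sequences -/

/-- One step of the generation of all interleavings of `a` and `b`: a state `(p, a, b)` consists of
the reversed prefix that has been generated so far and of the rests of the two sequences. -/
def expand {α : Type*} : List α × List α × List α → List (List α × List α × List α)
  | (p, x :: a, y :: b) => [(x :: p, a, y :: b), (y :: p, x :: a, b)]
  | (p, x :: a, []) => [(x :: p, a, [])]
  | (p, [], y :: b) => [(y :: p, [], b)]
  | (p, [], []) => [(p, [], [])]

/-- The encoding of a state of `expand`. -/
def encState {α : Type*} (f : α → Val) (s : List α × List α × List α) : Val :=
  .pair (.ofList (s.1.map f)) (.pair (.ofList (s.2.1.map f)) (.ofList (s.2.2.map f)))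

/-- The program for `expand`. -/
def expandE : Exp :=
  let p := Exp.fst (.var 0)
  let a := Exp.fst (.snd (.var 0))
  let b := Exp.snd (.snd (.var 0))
  let left := Exp.pair (.pair (.fst a) p) (.pair (.snd a) b)
  let right := Exp.pair (.pair (.fst b) p) (.pair a (.snd b))
  .ite (.isPair a)
    (.ite (.isPair b) (.pair left (.pair right (.const 0))) (.pair left (.const 0)))
    (.ite (.isPair b) (.pair right (.const 0)) (.pair (.var 0) (.const 0)))

theorem ev_expandE {α : Type*} (f : α → Val) (s : List α × List α × List α) (ρ : Val) :
    Ev O κ expandE (.pair (encState f s) ρ) (.ofList ((expand s).map (encState f))) 200 := by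
  rcases s with ⟨p, _ | ⟨x, a⟩, _ | ⟨y, b⟩⟩ <;>
  constructor <;>
  simp [expandE, eval, time, lookup, encState, Val.ofList, Val.fst, Val.snd, Val.isPair, Val.num,
    expand]

theorem foldl_flatMap_eq {α β : Type*} (g : α → List α) (xs : List β) (L : List α) :
    xs.foldl (fun L _ => L.flatMap g) L =
      L.flatMap fun s => xs.foldl (fun L _ => L.flatMap g) [s] := by
  induction xs generalizing L with
  | nil => simp
  | cons x xs ih =>
    rw [List.foldl_cons, ih, List.flatMap_assoc]
    refine List.flatMap_congr fun s _ => ?_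
    rw [List.foldl_cons, List.flatMap_singleton, ← ih]

theorem interleavings_nil_right {α : Type*} (a : List α) : interleavings a [] = [a] := by
  cases a <;> simp [interleavings]

/-- After enough rounds of `expand`, the states are exactly the completed interleavings, with
nothing left of `a` and `b`. -/
theorem foldl_expand {α β : Type*} (xs : List β) :
    ∀ (p a b : List α), a.length + b.length ≤ xs.length →
      xs.foldl (fun L _ => L.flatMap expand) [(p, a, b)] =
        (interleavings a b).map fun l => (l.reverse ++ p, [], []) := by
  induction xs with
  | nil =>
    intro p a b h
    simp only [List.length_nil, Nat.le_zero, Nat.add_eq_zero_iff, List.length_eq_zero_iff] at h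
    obtain ⟨rfl, rfl⟩ := h
    simp [interleavings]
  | cons _ xs ih =>
    intro p a b h
    rw [List.foldl_cons, List.flatMap_singleton, foldl_flatMap_eq]
    rw [List.length_cons] at h
    rcases a with _ | ⟨x, a⟩ <;> rcases b with _ | ⟨y, b⟩
    · simp [expand, ih, interleavings]
    · simp only [List.length_nil, List.length_cons] at h
      simp [expand, ih (y :: p) [] b (by simp; omega), interleavings]
    · simp only [List.length_nil, List.length_cons] at h
      simp [expand, ih (x :: p) a [] (by simp; omega), interleavings_nil_right]
    · simp only [List.length_cons] at h
      simp [expand, ih (x :: p) a (y :: b) (by simp; omega),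
        ih (y :: p) (x :: a) b (by simp; omega), interleavings, Function.comp_def]

/-- The number of interleavings that the states in the list will still produce is invariant.  Since
every state produces at least one, the list never becomes longer than the final result. -/
theorem sum_expand {α : Type*} (L : List (List α × List α × List α)) :
    ((L.flatMap expand).map fun s => (interleavings s.2.1 s.2.2).length).sum =
      (L.map fun s => (interleavings s.2.1 s.2.2).length).sum := by
  induction L with
  | nil => rfl
  | cons s L ih =>
    rw [List.flatMap_cons, List.map_append, List.sum_append, ih, List.map_cons, List.sum_cons]
    congr 1
    rcases s with ⟨p, _ | ⟨x, a⟩, _ | ⟨y, b⟩⟩ <;>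
    simp [expand, interleavings, interleavings_nil_right]

theorem length_le_sum_of_pos {α : Type*} {g : α → ℕ} {L : List α} (h : ∀ x ∈ L, 0 < g x) :
    L.length ≤ (L.map g).sum := by
  induction L with
  | nil => simp
  | cons x L ih =>
    have h₁ := h x (by simp)
    have h₂ := ih fun y hy => h y (by simp [hy])
    simp only [List.length_cons, List.map_cons, List.sum_cons]
    omega

/-- All interleavings of a sequence in the list `var 0` with one in the list `var 1`; the length of
`var 2` bounds the length of the results. -/
def interE : Exp :=
  mapE
    (.fold (.var 2)
      (bindE (.var 0) (mapE (.var 2) (.pair (.const 0) (.pair (.var 1) (.var 0)))))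
      (bindE (.var 1) expandE))
    (.app revE (.fst (.var 0)))

/-- The running time is linear in the bound `X` for the length of the result. -/
theorem ev_interE {α β : Type*} (f : α → Val) (h : β → Val) (A B : List (List α)) (F : List β)
    (ρ : Val) {X N : ℕ} (hN : 1000 ≤ N) (hF : F.length ≤ N)
    (hAB : ∀ a ∈ A, ∀ b ∈ B, a.length + b.length ≤ F.length) (hA : A.length ≤ X)
    (hX : (A.flatMap fun a => B.flatMap fun b => interleavings a b).length ≤ X) :
    Ev O κ interE (.pair (.ofList (A.map fun a => .ofList (a.map f)))
        (.pair (.ofList (B.map fun a => .ofList (a.map f))) (.pair (.ofList (F.map h)) ρ)))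
      (.ofList ((A.flatMap fun a => B.flatMap fun b => interleavings a b).map
        fun a => .ofList (a.map f))) ((X + 1) * N ^ 3) := by
  set v := Val.pair (.ofList (A.map fun a => .ofList (a.map f)))
        (.pair (.ofList (B.map fun a => .ofList (a.map f))) (.pair (.ofList (F.map h)) ρ)) with hv
  set L₀ : List (List α × List α × List α) := A.flatMap fun a => B.map fun b => ([], a, b) with hL₀
  have hpos : ∀ s : List α × List α × List α, 0 < (interleavings s.2.1 s.2.2).length :=
    fun s => List.length_pos_iff.mpr (interleavings_ne_nil _ _)
  -- the initial states still have to produce the whole result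
  have hsum : (L₀.map fun s => (interleavings s.2.1 s.2.2).length).sum ≤ X := by
    refine le_trans (le_of_eq ?_) hX
    rw [hL₀, List.map_flatMap, List.length_flatMap]
    rw [List.flatMap_def, List.sum_flatten, List.map_map]
    congr 1
    refine List.map_congr_left fun a _ => ?_
    simp [List.length_flatMap, Function.comp_def]
  have hL₀X : L₀.length ≤ X := (length_le_sum_of_pos fun s _ => hpos s).trans hsum
  have h₁ : Ev O κ (bindE (.var 0) (mapE (.var 2) (.pair (.const 0) (.pair (.var 1) (.var 0)))))
      v (.ofList (L₀.map (encState f))) (41 + X * 300 + X * 300) := by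
    have := Ev.bind (O := O) (κ := κ) (fun a => Val.ofList (a.map f)) (encState f)
      (fun a => B.map fun b => (([] : List α), a, b)) (T := fun _ => 50 + B.length * 130)
      (Ev.var 0 v) (fun a _ =>
      (Ev.mapConst (fun a => Val.ofList (a.map f)) (encState f) (fun b => (([] : List α), a, b))
        (T := 8) (b := .pair (.const 0) (.pair (.var 1) (.var 0)))
        (Ev.var 2 (.pair (.ofList (a.map f)) v)) (fun b _ => ⟨rfl, by simp [time]⟩)).mono
          (by omega))
    refine this.mono ?_
    have h₂ : (A.map fun a => 50 + B.length * 130 + 60 +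
        50 * (B.map fun b => (([] : List α), a, b)).length).sum ≤
        A.length * 300 + L₀.length * 300 := by
      rw [hL₀]
      clear this hAB hA hX hv hL₀ hsum hL₀X
      induction A with
      | nil => simp
      | cons a A ih =>
        simp only [List.map_cons, List.sum_cons, List.length_cons, List.flatMap_cons,
          List.length_append, List.length_map] at ih ⊢
        omega
    have := Nat.mul_le_mul_right 300 hA
    have := Nat.mul_le_mul_right 300 hL₀X
    omega
  -- the invariant bounds the length of every intermediate list of states by `X`
  have h₂ := Ev.foldConst (O := O) (κ := κ) h
    (fun L : List (List α × List α × List α) => Val.ofList (L.map (encState f)))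
    (fun L _ => L.flatMap expand)
    (fun L => (L.map fun s => (interleavings s.2.1 s.2.2).length).sum ≤ X)
    (T := 43 + X * 260 + 50 * X) (Ev.var 2 v) h₁ hsum (b := bindE (.var 1) expandE)
    (fun x _ L hL => by
      have hL' : (L.flatMap expand).length ≤ X := by
        rw [← sum_expand] at hL
        exact (length_le_sum_of_pos fun s _ => hpos s).trans hL
      have hL'' : L.length ≤ X := (length_le_sum_of_pos fun s _ => hpos s).trans hL
      refine ⟨(Ev.bindConst (encState f) (encState f) expand (T := 200) (Ev.var 1 _)
        (fun s _ => ev_expandE f s _)).mono ?_, by rwa [sum_expand]⟩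
      have := Nat.mul_le_mul_right 260 hL''
      omega)
  -- as many rounds as `F` has members complete all interleavings
  have h₃ : F.foldl (fun L _ => L.flatMap expand) L₀ =
      (A.flatMap fun a => B.flatMap fun b => interleavings a b).map
        fun l => (l.reverse, [], []) := by
    rw [foldl_flatMap_eq, hL₀, List.flatMap_assoc, List.map_flatMap]
    refine List.flatMap_congr fun a ha => ?_
    rw [List.flatMap_map, List.map_flatMap]
    refine List.flatMap_congr fun b hb => ?_
    rw [foldl_expand F [] a b (hAB a ha b hb)]
    simp
  rw [h₃] at h₂
  have h₄ := Ev.mapConst (O := O) (κ := κ) (encState f) (fun a => Val.ofList (a.map f))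
    (fun s => s.1.reverse) (T := 18 + N * 23) h₂ (b := .app revE (.fst (.var 0)))
    (fun s hs => by
      obtain ⟨l, hl, rfl⟩ := List.mem_map.mp hs
      obtain ⟨a, ha, hl⟩ := List.mem_flatMap.mp hl
      obtain ⟨b, hb, hl⟩ := List.mem_flatMap.mp hl
      have h₅ := (perm_append_of_mem_interleavings a b l hl).length_eq
      rw [List.length_append] at h₅
      have h₆ := hAB a ha b hb
      refine (Ev.app (s := 3) ⟨rfl, by simp [time]⟩ (ev_revE f l.reverse)).mono ?_
      rw [List.length_reverse]
      omega)
  have h₅ : ∀ L : List (List α), (L.map fun l => (l.reverse, ([] : List α), ([] : List α))).map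
      (fun s => s.1.reverse) = L := fun L => by simp [Function.comp_def]
  rw [h₅, List.length_map] at h₄
  refine h₄.mono ?_
  have e₁ := Nat.mul_le_mul_right (18 + N * 23 + 120) hX
  have e₂ := Nat.mul_le_mul_right (18 + (43 + X * 260 + 50 * X)) hF
  refine (Nat.add_le_add (Nat.add_le_add_right (Nat.add_le_add_left e₂ _) _) e₁).trans ?_
  nlinarith [Nat.mul_le_mul hN hN, Nat.zero_le X, Nat.zero_le (X * N),
    Nat.mul_le_mul (Nat.mul_le_mul hN hN) (le_refl N),
    Nat.mul_le_mul_left (X) (Nat.mul_le_mul (Nat.mul_le_mul hN hN) (le_refl N)),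
    Nat.mul_le_mul_left X hN]

/-- All concatenations of a sequence in the list `var 0` with one in the list `var 1`. -/
def concatE : Exp :=
  bindE (.var 0) (mapE (.var 2) (.app appendE (.pair (.var 1) (.pair (.var 0) (.const 0)))))

theorem ev_concatE {α : Type*} (f : α → Val) (A B : List (List α))
    (ρ : Val) {X N : ℕ} (hN : 1000 ≤ N) (hA : A.length ≤ X) (hAN : ∀ a ∈ A, a.length ≤ N)
    (hX : (A.flatMap fun a => B.map (a ++ ·)).length ≤ X) :
    Ev O κ concatE (.pair (.ofList (A.map fun a => .ofList (a.map f)))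
        (.pair (.ofList (B.map fun a => .ofList (a.map f))) ρ))
      (.ofList ((A.flatMap fun a => B.map (a ++ ·)).map
        fun a => .ofList (a.map f))) ((X + 1) * N ^ 3) := by
  set v := Val.pair (.ofList (A.map fun a => .ofList (a.map f)))
        (.pair (.ofList (B.map fun a => .ofList (a.map f))) ρ) with hv
  have := Ev.bind (O := O) (κ := κ) (fun a => Val.ofList (a.map f))
    (fun a => Val.ofList (a.map f))
    (fun a => B.map (a ++ ·)) (T := fun _ => 50 + B.length * (180 + N * 50))
    (Ev.var 0 v) (b := mapE (.var 2) (.app appendE (.pair (.var 1) (.pair (.var 0) (.const 0)))))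
    (fun a ha =>
    (Ev.mapConst (fun a => Val.ofList (a.map f)) (fun a => Val.ofList (a.map f)) (a ++ ·)
      (T := 52 + N * 50) (Ev.var 2 (.pair (.ofList (a.map f)) v))
      (fun b _ => (Ev.app (s := 7) ⟨rfl, by simp [time]⟩ (ev_appendE f a b _)).mono
        (by have := hAN a ha; omega))).mono (by
          have : B.length * (52 + N * 50 + 120) ≤ B.length * (180 + N * 50) :=
            Nat.mul_le_mul_left _ (by omega)
          omega))
  refine this.mono ?_
  have h₂ : (A.map fun a => 50 + B.length * (180 + N * 50) + 60 +
      50 * (B.map (a ++ ·)).length).sum ≤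
      A.length * 110 + (A.flatMap fun a => B.map (a ++ ·)).length * (230 + N * 50) := by
    clear this hAN hA hX hv
    induction A with
    | nil => simp
    | cons a A ih =>
      simp only [List.map_cons, List.sum_cons, List.length_cons, List.flatMap_cons,
        List.length_append, List.length_map] at ih ⊢
      refine (Nat.add_le_add_left ih _).trans (le_of_eq ?_)
      ring
  have e₁ := Nat.mul_le_mul_right 110 hA
  have e₂ := Nat.mul_le_mul_right (230 + N * 50) hX
  refine (Nat.add_le_add_left (h₂.trans (Nat.add_le_add e₁ e₂)) _).trans ?_
  nlinarith [Nat.mul_le_mul hN hN, Nat.zero_le X, Nat.zero_le (X * N),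
    Nat.mul_le_mul (Nat.mul_le_mul hN hN) (le_refl N),
    Nat.mul_le_mul_left (X) (Nat.mul_le_mul (Nat.mul_le_mul hN hN) (le_refl N)),
    Nat.mul_le_mul_left X hN]

end Exp

/-- The encoding of a vertex, as in `Workflow.code`. -/
def encV {k m : ℕ} : Fin k ⊕ Fin m → Val
  | Sum.inl s => .pair (.nat 0) (.nat s)
  | Sum.inr r => .pair (.nat 1) (.nat r)

/-- The encoding of an execution sequence. -/
def encSeq {k m : ℕ} (σ : List (Fin k ⊕ Fin m)) : Val := .ofList (σ.map encV)

namespace Exp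

variable {O : Val → ℕ} {κ : ℕ}

/-- One step of the evaluation of a workflow in reverse Polish notation: `var 0` is a token, `var 1`
is the stack, whose entries are lists of sequences, and `var 2` is the whole workflow. -/
def tokenE : Exp :=
  .ite (.isPair (.var 0))
    (.pair (.pair (.pair (.var 0) (.const 0)) (.const 0)) (.var 1))
    (.pair
      (.app
        (.ite (.var 3) (.ite (.le (.var 3) (.const 1)) interE (.app appendE .env)) concatE)
        (.pair (.fst (.snd (.var 1))) (.pair (.fst (.var 1)) (.pair (.var 2) (.pair (.var 0)
          (.const 0))))))
      (.snd (.snd (.var 1))))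

/-- The list of all execution sequences of the workflow `var 0`. -/
def seqsE : Exp := .fst (.fold (.var 0) (.const 0) tokenE)

end Exp

theorem Workflow.seqs_ne_nil {S R : Type*} (G : Workflow S R) : G.seqs ≠ [] := by
  classical
  obtain ⟨σ, hσ⟩ := G.execSeqs_nonempty
  exact List.ne_nil_of_mem ((G.mem_seqs σ).mpr hσ)

theorem Workflow.length_vertices_le {k m : ℕ} (G : Workflow (Fin k) (Fin m)) :
    G.vertices.length ≤ G.code.length := by
  induction G with
  | step s => simp [Workflow.vertices, Workflow.code]
  | release r => simp [Workflow.vertices, Workflow.code]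
  | seq G₁ G₂ h₁ h₂ => simp only [Workflow.vertices, Workflow.code, List.length_append]; omega
  | par G₁ G₂ h₁ h₂ => simp only [Workflow.vertices, Workflow.code, List.length_append]; omega
  | xor G₁ G₂ h₁ h₂ => simp only [Workflow.vertices, Workflow.code, List.length_append]; omega

theorem Workflow.length_le_of_mem_seqs {S R : Type*} {G : Workflow S R} {σ : List (S ⊕ R)}
    (h : σ ∈ G.seqs) : σ.length ≤ G.vertices.length := by
  classical
  exact (G.subperm_vertices σ ((G.mem_seqs σ).mp h)).length_le

theorem length_le_length_flatMap {α β : Type*} {A : List α} {g : α → List β}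
    (h : ∀ a ∈ A, g a ≠ []) : A.length ≤ (A.flatMap g).length := by
  rw [List.length_flatMap]
  exact Exp.length_le_sum_of_pos fun a ha => List.length_pos_iff.mpr (h a ha)

theorem length_le_length_flatMap_right {α β γ : Type*} {A : List α} {B : List β}
    {g : α → List γ} (hA : A ≠ []) (h : ∀ a ∈ A, B.length ≤ (g a).length) :
    B.length ≤ (A.flatMap g).length := by
  obtain ⟨a, A, rfl⟩ := List.exists_cons_of_ne_nil hA
  rw [List.flatMap_cons, List.length_append]
  exact (h a (by simp)).trans (Nat.le_add_right _ _)

namespace Exp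

variable {O : Val → ℕ} {κ : ℕ}

/-- The token `n` of a binary operation is applied to the two topmost entries of the stack; the
second operand is on top. -/
theorem ev_tokenE_op {k m : ℕ} (n : ℕ) (A B C : List (List (Fin k ⊕ Fin m))) (ρ st ρ' : Val)
    {T : ℕ} (hn : n ≤ 2)
    (h : Ev O κ (if n = 0 then concatE else if n = 1 then interE else .app appendE .env)
      (.pair (.ofList (A.map encSeq)) (.pair (.ofList (B.map encSeq))
        (.pair ρ (.pair (.nat n) (.nat 0))))) (.ofList (C.map encSeq)) T) :
    Ev O κ tokenE (.pair (.nat n) (.pair (.pair (.ofList (B.map encSeq))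
        (.pair (.ofList (A.map encSeq)) st)) (.pair ρ ρ')))
      (.pair (.ofList (C.map encSeq)) st) (T + 100) := by
  obtain ⟨h₁, h₂⟩ := h
  have : n = 0 ∨ n = 1 ∨ n = 2 := by omega
  rcases this with rfl | rfl | rfl
  · simp only [if_true] at h₁ h₂
    constructor
    · simp [tokenE, eval, lookup, Val.fst, Val.snd, Val.isPair, Val.num, h₁]
    · simp [tokenE, eval, time, lookup, Val.fst, Val.snd, Val.isPair, Val.num]
      omega
  · simp only [one_ne_zero, if_false, if_true] at h₁ h₂
    constructor
    · simp [tokenE, eval, lookup, Val.fst, Val.snd, Val.isPair, Val.num, h₁]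
    · simp [tokenE, eval, time, lookup, Val.fst, Val.snd, Val.isPair, Val.num]
      omega
  · simp only [OfNat.ofNat_ne_zero, OfNat.ofNat_ne_one, if_false] at h₁ h₂
    have h2 : Nat.size 2 = 2 := rfl
    constructor
    · simp [tokenE, eval, lookup, Val.fst, Val.snd, Val.isPair, Val.num] at h₁ ⊢
      exact h₁
    · simp [tokenE, eval, time, lookup, Val.fst, Val.snd, Val.isPair, Val.num, h2] at h₂ ⊢
      omega

/-- The evaluation of the reverse Polish notation of `G` in front of further tokens pushes the list
of the execution sequences of `G` on the stack.  The value of the stack and the running time are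
treated together, since the time bounds for the operations require the lengths of the lists on the
stack. -/
theorem foldl_code {k m : ℕ} (F ρ : Val) (fs : List Val) (hF : F = .ofList fs) {X N : ℕ}
    (hN : 1000 ≤ N) (hFN : fs.length ≤ N) (G : Workflow (Fin k) (Fin m)) :
    G.vertices.length ≤ fs.length → G.seqs.length ≤ X → ∀ (tail : List Val) (st : Val),
      (G.code ++ tail).foldl
        (fun acc x => eval O tokenE (.pair x (.pair acc (.pair F ρ)))) st =
      tail.foldl (fun acc x => eval O tokenE (.pair x (.pair acc (.pair F ρ))))
        (.pair (.ofList (G.seqs.map encSeq)) st) ∧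
      foldTime (fun x acc => eval O tokenE (.pair x (.pair acc (.pair F ρ))))
        (fun x acc => time O κ tokenE (.pair x (.pair acc (.pair F ρ)))) (G.code ++ tail) st ≤
      G.code.length * ((X + 1) * N ^ 3 + 200) +
        foldTime (fun x acc => eval O tokenE (.pair x (.pair acc (.pair F ρ))))
          (fun x acc => time O κ tokenE (.pair x (.pair acc (.pair F ρ)))) tail
          (.pair (.ofList (G.seqs.map encSeq)) st) := by
  -- the inductive step, for any operation for which the program of the token `n` is correct
  have op : ∀ (G₁ G₂ G : Workflow (Fin k) (Fin m)) (n : ℕ), n ≤ 2 →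
      G.code = G₁.code ++ G₂.code ++ [.nat n] → G.vertices = G₁.vertices ++ G₂.vertices →
      G₁.seqs.length ≤ G.seqs.length → G₂.seqs.length ≤ G.seqs.length →
      (G.vertices.length ≤ fs.length → G.seqs.length ≤ X →
        Ev O κ (if n = 0 then concatE else if n = 1 then interE else .app appendE .env)
        (.pair (.ofList (G₁.seqs.map encSeq)) (.pair (.ofList (G₂.seqs.map encSeq))
          (.pair F (.pair (.nat n) (.nat 0))))) (.ofList (G.seqs.map encSeq))
          ((X + 1) * N ^ 3 + 60)) →
      (G₁.vertices.length ≤ fs.length → G₁.seqs.length ≤ X → ∀ (tail : List Val) (st : Val),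
        (G₁.code ++ tail).foldl
          (fun acc x => eval O tokenE (.pair x (.pair acc (.pair F ρ)))) st =
        tail.foldl (fun acc x => eval O tokenE (.pair x (.pair acc (.pair F ρ))))
          (.pair (.ofList (G₁.seqs.map encSeq)) st) ∧
        foldTime (fun x acc => eval O tokenE (.pair x (.pair acc (.pair F ρ))))
          (fun x acc => time O κ tokenE (.pair x (.pair acc (.pair F ρ)))) (G₁.code ++ tail) st ≤
        G₁.code.length * ((X + 1) * N ^ 3 + 200) +
          foldTime (fun x acc => eval O tokenE (.pair x (.pair acc (.pair F ρ))))
            (fun x acc => time O κ tokenE (.pair x (.pair acc (.pair F ρ)))) tail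
            (.pair (.ofList (G₁.seqs.map encSeq)) st)) →
      (G₂.vertices.length ≤ fs.length → G₂.seqs.length ≤ X → ∀ (tail : List Val) (st : Val),
        (G₂.code ++ tail).foldl
          (fun acc x => eval O tokenE (.pair x (.pair acc (.pair F ρ)))) st =
        tail.foldl (fun acc x => eval O tokenE (.pair x (.pair acc (.pair F ρ))))
          (.pair (.ofList (G₂.seqs.map encSeq)) st) ∧
        foldTime (fun x acc => eval O tokenE (.pair x (.pair acc (.pair F ρ))))
          (fun x acc => time O κ tokenE (.pair x (.pair acc (.pair F ρ)))) (G₂.code ++ tail) st ≤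
        G₂.code.length * ((X + 1) * N ^ 3 + 200) +
          foldTime (fun x acc => eval O tokenE (.pair x (.pair acc (.pair F ρ))))
            (fun x acc => time O κ tokenE (.pair x (.pair acc (.pair F ρ)))) tail
            (.pair (.ofList (G₂.seqs.map encSeq)) st)) →
      G.vertices.length ≤ fs.length → G.seqs.length ≤ X → ∀ (tail : List Val) (st : Val),
        (G.code ++ tail).foldl
          (fun acc x => eval O tokenE (.pair x (.pair acc (.pair F ρ)))) st =
        tail.foldl (fun acc x => eval O tokenE (.pair x (.pair acc (.pair F ρ))))
          (.pair (.ofList (G.seqs.map encSeq)) st) ∧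
        foldTime (fun x acc => eval O tokenE (.pair x (.pair acc (.pair F ρ))))
          (fun x acc => time O κ tokenE (.pair x (.pair acc (.pair F ρ)))) (G.code ++ tail) st ≤
        G.code.length * ((X + 1) * N ^ 3 + 200) +
          foldTime (fun x acc => eval O tokenE (.pair x (.pair acc (.pair F ρ))))
            (fun x acc => time O κ tokenE (.pair x (.pair acc (.pair F ρ)))) tail
            (.pair (.ofList (G.seqs.map encSeq)) st) := by
    intro G₁ G₂ G n hn hcode hvert hs₁ hs₂ hop h₁ h₂ hv hs tail st
    rw [hvert, List.length_append] at hv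
    obtain ⟨h₃, h₄⟩ := h₁ (by omega) (by omega) (G₂.code ++ (.nat n :: tail)) st
    obtain ⟨h₅, h₆⟩ := h₂ (by omega) (by omega) (.nat n :: tail)
      (.pair (.ofList (G₁.seqs.map encSeq)) st)
    have h₇ := ev_tokenE_op (ρ' := ρ) (st := st) n G₁.seqs G₂.seqs G.seqs F hn
      (hop (by rwa [hvert, List.length_append]) hs)
    rw [hcode]
    simp only [List.append_assoc, List.singleton_append] at h₃ h₄ ⊢
    rw [h₃, h₅, List.foldl_cons, h₇.1]
    refine ⟨rfl, h₄.trans ((Nat.add_le_add_left h₆ _).trans ?_)⟩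
    have h₈ := h₇.2
    simp only [foldTime, h₇.1, List.length_append, List.length_cons, List.length_nil]
    have e : (G₁.code.length + (G₂.code.length + (0 + 1))) * ((X + 1) * N ^ 3 + 200) =
      G₁.code.length * ((X + 1) * N ^ 3 + 200) + G₂.code.length * ((X + 1) * N ^ 3 + 200) +
        ((X + 1) * N ^ 3 + 200) := by ring
    omega
  have single : ∀ (G : Workflow (Fin k) (Fin m)) (v : Fin k ⊕ Fin m), G.code = [encV v] →
      G.seqs = [[v]] → ∀ (tail : List Val) (st : Val),
        (G.code ++ tail).foldl
          (fun acc x => eval O tokenE (.pair x (.pair acc (.pair F ρ)))) st =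
        tail.foldl (fun acc x => eval O tokenE (.pair x (.pair acc (.pair F ρ))))
          (.pair (.ofList (G.seqs.map encSeq)) st) ∧
        foldTime (fun x acc => eval O tokenE (.pair x (.pair acc (.pair F ρ))))
          (fun x acc => time O κ tokenE (.pair x (.pair acc (.pair F ρ)))) (G.code ++ tail) st ≤
        G.code.length * ((X + 1) * N ^ 3 + 200) +
          foldTime (fun x acc => eval O tokenE (.pair x (.pair acc (.pair F ρ))))
            (fun x acc => time O κ tokenE (.pair x (.pair acc (.pair F ρ)))) tail
            (.pair (.ofList (G.seqs.map encSeq)) st) := by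
    intro G v hcode hs tail st
    have h : Ev O κ tokenE (.pair (encV v) (.pair st (.pair F ρ)))
        (.pair (.ofList ([[v]].map encSeq)) st) 100 := by
      rcases v with s | r <;> constructor <;>
      simp [tokenE, eval, time, lookup, Val.fst, Val.snd, Val.isPair, Val.num, encV, encSeq,
        Val.ofList]
    rw [hcode, hs, List.singleton_append, List.foldl_cons, h.1]
    refine ⟨rfl, ?_⟩
    have := h.2
    simp only [foldTime, h.1, List.length_cons, List.length_nil]
    omega
  induction G with
  | step s => exact fun _ _ => single _ (Sum.inl s) rfl rfl
  | release r => exact fun _ _ => single _ (Sum.inr r) rfl rfl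
  | seq G₁ G₂ h₁ h₂ =>
    have hl : G₁.seqs.length ≤ (Workflow.seq G₁ G₂).seqs.length :=
      length_le_length_flatMap fun a _ => by simpa using G₂.seqs_ne_nil
    refine op G₁ G₂ _ 0 (by omega) rfl rfl hl
      (length_le_length_flatMap_right G₁.seqs_ne_nil fun a _ => by simp) (fun hv hs => ?_) h₁ h₂
    simp only [if_true]
    refine (ev_concatE encV G₁.seqs G₂.seqs _ hN (hl.trans hs) (fun a ha => ?_) hs).mono
      (by omega)
    have := Workflow.length_le_of_mem_seqs ha
    rw [Workflow.vertices, List.length_append] at hv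
    omega
  | par G₁ G₂ h₁ h₂ =>
    have hl : G₁.seqs.length ≤ (Workflow.par G₁ G₂).seqs.length :=
      length_le_length_flatMap fun a _ => by
        obtain ⟨b, B, hB⟩ := List.exists_cons_of_ne_nil G₂.seqs_ne_nil
        simp [hB, interleavings_ne_nil]
    refine op G₁ G₂ _ 1 (by omega) rfl rfl hl
      (length_le_length_flatMap_right G₁.seqs_ne_nil fun a _ =>
        length_le_length_flatMap fun b _ => interleavings_ne_nil a b) (fun hv hs => ?_) h₁ h₂
    simp only [one_ne_zero, if_false, if_true]
    have hF' : F = .ofList (fs.map id) := by rw [List.map_id, hF]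
    rw [hF']
    refine (ev_interE encV id G₁.seqs G₂.seqs fs _ hN hFN (fun a ha b hb => ?_) (hl.trans hs)
      hs).mono (by omega)
    have := Workflow.length_le_of_mem_seqs ha
    have := Workflow.length_le_of_mem_seqs hb
    rw [Workflow.vertices, List.length_append] at hv
    omega
  | xor G₁ G₂ h₁ h₂ =>
    refine op G₁ G₂ _ 2 (by omega) rfl rfl (by simp [Workflow.seqs]) (by simp [Workflow.seqs])
      (fun hv hs => ?_) h₁ h₂
    simp only [OfNat.ofNat_ne_zero, OfNat.ofNat_ne_one, if_false]
    refine (Ev.app (Ev.env _) (ev_appendE encSeq G₁.seqs G₂.seqs _)).mono ?_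
    simp only [Workflow.seqs, List.length_append] at hs
    have : 50 ≤ N ^ 3 := by nlinarith [Nat.mul_le_mul hN hN]
    nlinarith [Nat.zero_le (X * N ^ 3)]

theorem ev_seqsE {k m : ℕ} (G : Workflow (Fin k) (Fin m)) (ρ : Val) {X N : ℕ}
    (hN : 1000 ≤ N) (hGN : G.code.length ≤ N) (hX : G.seqs.length ≤ X) :
    Ev O κ seqsE (.pair (.ofList G.code) ρ) (.ofList (G.seqs.map encSeq)) ((X + 1) * N ^ 5) := by
  obtain ⟨h₁, h₂⟩ := foldl_code (O := O) (κ := κ) (.ofList G.code) ρ G.code rfl hN hGN G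
    G.length_vertices_le hX [] (.nat 0)
  rw [List.append_nil] at h₁ h₂
  refine ⟨?_, ?_⟩
  · simp only [seqsE, eval, lookup, Val.fst, Val.toList_ofList, h₁, List.foldl_nil]
  · have e₁ := Nat.mul_le_mul_right ((X + 1) * N ^ 3 + 200) hGN
    have e₂ : 1 * 1000 ^ 3 ≤ (X + 1) * N ^ 3 :=
      Nat.mul_le_mul (by omega) (Nat.pow_le_pow_left hN 3)
    have e₃ : N * ((X + 1) * N ^ 3 + 200) + 100 ≤ N * ((X + 1) * N ^ 3 * 2) := by
      nlinarith
    have e₄ : N * ((X + 1) * N ^ 3 * 2) ≤ (X + 1) * N ^ 5 := by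
      have : N * ((X + 1) * N ^ 3 * 2) = (X + 1) * N ^ 4 * 2 := by ring
      rw [this, show (X + 1) * N ^ 5 = (X + 1) * N ^ 4 * N by ring]
      exact Nat.mul_le_mul_left _ (by omega)
    simp only [foldTime] at h₂
    simp only [seqsE, time, eval, lookup, Val.fst, Val.toList_ofList]
    omega

end Exp

/-! ### Keys of execution arrangements -/

/-- The number of release points in a sequence. -/
def numRel {S R : Type*} (σ : List (S ⊕ R)) : ℕ := σ.countP Sum.isRight

theorem releaseSeq_cons_inr {S R : Type*} (r : R) (σ : List (S ⊕ R)) :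
    releaseSeq (Sum.inr r :: σ) = r :: releaseSeq σ := rfl

theorem releaseSeq_cons_inl {S R : Type*} (s : S) (σ : List (S ⊕ R)) :
    releaseSeq (Sum.inl s :: σ) = releaseSeq σ := rfl

theorem nodup_releaseSeq {S R : Type*} {σ : List (S ⊕ R)} (hσ : σ.Nodup) :
    (releaseSeq σ).Nodup := by
  refine hσ.filterMap fun a a' b h h' => ?_
  rw [Option.mem_def, Sum.getRight?_eq_some_iff] at h h'
  rw [h, h']

theorem numRel_eq_length {S R : Type*} (σ : List (S ⊕ R)) : numRel σ = (releaseSeq σ).length := by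
  induction σ with
  | nil => rfl
  | cons x σ ih =>
    unfold numRel releaseSeq at *
    rcases x with s | r
    · rw [List.countP_cons_of_neg (by simp), List.filterMap_cons_none rfl, ih]
    · rw [List.countP_cons_of_pos rfl, ih]
      rfl

section

variable {S R : Type*} [DecidableEq S] [DecidableEq R]

open Classical in
/-- The key of a vertex `v`: it is `0` if `v` does not occur, and otherwise one more than the number
of release points to the right of `v`. -/
noncomputable def key (σ : List (S ⊕ R)) (v : S ⊕ R) : ℕ :=
  if v ∈ σ then numRel (rightOf σ v) + 1 else 0

theorem numRel_rightOf_le (σ : List (S ⊕ R)) (v : S ⊕ R) : numRel (rightOf σ v) ≤ numRel σ :=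
  (rightOf_sublist σ v).countP_le

theorem numRel_rightOf_lt {σ : List (S ⊕ R)} {r : R} (h : Sum.inr r ∈ σ) :
    numRel (rightOf σ (Sum.inr r)) < numRel σ := by
  induction σ with
  | nil => simp at h
  | cons x σ ih =>
    by_cases hx : x = Sum.inr r
    · subst hx
      rw [rightOf_cons_self, numRel, numRel, List.countP_cons_of_pos rfl]
      exact Nat.lt_succ_self _
    · rw [rightOf_cons_of_ne hx]
      have h₁ := ih ((List.mem_cons.mp h).resolve_left (Ne.symm hx))
      refine h₁.trans_le ?_
      unfold numRel
      rw [List.countP_cons]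
      omega

/-- A release point is to the right of a step if and only if it has fewer release points to its
right. -/
theorem mem_rightOf_iff {σ : List (S ⊕ R)} (hσ : σ.Nodup) (s : S) (r : R)
    (hs : Sum.inl s ∈ σ) (hr : Sum.inr r ∈ σ) :
    Sum.inr r ∈ rightOf σ (Sum.inl s) ↔
      numRel (rightOf σ (Sum.inr r)) < numRel (rightOf σ (Sum.inl s)) := by
  induction σ with
  | nil => simp at hs
  | cons x σ ih =>
    obtain ⟨hx, hσ⟩ := List.nodup_cons.mp hσ
    by_cases h₁ : x = Sum.inl s
    · subst h₁
      have hr' : Sum.inr r ∈ σ := by simpa using hr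
      rw [rightOf_cons_self, rightOf_cons_of_ne (by simp)]
      simp [hr', numRel_rightOf_lt hr']
    · by_cases h₂ : x = Sum.inr r
      · subst h₂
        rw [rightOf_cons_self, rightOf_cons_of_ne (by simp)]
        have h₃ := numRel_rightOf_le σ (Sum.inl s)
        constructor
        · exact fun h => absurd ((rightOf_sublist _ _).subset h) hx
        · exact fun h => absurd h (not_lt.mpr h₃)
      · rw [rightOf_cons_of_ne h₁, rightOf_cons_of_ne h₂]
        exact ih hσ ((List.mem_cons.mp hs).resolve_left (Ne.symm h₁))
          ((List.mem_cons.mp hr).resolve_left (Ne.symm h₂))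

/-- The position of a release point in the release sequence is determined by the number of release
points to its right. -/
theorem numRel_rightOf_inr {σ : List (S ⊕ R)} {r : R} (hr : Sum.inr r ∈ σ) :
    numRel (rightOf σ (Sum.inr r)) + (releaseSeq σ).idxOf r + 1 = (releaseSeq σ).length := by
  induction σ with
  | nil => simp at hr
  | cons x σ ih =>
    rcases x with s | r'
    · rw [rightOf_cons_of_ne (by simp), releaseSeq_cons_inl]
      exact ih (by simpa using hr)
    · rw [releaseSeq_cons_inr]
      by_cases h : r' = r
      · subst h
        simp [rightOf_cons_self, numRel_eq_length]
      · rw [rightOf_cons_of_ne (by simpa using h), List.idxOf_cons_ne _ h]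
        have := ih (by simpa [Ne.symm h] using hr)
        simp only [List.length_cons]
        omega

/-- Two lists of the same distinct members in the same positions are equal. -/
theorem eq_of_idxOf_eq {l l' : List R} (hl : l.Nodup) (hl' : l'.Nodup) (hm : ∀ r, r ∈ l ↔ r ∈ l')
    (h : ∀ r ∈ l, l.idxOf r = l'.idxOf r) : l = l' := by
  refine List.ext_getElem
    ((List.perm_ext_iff_of_nodup hl hl').mpr hm).length_eq fun i hi hi' => ?_
  have h₁ := h l[i] (List.getElem_mem hi)
  rw [hl.idxOf_getElem i hi] at h₁
  have h₂ : l'.idxOf l[i] < l'.length := by rwa [← h₁]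
  have h₃ := List.getElem_idxOf h₂
  simp only [← h₁] at h₃
  exact h₃.symm

/-- Execution sequences with the same keys are equivalent. -/
theorem seqEquiv_of_key_eq {σ σ' : List (S ⊕ R)} (hσ : σ.Nodup) (hσ' : σ'.Nodup)
    (h : ∀ v, key σ v = key σ' v) : SeqEquiv σ σ' := by
  have hmem : ∀ v, v ∈ σ ↔ v ∈ σ' := by
    intro v
    have := h v
    unfold key at this
    split_ifs at this <;> simp [*]
  have hnum : ∀ v ∈ σ, numRel (rightOf σ v) = numRel (rightOf σ' v) := by
    intro v hv
    have := h v
    unfold key at this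
    rw [if_pos hv, if_pos ((hmem v).mp hv)] at this
    omega
  have hmr : ∀ r, r ∈ releaseSeq σ ↔ r ∈ releaseSeq σ' := fun r => by
    rw [mem_releaseSeq, mem_releaseSeq, hmem]
  refine ⟨eq_of_idxOf_eq (nodup_releaseSeq hσ) (nodup_releaseSeq hσ') hmr fun r hr => ?_,
    fun s => hmem _, fun s hs r => ?_⟩
  · have hlen := ((List.perm_ext_iff_of_nodup (nodup_releaseSeq hσ)
      (nodup_releaseSeq hσ')).mpr hmr).length_eq
    rw [mem_releaseSeq] at hr
    have h₁ := numRel_rightOf_inr hr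
    have h₂ := numRel_rightOf_inr ((hmem _).mp hr)
    have h₃ := hnum _ hr
    omega
  · by_cases hr : Sum.inr r ∈ σ
    · rw [mem_rightOf_iff hσ s r hs hr,
        mem_rightOf_iff hσ' s r ((hmem _).mp hs) ((hmem _).mp hr), hnum _ hs, hnum _ hr]
    · have hr' : Sum.inr r ∉ σ' := fun h => hr ((hmem _).mpr h)
      exact ⟨fun h => absurd ((rightOf_sublist _ _).subset h) hr,
        fun h => absurd ((rightOf_sublist _ _).subset h) hr'⟩

theorem key_le {σ : List (S ⊕ R)} (v : S ⊕ R) : key σ v ≤ σ.length := by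
  unfold key
  split_ifs with h
  · have : (rightOf σ v).length < σ.length := by
      induction σ with
      | nil => simp at h
      | cons x σ ih =>
        by_cases hx : x = v
        · subst hx
          simp [rightOf_cons_self]
        · rw [rightOf_cons_of_ne hx]
          exact (ih ((List.mem_cons.mp h).resolve_left (Ne.symm hx))).trans (by simp)
    have h₂ : numRel (rightOf σ v) ≤ (rightOf σ v).length := List.countP_le_length
    omega
  · omega

/-- The keys are determined by the set of executed vertices (`2 ^ |ℬ|` possibilities), the release
sequence (`|R|!` possibilities for each set) and the positions of the steps between the release
points (`(|R| + 1) ^ |S|` possibilities). -/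
theorem Schema.card_image_key_le [Fintype S] [Fintype R] {U : Type*} (W : Schema S R U) :
    (W.execSeqs.image key).card ≤ 2 ^ W.workflow.numXor * (Nat.factorial (Fintype.card R) *
      (Fintype.card R + 1) ^ Fintype.card S) := by
  classical
  -- `Φ σ` consists of the data that determine the keys, and `F` recovers the keys from them
  let slot : List (S ⊕ R) → S → Fin (Fintype.card R + 1) := fun σ s =>
    Fin.ofNat _ (numRel (rightOf σ (Sum.inl s)))
  let Φ : List (S ⊕ R) → Finset (S ⊕ R) × List R × (S → Fin (Fintype.card R + 1)) := fun σ =>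
    (σ.toFinset, releaseSeq σ, slot σ)
  let F : Finset (S ⊕ R) × List R × (S → Fin (Fintype.card R + 1)) → S ⊕ R → ℕ := fun x v =>
    if v ∈ x.1 then
      v.elim (fun s => (x.2.2 s : ℕ) + 1) (fun r => x.2.1.length - x.2.1.idxOf r)
    else 0
  have hF : ∀ σ ∈ W.execSeqs, key σ = F (Φ σ) := by
    intro σ hσ
    have hn := W.nodup_of_mem_execSeqs hσ
    funext v
    simp only [key, F, Φ, List.mem_toFinset]
    by_cases hv : v ∈ σ
    · rw [if_pos hv, if_pos hv]
      rcases v with s | r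
      · simp only [Sum.elim_inl, slot, Fin.val_ofNat, Nat.add_right_cancel_iff]
        refine (Nat.mod_eq_of_lt (Nat.lt_succ_of_le ?_)).symm
        rw [numRel_eq_length]
        exact (nodup_releaseSeq (hn.sublist (rightOf_sublist _ _))).length_le_card
      · have := numRel_rightOf_inr hv
        simp only [Sum.elim_inr]
        omega
    · rw [if_neg hv, if_neg hv]
  have h₁ : W.execSeqs.image key = (W.execSeqs.image Φ).image F := by
    rw [Finset.image_image]
    exact Finset.image_congr fun σ hσ => hF σ hσ
  rw [h₁]
  refine Finset.card_image_le.trans ?_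
  -- for a fixed set of vertices, the release sequence is a permutation of its release points
  have h₂ : W.execSeqs.image Φ ⊆ (W.workflow.execSeqs.image List.toFinset).biUnion fun V =>
      ((releaseSeq V.toList).permutations.toFinset ×ˢ
        (Finset.univ : Finset (S → Fin (Fintype.card R + 1)))).image fun x => (V, x) := by
    intro x hx
    obtain ⟨σ, hσ, rfl⟩ := Finset.mem_image.mp hx
    have hn := W.nodup_of_mem_execSeqs hσ
    refine Finset.mem_biUnion.mpr ⟨σ.toFinset, Finset.mem_image_of_mem _ hσ,
      Finset.mem_image.mpr ⟨(releaseSeq σ, slot σ), ?_, rfl⟩⟩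
    rw [Finset.mem_product]
    refine ⟨?_, Finset.mem_univ _⟩
    rw [List.mem_toFinset, List.mem_permutations]
    exact ((List.toFinset_toList hn).symm.filterMap _)
  refine (Finset.card_le_card h₂).trans ?_
  refine (Finset.card_biUnion_le_card_mul _ _ _ fun V _ => ?_).trans
    (Nat.mul_le_mul_right _ W.workflow.card_image_toFinset_le)
  refine Finset.card_image_le.trans ?_
  rw [Finset.card_product, Finset.card_univ, Fintype.card_fun, Fintype.card_fin]
  refine Nat.mul_le_mul_right _ ((List.toFinset_card_le _).trans ?_)
  rw [List.length_permutations]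
  exact Nat.factorial_le (nodup_releaseSeq V.nodup_toList).length_le_card

end

/-! ### Grouping by keys -/

section

variable {γ : Type*}

/-- The members of a group whose remaining key begins with `a`; this entry is removed. -/
def subgroup (a : ℕ) (g : List (List ℕ × γ)) : List (List ℕ × γ) :=
  g.flatMap fun it => if it.1.headD 0 = a then [(it.1.tail, it.2)] else []

/-- One round of the refinement of a partition into groups: every group is split according to the
first entry of the remaining keys. -/
def refineStep (vals : List ℕ) (gs : List (List (List ℕ × γ))) : List (List (List ℕ × γ)) :=
  gs.flatMap fun g => vals.flatMap fun a => if subgroup a g = [] then [] else [subgroup a g]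

theorem mem_subgroup {a : ℕ} {g : List (List ℕ × γ)} {it : List ℕ × γ} :
    it ∈ subgroup a g ↔ ∃ it' ∈ g, it'.1.headD 0 = a ∧ it = (it'.1.tail, it'.2) := by
  unfold subgroup
  simp only [List.mem_flatMap]
  refine exists_congr fun it' => and_congr_right fun _ => ?_
  by_cases h : it'.1.headD 0 = a
  · rw [if_pos h, List.mem_singleton]
    exact (and_iff_right h).symm
  · rw [if_neg h]
    simp only [List.not_mem_nil, false_iff]
    exact fun h' => h h'.1

theorem mem_refineStep {vals : List ℕ} {gs : List (List (List ℕ × γ))}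
    {g : List (List ℕ × γ)} :
    g ∈ refineStep vals gs ↔ g ≠ [] ∧ ∃ g' ∈ gs, ∃ a ∈ vals, g = subgroup a g' := by
  unfold refineStep
  simp only [List.mem_flatMap]
  constructor
  · rintro ⟨g', hg', a, ha, h⟩
    split_ifs at h with h₁
    · simp at h
    · rw [List.mem_singleton] at h
      exact ⟨h ▸ h₁, g', hg', a, ha, h⟩
  · rintro ⟨h₁, g', hg', a, ha, rfl⟩
    refine ⟨g', hg', a, ha, ?_⟩
    rw [if_neg h₁]
    simp

theorem sum_ite_headD {vals : List ℕ} (hv : vals.Nodup) {x : ℕ} (hx : x ∈ vals) (c : ℕ) :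
    (vals.map fun a => if x = a then c else 0).sum = c := by
  induction vals with
  | nil => simp at hx
  | cons a vals ih =>
    obtain ⟨ha, hv⟩ := List.nodup_cons.mp hv
    rw [List.map_cons, List.sum_cons]
    by_cases h : x = a
    · subst h
      rw [if_pos rfl, List.map_congr_left (g := fun _ => 0), List.map_const']
      · simp
      · intro b hb
        rw [if_neg]
        rintro rfl
        exact ha hb
    · rw [if_neg h, ih hv ((List.mem_cons.mp hx).resolve_left h), zero_add]

/-- Splitting a group does not change sums over its members. -/
theorem sum_subgroup {vals : List ℕ} (hv : vals.Nodup) (F : γ → ℕ) {g : List (List ℕ × γ)}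
    (hg : ∀ it ∈ g, it.1.headD 0 ∈ vals) :
    (vals.map fun a => ((subgroup a g).map fun it => F it.2).sum).sum =
      (g.map fun it => F it.2).sum := by
  induction g with
  | nil => simp [subgroup]
  | cons it g ih =>
    have h₁ : ∀ a, ((subgroup a (it :: g)).map fun it => F it.2).sum =
        (if it.1.headD 0 = a then F it.2 else 0) +
          ((subgroup a g).map fun it => F it.2).sum := by
      intro a
      unfold subgroup
      rw [List.flatMap_cons, List.map_append, List.sum_append]
      congr 1
      split_ifs <;> simp
    simp only [h₁]
    rw [List.sum_map_add, sum_ite_headD hv (hg it (by simp)),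
      ih fun it hit => hg it (by simp [hit])]
    simp

theorem sum_refineStep {vals : List ℕ} (hv : vals.Nodup) (F : γ → ℕ)
    {gs : List (List (List ℕ × γ))} (hg : ∀ g ∈ gs, ∀ it ∈ g, it.1.headD 0 ∈ vals) :
    ((refineStep vals gs).map fun g => (g.map fun it => F it.2).sum).sum =
      (gs.map fun g => (g.map fun it => F it.2).sum).sum := by
  induction gs with
  | nil => simp [refineStep]
  | cons g gs ih =>
    have h₁ : refineStep vals (g :: gs) =
        (vals.flatMap fun a => if subgroup a g = [] then [] else [subgroup a g]) ++
          refineStep vals gs := by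
      simp [refineStep]
    rw [h₁, List.map_append, List.sum_append, ih fun g hg' => hg g (by simp [hg']),
      List.map_cons, List.sum_cons, ← sum_subgroup hv F (hg g (by simp)), List.map_flatMap]
    congr 1
    rw [List.flatMap_def, List.sum_flatten, List.map_map]
    congr 1
    refine List.map_congr_left fun a _ => ?_
    simp only [Function.comp_apply]
    split_ifs with h <;> simp [h]

/-- The state of the refinement of the list `L` with the keys `K`, when `n` entries of the keys
remain. -/
structure IsGrouping (L : List γ) (K : γ → List ℕ) (vals : List ℕ) (n : ℕ)
    (gs : List (List (List ℕ × γ))) : Prop where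
  ne_nil : ∀ g ∈ gs, g ≠ []
  mem : ∀ g ∈ gs, ∀ it ∈ g, it.2 ∈ L
  length_eq : ∀ g ∈ gs, ∀ it ∈ g, it.1.length = n
  mem_vals : ∀ g ∈ gs, ∀ it ∈ g, ∀ a ∈ it.1, a ∈ vals
  prefix_eq : ∀ g ∈ gs, ∃ p, ∀ it ∈ g, K it.2 = p ++ it.1
  pairwise : gs.Pairwise fun g g' => ∀ it ∈ g, ∀ it' ∈ g', K it.2 ≠ K it'.2
  sum_eq : ∀ F : γ → ℕ, (gs.map fun g => (g.map fun it => F it.2).sum).sum = (L.map F).sum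

/-- At the start there is a single group, and no entry of the keys has been used. -/
theorem IsGrouping.init {L : List γ} {K : γ → List ℕ} {vals : List ℕ} {n : ℕ} (hL : L ≠ [])
    (hK : ∀ x ∈ L, (K x).length = n ∧ ∀ a ∈ K x, a ∈ vals) :
    IsGrouping L K vals n [L.map fun x => (K x, x)] where
  ne_nil := by simpa using hL
  mem := by simpa using fun _ x hx _ => hx
  length_eq := by simpa using fun x hx => (hK x hx).1
  mem_vals := by simpa using fun x hx => (hK x hx).2
  prefix_eq := fun g hg => ⟨[], by
    rw [List.mem_singleton] at hg
    subst hg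
    simp⟩
  pairwise := by simp
  sum_eq := fun F => by simp [Function.comp_def]

/-- One round of the refinement uses one more entry of the keys. -/
theorem IsGrouping.step {L : List γ} {K : γ → List ℕ} {vals : List ℕ} (hv : vals.Nodup) {n : ℕ}
    {gs : List (List (List ℕ × γ))} (h : IsGrouping L K vals (n + 1) gs) :
    IsGrouping L K vals n (refineStep vals gs) where
  ne_nil := fun g hg => (mem_refineStep.mp hg).1
  mem := by
    intro g hg it hit
    obtain ⟨_, g', hg', a, _, rfl⟩ := mem_refineStep.mp hg
    obtain ⟨it', hit', _, rfl⟩ := mem_subgroup.mp hit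
    exact h.mem g' hg' it' hit'
  length_eq := by
    intro g hg it hit
    obtain ⟨_, g', hg', a, _, rfl⟩ := mem_refineStep.mp hg
    obtain ⟨it', hit', _, rfl⟩ := mem_subgroup.mp hit
    have := h.length_eq g' hg' it' hit'
    simp [this]
  mem_vals := by
    intro g hg it hit b hb
    obtain ⟨_, g', hg', a, _, rfl⟩ := mem_refineStep.mp hg
    obtain ⟨it', hit', _, rfl⟩ := mem_subgroup.mp hit
    exact h.mem_vals g' hg' it' hit' b (List.mem_of_mem_tail hb)
  prefix_eq := by
    intro g hg
    obtain ⟨_, g', hg', a, _, rfl⟩ := mem_refineStep.mp hg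
    obtain ⟨p, hp⟩ := h.prefix_eq g' hg'
    refine ⟨p ++ [a], fun it hit => ?_⟩
    obtain ⟨it', hit', ha, rfl⟩ := mem_subgroup.mp hit
    have hl := h.length_eq g' hg' it' hit'
    rw [hp it' hit']
    rcases hk : it'.1 with _ | ⟨b, k⟩
    · simp [hk] at hl
    · simp only [hk, List.headD_cons] at ha
      simp [ha]
  pairwise := by
    unfold refineStep
    rw [List.pairwise_flatMap]
    constructor
    · intro g hg
      obtain ⟨p, hp⟩ := h.prefix_eq g hg
      rw [List.pairwise_flatMap]
      constructor
      · intro a _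
        split_ifs <;> simp
      -- members of different subgroups of a group differ in the entry after the common prefix
      · refine hv.imp fun {a a'} hne x hx y hy it hit it' hit' he => ?_
        split_ifs at hx hy
        · simp at hx
        · simp at hx
        · simp at hy
        · rw [List.mem_singleton] at hx hy
          subst hx hy
          obtain ⟨i, hi, ha, rfl⟩ := mem_subgroup.mp hit
          obtain ⟨i', hi', ha', rfl⟩ := mem_subgroup.mp hit'
          simp only [hp i hi, hp i' hi', List.append_cancel_left_eq] at he
          rw [he] at ha
          exact hne (ha.symm.trans ha')
    · refine h.pairwise.imp fun {g g'} hgg x hx y hy it hit it' hit' => ?_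
      simp only [List.mem_flatMap] at hx hy
      obtain ⟨a, _, hx⟩ := hx
      obtain ⟨a', _, hy⟩ := hy
      split_ifs at hx hy
      · simp at hx
      · simp at hx
      · simp at hy
      · rw [List.mem_singleton] at hx hy
        subst hx hy
        obtain ⟨i, hi, _, rfl⟩ := mem_subgroup.mp hit
        obtain ⟨i', hi', _, rfl⟩ := mem_subgroup.mp hit'
        exact hgg i hi i' hi'
  sum_eq := fun F => by
    rw [sum_refineStep hv F, h.sum_eq F]
    intro g hg it hit
    have hl := h.length_eq g hg it hit
    rcases hk : it.1 with _ | ⟨b, k⟩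
    · simp [hk] at hl
    · exact h.mem_vals g hg it hit b (by simp [hk])

/-- After as many rounds as the keys have entries, nothing of the keys remains. -/
theorem IsGrouping.foldl {β : Type*} {L : List γ} {K : γ → List ℕ} {vals : List ℕ}
    (hv : vals.Nodup) (xs : List β) {gs : List (List (List ℕ × γ))}
    (h : IsGrouping L K vals xs.length gs) :
    IsGrouping L K vals 0 (xs.foldl (fun gs _ => refineStep vals gs) gs) := by
  induction xs generalizing gs with
  | nil => exact h
  | cons x xs ih => exact ih (h.step hv)

theorem IsGrouping.sum_length {L : List γ} {K : γ → List ℕ} {vals : List ℕ} {n : ℕ}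
    {gs : List (List (List ℕ × γ))} (h : IsGrouping L K vals n gs) :
    (gs.map List.length).sum = L.length := by
  have := h.sum_eq fun _ => 1
  simpa using this

theorem IsGrouping.length_le {L : List γ} {K : γ → List ℕ} {vals : List ℕ} {n : ℕ}
    {gs : List (List (List ℕ × γ))} (h : IsGrouping L K vals n gs) : gs.length ≤ L.length := by
  rw [← h.sum_length]
  exact Exp.length_le_sum_of_pos fun g hg => List.length_pos_iff.mpr (h.ne_nil g hg)

/-- At the end, all members of a group have the same key. -/
theorem IsGrouping.key_eq {L : List γ} {K : γ → List ℕ} {vals : List ℕ}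
    {gs : List (List (List ℕ × γ))} (h : IsGrouping L K vals 0 gs) {g : List (List ℕ × γ)}
    (hg : g ∈ gs) {it it' : List ℕ × γ} (hit : it ∈ g) (hit' : it' ∈ g) : K it.2 = K it'.2 := by
  obtain ⟨p, hp⟩ := h.prefix_eq g hg
  have h₁ := List.eq_nil_of_length_eq_zero (h.length_eq g hg it hit)
  have h₂ := List.eq_nil_of_length_eq_zero (h.length_eq g hg it' hit')
  rw [hp it hit, hp it' hit', h₁, h₂]

/-- There are at most as many groups as different keys. -/
theorem IsGrouping.length_le_card [DecidableEq γ] {L : List γ} {K : γ → List ℕ} {vals : List ℕ}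
    {n : ℕ} {gs : List (List (List ℕ × γ))} (h : IsGrouping L K vals n gs) :
    gs.length ≤ (L.toFinset.image K).card := by
  rcases gs with _ | ⟨g₀, gs'⟩
  · simp
  obtain ⟨it₀, _⟩ := List.exists_mem_of_ne_nil _ (h.ne_nil g₀ (by simp))
  set gs := g₀ :: gs' with hgs
  have hhead : ∀ g ∈ gs, g.headD it₀ ∈ g := by
    intro g hg
    obtain ⟨it, l, rfl⟩ := List.exists_cons_of_ne_nil (h.ne_nil g hg)
    simp
  have hnodup : (gs.map fun g => K (g.headD it₀).2).Nodup := by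
    rw [List.Nodup, List.pairwise_map]
    exact h.pairwise.imp_of_mem fun {g g'} hg hg' hgg =>
      hgg _ (hhead g hg) _ (hhead g' hg')
  rw [← List.length_map (f := fun g => K (g.headD it₀).2), ← List.toFinset_card_of_nodup hnodup]
  refine Finset.card_le_card fun x hx => ?_
  rw [List.mem_toFinset, List.mem_map] at hx
  obtain ⟨g, hg, rfl⟩ := hx
  exact Finset.mem_image_of_mem _ (List.mem_toFinset.mpr (h.mem g hg _ (hhead g hg)))

end

namespace Exp

variable {O : Val → ℕ} {κ : ℕ}

/-! ### Programs that compute keys and groups -/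

theorem Ev.fst {e : Exp} {v x y : Val} {t : ℕ} (h : Ev O κ e v (.pair x y) t) :
    Ev O κ (.fst e) v x (t + 2) :=
  ⟨by simp [eval, h.1, Val.fst], by have := h.2; simp only [time]; omega⟩

theorem Ev.snd {e : Exp} {v x y : Val} {t : ℕ} (h : Ev O κ e v (.pair x y) t) :
    Ev O κ (.snd e) v y (t + 2) :=
  ⟨by simp [eval, h.1, Val.snd], by have := h.2; simp only [time]; omega⟩

/-- Equality of two vertices. -/
def eqVE (a b : Exp) : Exp := .ite (eqE (.fst a) (.fst b)) (eqE (.snd a) (.snd b)) (.const 0)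

theorem Ev.eqV {k m N : ℕ} (hk : k ≤ N) (hm : m ≤ N) {a b : Exp} {v : Val} {x y : Fin k ⊕ Fin m}
    {s t : ℕ} (ha : Ev O κ a v (encV x) s) (hb : Ev O κ b v (encV y) t) :
    Ev O κ (eqVE a b) v (.nat (if x = y then 1 else 0)) (4 * (s + t) + 4 * N + 60) := by
  have key : ∀ p q : ℕ, ∀ i j : ℕ, p ≤ 1 → q ≤ 1 → i ≤ N → j ≤ N →
      encV x = .pair (.nat p) (.nat i) → encV y = .pair (.nat q) (.nat j) →
      (x = y ↔ p = q ∧ i = j) →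
      Ev O κ (eqVE a b) v (.nat (if x = y then 1 else 0)) (4 * (s + t) + 4 * N + 60) := by
    intro p q i j hp hq hi hj hx hy hxy
    rw [hx] at ha
    rw [hy] at hb
    have h := Ev.ite (p := p = q) (ha.fst.eq hb.fst) ite_one_zero_ne_zero_iff
      (fun _ => ha.snd.eq hb.snd) (fun _ => Ev.const 0 v)
    have h' : (if p = q then Val.nat (if i = j then 1 else 0) else Val.nat 0) =
        .nat (if x = y then 1 else 0) := by
      simp only [hxy]
      split_ifs <;> first | rfl | tauto
    rw [h'] at h
    refine h.mono ?_
    have h₁ := size_le_of_le hp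
    have h₂ := size_le_of_le hq
    have h₃ := size_le_of_le hi
    have h₄ := size_le_of_le hj
    have : max (2 * (s + 2 + (t + 2) + Nat.size i + Nat.size j) + 8) 1 =
      2 * (s + 2 + (t + 2) + Nat.size i + Nat.size j) + 8 := max_eq_left (by omega)
    omega
  have hf : ∀ {n : ℕ} (i : Fin n), n ≤ N → (i : ℕ) ≤ N := fun i h => i.isLt.le.trans h
  rcases x with x | x <;> rcases y with y | y
  · exact key 0 0 x y (by omega) (by omega) (hf x hk) (hf y hk) rfl rfl (by simp [Fin.ext_iff])
  · exact key 0 1 x y (by omega) (by omega) (hf x hk) (hf y hm) rfl rfl (by simp)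
  · exact key 1 0 x y (by omega) (by omega) (hf x hm) (hf y hk) rfl rfl (by simp)
  · exact key 1 1 x y (by omega) (by omega) (hf x hm) (hf y hm) rfl rfl (by simp [Fin.ext_iff])

/-- One step of the computation of a key by a scan of the sequence. -/
def keyStep {k m : ℕ} (v : Fin k ⊕ Fin m) (acc : ℕ) (x : Fin k ⊕ Fin m) : ℕ :=
  if x = v then 1 else if x.isRight ∧ acc ≠ 0 then acc + 1 else acc

open Classical in
/-- The accumulator of the scan is `0` before `v` has been met, and one more than the number of
release points since `v` afterwards. -/
theorem foldl_keyStep {k m : ℕ} (v : Fin k ⊕ Fin m) (σ : List (Fin k ⊕ Fin m)) (hσ : σ.Nodup) :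
    ∀ acc, σ.foldl (keyStep v) acc =
      if v ∈ σ then key σ v else if acc = 0 then 0 else acc + numRel σ := by
  induction σ with
  | nil => intro acc; by_cases h : acc = 0 <;> simp [numRel, h]
  | cons x σ ih =>
    intro acc
    obtain ⟨hx, hσ⟩ := List.nodup_cons.mp hσ
    rw [List.foldl_cons, ih hσ]
    by_cases hxv : x = v
    · subst hxv
      simp [hx, key, keyStep, rightOf_cons_self, add_comm]
    · have h₁ : v ∈ x :: σ ↔ v ∈ σ := by simp [Ne.symm hxv]
      by_cases hv : v ∈ σ
      · simp [key, hv, rightOf_cons_of_ne hxv]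
      · simp only [h₁, hv, if_false, keyStep, hxv]
        by_cases ha : acc = 0
        · simp [ha]
        · rcases x with s | r
          · simp [ha, numRel]
          · simp [ha, numRel, List.countP_cons]
            ring

/-- The key of the vertex `var 0` in the sequence `var 1`. -/
def keyE : Exp :=
  .fold (.var 1) (.const 0)
    (.ite (eqVE (.var 0) (.var 2)) (.const 1)
      (.ite (.fst (.var 0)) (.ite (.var 1) (.add (.var 1) (.const 1)) (.const 0)) (.var 1)))

theorem ev_keyE {k m N : ℕ} (hN : 1000 ≤ N) (hk : k ≤ N) (hm : m ≤ N) (v : Fin k ⊕ Fin m)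
    (σ : List (Fin k ⊕ Fin m)) (hσ : σ.Nodup) (hσN : σ.length ≤ N) (ρ : Val) :
    Ev O κ keyE (.pair (encV v) (.pair (encSeq σ) ρ)) (.nat (key σ v)) (N ^ 3) := by
  classical
  have h := Ev.foldRem (O := O) (κ := κ) encV Val.nat (keyStep v)
    (fun rest acc => acc + rest.length ≤ N) (T := 200 + 6 * N)
    (Ev.var 1 (.pair (encV v) (.pair (encSeq σ) ρ))) (i := .const 0) (Ev.const 0 _)
    (by simpa using hσN)
    (b := .ite (eqVE (.var 0) (.var 2)) (.const 1)
      (.ite (.fst (.var 0)) (.ite (.var 1) (.add (.var 1) (.const 1)) (.const 0)) (.var 1)))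
    (fun x _ rest acc hacc => by
      rw [List.length_cons] at hacc
      set w := Val.pair (encV x) (.pair (.nat acc) (.pair (encV v) (.pair (encSeq σ) ρ))) with hw
      have l₀ : lookup 0 w = encV x := rfl
      have l₁ : lookup 1 w = .nat acc := rfl
      have l₂ : lookup 2 w = encV v := rfl
      obtain ⟨h₁, h₂⟩ := Ev.eqV (O := O) (κ := κ) hk hm (x := x) (y := v) (Ev.var 0 w) (Ev.var 2 w)
      have hs : Nat.size acc ≤ N := size_le_of_le (by omega)
      have hs1 : Nat.size 1 = 1 := Nat.size_one
      clear_value w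
      refine ⟨?_, ?_⟩
      · by_cases hx : x = v
        · constructor
          · simp [eval, h₁, hx, Val.num, keyStep]
          · simp [time, h₁, hx, Val.num]
            omega
        · rcases x with s | r <;> by_cases ha : acc = 0 <;> constructor <;>
          simp [eval, time, h₁, hx, Val.num, keyStep, l₀, l₁, ha, encV, Val.fst, hs1] <;> omega
      · unfold keyStep
        split_ifs <;> omega)
  rw [foldl_keyStep v σ hσ] at h
  have h' : (if v ∈ σ then key σ v else if 0 = 0 then 0 else 0 + numRel σ) = key σ v := by
    unfold key
    split_ifs <;> simp_all
  rw [h'] at h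
  refine Ev.mono h ?_
  have := Nat.mul_le_mul_right (18 + (200 + 6 * N)) hσN
  nlinarith [Nat.mul_le_mul hN hN, Nat.mul_le_mul (Nat.mul_le_mul hN hN) (le_refl N)]

/-- The list `var 0` of sequences, where every sequence is preceded by the list of its keys for the
vertices in the list `var 1`. -/
def itemsE : Exp :=
  mapE (.var 0)
    (.pair (mapE (.var 2) (.app keyE (.pair (.var 0) (.pair (.var 1) (.const 0))))) (.var 0))

/-- The encoding of a member of a group: the rest of its key and the member itself. -/
def encItem {γ : Type*} (h : γ → Val) (it : List ℕ × γ) : Val :=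
  .pair (.ofList (it.1.map .nat)) (h it.2)

theorem ev_itemsE {k m N X : ℕ} (hN : 1000 ≤ N) (hk : k ≤ N) (hm : m ≤ N)
    (L : List (List (Fin k ⊕ Fin m))) (hL : ∀ σ ∈ L, σ.Nodup ∧ σ.length ≤ N) (hX : L.length ≤ X)
    (vs : List (Fin k ⊕ Fin m)) (hvs : vs.length ≤ N) (ρ : Val) :
    Ev O κ itemsE (.pair (.ofList (L.map encSeq)) (.pair (.ofList (vs.map encV)) ρ))
      (.ofList ((L.map fun σ => (vs.map (key σ), σ)).map (encItem encSeq)))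
      ((X + 1) * N ^ 5) := by
  have h := Ev.mapConst (O := O) (κ := κ) encSeq (encItem encSeq)
    (fun σ => (vs.map (key σ), σ)) (T := 60 + N * (N ^ 3 + 140))
    (Ev.var 0 (.pair (.ofList (L.map encSeq)) (.pair (.ofList (vs.map encV)) ρ)))
    (b := .pair (mapE (.var 2) (.app keyE (.pair (.var 0) (.pair (.var 1) (.const 0))))) (.var 0))
    (fun σ hσ => by
      refine (Ev.pair (Ev.mapConst (O := O) (κ := κ) encV Val.nat (key σ) (T := N ^ 3 + 10)
        (xs := vs) (s := 5) ⟨rfl, le_rfl⟩ (fun v _ => ?_))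
        (w := .ofList ((vs.map (key σ)).map .nat))
        (x := encSeq σ) (t := 1) ⟨rfl, le_rfl⟩).mono ?_
      · refine (Ev.app (s := 7) (w := .pair (encV v) (.pair (encSeq σ) (.nat 0))) ⟨rfl, ?_⟩
          (ev_keyE hN hk hm v σ (hL σ hσ).1 (hL σ hσ).2 _)).mono (by omega)
        simp [time]
      · have := Nat.mul_le_mul_right (N ^ 3 + 10 + 120) hvs
        have : N * (N ^ 3 + 10 + 120) ≤ N * (N ^ 3 + 140) := Nat.mul_le_mul_left _ (by omega)
        omega)
  refine Ev.mono h ?_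
  have e₁ := Nat.mul_le_mul_right (60 + N * (N ^ 3 + 140) + 120) hX
  have e₂ : 60 + N * (N ^ 3 + 140) + 120 ≤ 2 * N ^ 4 := by
    have : 1000 ^ 3 ≤ N ^ 3 := Nat.pow_le_pow_left hN 3
    nlinarith
  have e₃ := Nat.mul_le_mul_left X e₂
  have e₄ : 2 * N ^ 4 * X + 2 * N ^ 4 ≤ (X + 1) * N ^ 5 := by
    have : 2 * N ^ 4 * X + 2 * N ^ 4 = (X + 1) * N ^ 4 * 2 := by ring
    rw [this, show (X + 1) * N ^ 5 = (X + 1) * N ^ 4 * N by ring]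
    exact Nat.mul_le_mul_left _ (by omega)
  have e₅ : 1000 ^ 4 ≤ N ^ 4 := Nat.pow_le_pow_left hN 4
  rw [mul_comm X (2 * N ^ 4)] at e₃
  omega

/-- The numbers `n, …, 0`, where `n` is the length of the list `var 0`. -/
def valsE : Exp :=
  .fold (.var 0) (.pair (.const 0) (.const 0)) (.pair (.add (.fst (.var 1)) (.const 1)) (.var 1))

/-- The numbers `0, …, |V|` are the possible values of the keys. -/
theorem ev_valsE {α : Type*} (f : α → Val) (xs : List α) {N : ℕ} (hN : 1000 ≤ N)
    (hxs : xs.length ≤ N) (ρ : Val) :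
    Ev O κ valsE (.pair (.ofList (xs.map f)) ρ)
      (.ofList (((List.range (xs.length + 1)).reverse).map .nat)) (N ^ 3) := by
  have h := Ev.foldRem (O := O) (κ := κ) f (fun l : List ℕ => Val.ofList (l.map .nat))
    (fun l _ => (l.headD 0 + 1) :: l) (fun rest l => l.headD 0 + rest.length ≤ N) (T := 50 + N)
    (Ev.var 0 (.pair (.ofList (xs.map f)) ρ)) (i := .pair (.const 0) (.const 0)) (b₀ := [0])
    (t := 3) ⟨rfl, le_rfl⟩ (by simpa using hxs)
    (b := .pair (.add (.fst (.var 1)) (.const 1)) (.var 1))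
    (fun x _ rest l hl => by
      rw [List.length_cons] at hl
      have hs : Nat.size (l.headD 0) ≤ N := size_le_of_le (by omega)
      have hs1 : Nat.size 1 = 1 := Nat.size_one
      have hfst : (Val.ofList (l.map Val.nat)).fst = .nat (l.headD 0) := by
        cases l <;> rfl
      refine ⟨⟨?_, ?_⟩, by rw [List.headD_cons]; omega⟩
      · simp only [eval, lookup, Val.fst_pair, Val.snd_pair, hfst, List.map_cons, Val.ofList,
          Val.num_nat]
      · simp only [eval, time, lookup, Val.fst_pair, Val.snd_pair, hfst, Val.num_nat, hs1]
        omega)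
  have h₁ : xs.foldl (fun l _ => (l.headD 0 + 1) :: l) [0] =
      (List.range (xs.length + 1)).reverse := by
    have : ∀ n, xs.foldl (fun l _ => (l.headD 0 + 1) :: l) (List.range (n + 1)).reverse =
        (List.range (n + xs.length + 1)).reverse := by
      clear h hxs
      induction xs with
      | nil => simp
      | cons x xs ih =>
        intro n
        have : ((List.range (n + 1)).reverse.headD 0 + 1) :: (List.range (n + 1)).reverse =
            (List.range (n + 1 + 1)).reverse := by
          rw [List.range_succ (n := n + 1), List.reverse_append, List.range_succ (n := n)]
          simp
        rw [List.foldl_cons, this, ih, List.length_cons]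
        congr 2
        ring
    simpa using this 0
  rw [h₁] at h
  refine Ev.mono h ?_
  have := Nat.mul_le_mul_right (18 + (50 + N)) hxs
  nlinarith [Nat.mul_le_mul hN hN, Nat.mul_le_mul (Nat.mul_le_mul hN hN) (le_refl N)]

/-- The members of the group `var 1` whose keys begin with `var 0`. -/
def subgroupE : Exp :=
  bindE (.var 1)
    (.ite (eqE (.fst (.fst (.var 0))) (.var 1))
      (.pair (.pair (.snd (.fst (.var 0))) (.snd (.var 0))) (.const 0)) (.const 0))

theorem length_subgroup_le {γ : Type*} (a : ℕ) (g : List (List ℕ × γ)) :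
    (subgroup a g).length ≤ g.length := by
  unfold subgroup
  induction g with
  | nil => simp
  | cons it g ih =>
    rw [List.flatMap_cons, List.length_append, List.length_cons]
    split_ifs <;> simp only [List.length_singleton, List.length_nil] <;> omega

theorem ev_subgroupE {γ : Type*} (h : γ → Val) {N : ℕ} (a : ℕ) (ha : a ≤ N)
    (g : List (List ℕ × γ)) (hg : ∀ it ∈ g, ∀ b ∈ it.1, b ≤ N) (ρ : Val) :
    Ev O κ subgroupE (.pair (.nat a) (.pair (.ofList (g.map (encItem h))) ρ))
      (.ofList ((subgroup a g).map (encItem h))) (60 + g.length * (200 + 4 * N)) := by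
  have h := Ev.bindConst (O := O) (κ := κ) (encItem h) (encItem h)
    (fun it => if it.1.headD 0 = a then [(it.1.tail, it.2)] else []) (T := 80 + 4 * N)
    (Ev.var 1 (.pair (.nat a) (.pair (.ofList (g.map (encItem h))) ρ)))
    (b := .ite (eqE (.fst (.fst (.var 0))) (.var 1))
      (.pair (.pair (.snd (.fst (.var 0))) (.snd (.var 0))) (.const 0)) (.const 0))
    (fun it hit => by
      have hfst : (Val.ofList (it.1.map Val.nat)).fst = .nat (it.1.headD 0) := by
        cases it.1 <;> rfl
      have hsnd : (Val.ofList (it.1.map Val.nat)).snd = .ofList (it.1.tail.map .nat) := by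
        cases it.1 <;> rfl
      have hb : it.1.headD 0 ≤ N := by
        rcases hk : it.1 with _ | ⟨b, k⟩
        · simp
        · exact hg it hit b (by simp [hk])
      set w := Val.pair (encItem h it) (.pair (.nat a) (.pair (.ofList (g.map (encItem h))) ρ))
      have e₁ : Ev O κ (.fst (.fst (.var 0))) w (.nat (it.1.headD 0)) 5 := ⟨hfst, le_rfl⟩
      have e₂ := Ev.ite (p := it.1.headD 0 = a) (e₁.eq (y := a) (Ev.var 1 w))
        ite_one_zero_ne_zero_iff
        (a := .pair (.pair (.snd (.fst (.var 0))) (.snd (.var 0))) (.const 0))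
        (w := .ofList ([(it.1.tail, it.2)].map (encItem h))) (s := 20)
        (fun _ => ⟨by
          simp only [eval, lookup, w, Val.fst_pair, Val.snd_pair, encItem, hsnd, List.map_cons,
            List.map_nil, Val.ofList], by simp [time]⟩)
        (fun _ => Ev.const 0 w)
      have e₃ : (if it.1.headD 0 = a then Val.ofList ([(it.1.tail, it.2)].map (encItem h))
          else .nat 0) = .ofList ((if it.1.headD 0 = a then [(it.1.tail, it.2)] else []).map
            (encItem h)) := by
        split_ifs <;> rfl
      rw [e₃] at e₂
      refine e₂.mono ?_
      have := size_le_of_le hb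
      have := size_le_of_le ha
      have := max_eq_left (a := 20) (b := 1) (by omega)
      omega)
  refine Ev.mono h ?_
  have h₁ := length_subgroup_le a g
  unfold subgroup at h₁
  have : g.length * (80 + 4 * N + 60) + 50 * g.length ≤ g.length * (200 + 4 * N) := by
    have : g.length * (80 + 4 * N + 60) + 50 * g.length = g.length * (190 + 4 * N) := by ring
    rw [this]
    exact Nat.mul_le_mul_left _ (by omega)
  omega

/-- One round of the refinement of the list `var 1` of groups, with the list `var 4` of possible
entries of the keys. -/
def refineE : Exp :=
  bindE (.var 1) (bindE (.var 5)
    (.app (.ite (.isPair .env) (.pair .env (.const 0)) (.const 0)) subgroupE))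

theorem length_flatMap_ite_le {γ : Type*} (vals : List ℕ) (g : List (List ℕ × γ)) :
    (vals.flatMap fun a => if subgroup a g = [] then [] else [subgroup a g]).length ≤
      vals.length := by
  induction vals with
  | nil => simp
  | cons a vals ih =>
    rw [List.flatMap_cons, List.length_append, List.length_cons]
    split_ifs <;> simp only [List.length_singleton, List.length_nil] <;> omega

/-- `X` bounds the number of sequences, which is the sum of the sizes of the groups. -/
theorem ev_refineE {γ : Type*} (h : γ → Val) {N X : ℕ} (hN : 1000 ≤ N) (vals : List ℕ)
    (hvals : ∀ a ∈ vals, a ≤ N) (hvN : vals.length ≤ 2 * N) (gs : List (List (List ℕ × γ)))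
    (hgs : ∀ g ∈ gs, ∀ it ∈ g, ∀ b ∈ it.1, b ≤ N) (hX : (gs.map List.length).sum ≤ X)
    (hX' : gs.length ≤ X) (x y z ρ : Val) :
    Ev O κ refineE (.pair x (.pair (.ofList (gs.map fun g => .ofList (g.map (encItem h))))
        (.pair y (.pair z (.pair (.ofList (vals.map .nat)) ρ)))))
      (.ofList ((refineStep vals gs).map fun g => .ofList (g.map (encItem h))))
      ((X + 1) * N ^ 3) := by
  set v := Val.pair x (.pair (.ofList (gs.map fun g => .ofList (g.map (encItem h))))
        (.pair y (.pair z (.pair (.ofList (vals.map .nat)) ρ)))) with hv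
  have e := Ev.bind (O := O) (κ := κ)
    (fun g : List (List ℕ × γ) => Val.ofList (g.map (encItem h)))
    (fun g : List (List ℕ × γ) => Val.ofList (g.map (encItem h)))
    (fun g => vals.flatMap fun a => if subgroup a g = [] then [] else [subgroup a g])
    (T := fun g => 60 + 2 * N * (g.length * (200 + 4 * N) + 200)) (Ev.var 1 v)
    (b := bindE (.var 5)
      (.app (.ite (.isPair .env) (.pair .env (.const 0)) (.const 0)) subgroupE))
    (fun g hg => by
      have e₁ := Ev.bindConst (O := O) (κ := κ) Val.nat
        (fun g : List (List ℕ × γ) => Val.ofList (g.map (encItem h)))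
        (fun a => if subgroup a g = [] then [] else [subgroup a g])
        (T := 80 + g.length * (200 + 4 * N))
        (Ev.var 5 (.pair (.ofList (g.map (encItem h))) v))
        (b := .app (.ite (.isPair .env) (.pair .env (.const 0)) (.const 0)) subgroupE)
        (fun a ha => by
          refine (Ev.app (ev_subgroupE h a (hvals a ha) g (hgs g hg) v) (t := 10) ?_).mono
            (by omega)
          rcases hs : subgroup a g with _ | ⟨it, l⟩
          · exact ⟨rfl, by simp [time, eval, Val.ofList, Val.isPair, Val.num]⟩
          · constructor
            · simp [eval, Val.ofList, Val.isPair, Val.num]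
            · simp [time, eval, Val.ofList, Val.isPair, Val.num])
      refine e₁.mono ?_
      have h₁ := length_flatMap_ite_le vals g
      have h₂ := Nat.mul_le_mul_right (80 + g.length * (200 + 4 * N) + 60) hvN
      have h₃ : 2 * N * (g.length * (200 + 4 * N) + 200) =
        2 * N * (80 + g.length * (200 + 4 * N) + 60) + 2 * N * 60 := by ring
      omega)
  refine e.mono ?_
  have h₁ : ∀ gs : List (List (List ℕ × γ)), (gs.map fun g =>
      60 + 2 * N * (g.length * (200 + 4 * N) + 200) + 60 + 50 *
        (vals.flatMap fun a => if subgroup a g = [] then [] else [subgroup a g]).length).sum ≤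
      gs.length * (120 + 500 * N) + (gs.map List.length).sum * (2 * N * (200 + 4 * N)) := by
    intro gs
    induction gs with
    | nil => simp
    | cons g gs ih =>
      simp only [List.map_cons, List.sum_cons, List.length_cons]
      have h₁ := length_flatMap_ite_le vals g
      have e₁ : 2 * N * (g.length * (200 + 4 * N) + 200) =
        g.length * (2 * N * (200 + 4 * N)) + 400 * N := by ring
      have e₂ : (gs.length + 1) * (120 + 500 * N) =
        gs.length * (120 + 500 * N) + 120 + 500 * N := by ring
      have e₃ : (g.length + (gs.map List.length).sum) * (2 * N * (200 + 4 * N)) =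
        g.length * (2 * N * (200 + 4 * N)) +
          (gs.map List.length).sum * (2 * N * (200 + 4 * N)) := by ring
      omega
  refine (Nat.add_le_add_left (h₁ gs) _).trans ?_
  have h₂ := Nat.mul_le_mul_right (120 + 500 * N) hX'
  have h₃ := Nat.mul_le_mul_right (2 * N * (200 + 4 * N)) hX
  refine (Nat.add_le_add_left (Nat.add_le_add h₂ h₃) _).trans ?_
  have h₄ : (120 + 500 * N) + 2 * N * (200 + 4 * N) + 50 ≤ N ^ 3 := by
    nlinarith [Nat.mul_le_mul hN hN, Nat.mul_le_mul (Nat.mul_le_mul hN hN) (le_refl N)]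
  have h₅ := Nat.mul_le_mul_left (X + 1) h₄
  nlinarith [Nat.zero_le (N * N)]

/-- The groups of the list `var 0` of sequences that have the same keys for the vertices in the list
`var 1`. -/
def groupsE : Exp :=
  .app (.fold (.var 1) (.pair (.var 0) (.const 0)) refineE)
    (.pair itemsE (.pair (.var 1) (.pair (.app valsE (.pair (.var 1) (.const 0))) (.const 0))))

/-- The groups of the sequences in `L` that have the same keys for the vertices in `vs`. -/
noncomputable def groups {k m : ℕ} (L : List (List (Fin k ⊕ Fin m))) (vs : List (Fin k ⊕ Fin m)) :
    List (List (List ℕ × List (Fin k ⊕ Fin m))) :=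
  vs.foldl (fun gs _ => refineStep (List.range (vs.length + 1)).reverse gs)
    [L.map fun σ => (vs.map (key σ), σ)]

theorem isGrouping_init {k m : ℕ} {L : List (List (Fin k ⊕ Fin m))} (hL : L ≠ [])
    {vs : List (Fin k ⊕ Fin m)} (hvs : ∀ σ ∈ L, σ.length ≤ vs.length) :
    IsGrouping L (fun σ => vs.map (key σ)) (List.range (vs.length + 1)).reverse vs.length
      [L.map fun σ => (vs.map (key σ), σ)] := by
  refine IsGrouping.init hL fun σ hσ => ⟨by simp, fun a ha => ?_⟩
  obtain ⟨v, _, rfl⟩ := List.mem_map.mp ha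
  have := (key_le (σ := σ) v).trans (hvs σ hσ)
  simpa using Nat.lt_succ_of_le this

theorem isGrouping_groups {k m : ℕ} {L : List (List (Fin k ⊕ Fin m))} (hL : L ≠ [])
    {vs : List (Fin k ⊕ Fin m)} (hvs : ∀ σ ∈ L, σ.length ≤ vs.length) :
    IsGrouping L (fun σ => vs.map (key σ)) (List.range (vs.length + 1)).reverse 0
      (groups L vs) :=
  IsGrouping.foldl (List.nodup_reverse.mpr List.nodup_range) vs (isGrouping_init hL hvs)

theorem ev_groupsE {k m N X : ℕ} (hN : 1000 ≤ N) (hk : k ≤ N) (hm : m ≤ N)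
    (L : List (List (Fin k ⊕ Fin m))) (hL : L ≠ []) (vs : List (Fin k ⊕ Fin m))
    (hLn : ∀ σ ∈ L, σ.Nodup ∧ σ.length ≤ vs.length) (hX : L.length ≤ X) (hvs : vs.length ≤ N)
    (ρ : Val) :
    Ev O κ groupsE (.pair (.ofList (L.map encSeq)) (.pair (.ofList (vs.map encV)) ρ))
      (.ofList ((groups L vs).map fun g => .ofList (g.map (encItem encSeq))))
      ((X + 1) * N ^ 6) := by
  set v := Val.pair (.ofList (L.map encSeq)) (.pair (.ofList (vs.map encV)) ρ) with hv
  have e₁ := ev_itemsE (O := O) (κ := κ) hN hk hm L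
    (fun σ hσ => ⟨(hLn σ hσ).1, (hLn σ hσ).2.trans hvs⟩) hX vs hvs ρ
  have e₂ := ev_valsE (O := O) (κ := κ) encV vs hN hvs (.nat 0)
  have e₃ := e₁.pair ((Ev.var 1 v).pair (((((Ev.var 1 v).pair (Ev.const 0 v))).app e₂).pair
    (Ev.const 0 v)))
  refine (e₃.app (Ev.foldRem (T := (X + 1) * N ^ 3) encV
    (fun gs : List (List (List ℕ × List (Fin k ⊕ Fin m))) =>
      Val.ofList (gs.map fun g => .ofList (g.map (encItem encSeq))))
    (fun gs _ => refineStep (List.range (vs.length + 1)).reverse gs)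
    (fun rest gs => IsGrouping L (fun σ => vs.map (key σ)) (List.range (vs.length + 1)).reverse
      rest.length gs) (Ev.var 1 _) (t := 3) ⟨rfl, le_rfl⟩
    (isGrouping_init hL fun σ hσ => (hLn σ hσ).2) ?_)).mono ?_
  · intro x _ rest gs hgs
    refine ⟨?_, hgs.step (List.nodup_reverse.mpr List.nodup_range)⟩
    have hval : ∀ a ∈ (List.range (vs.length + 1)).reverse, a ≤ N := by
      intro a ha
      simp only [List.mem_reverse, List.mem_range] at ha
      omega
    exact ev_refineE encSeq hN _ hval (by simp; omega) gs
      (fun g hg it hit b hb => hval b (hgs.mem_vals g hg it hit b hb))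
      (hgs.sum_length.trans_le hX) (hgs.length_le.trans hX) _ _ _ _
  · have h₁ := Nat.mul_le_mul_right (18 + (X + 1) * N ^ 3) hvs
    have h₂ : N * (18 + (X + 1) * N ^ 3) ≤ (X + 1) * N ^ 5 := by
      have : 18 ≤ (X + 1) * N ^ 3 :=
        le_trans (by norm_num) (Nat.mul_le_mul (Nat.le_add_left 1 X)
          (Nat.pow_le_pow_left hN 3))
      calc N * (18 + (X + 1) * N ^ 3) ≤ N * ((X + 1) * N ^ 3 * 2) :=
            Nat.mul_le_mul_left _ (by omega)
        _ = (X + 1) * N ^ 4 * 2 := by ring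
        _ ≤ (X + 1) * N ^ 4 * N := Nat.mul_le_mul_left _ (by omega)
        _ = _ := by ring
    have h₃ : N ^ 3 + 100 ≤ (X + 1) * N ^ 5 := by
      have e₁ : N ^ 3 * 1000 ≤ N ^ 3 * N ^ 2 := Nat.mul_le_mul_left _ (by nlinarith)
      have e₂ : 1 ≤ N ^ 3 := Nat.one_le_pow _ _ (by omega)
      nlinarith [Nat.zero_le (X * N ^ 5)]
    have h₄ : (X + 1) * N ^ 5 * 1000 ≤ (X + 1) * N ^ 6 := by
      rw [show (X + 1) * N ^ 6 = (X + 1) * N ^ 5 * N by ring]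
      exact Nat.mul_le_mul_left _ hN
    omega

end Exp

/-! ### Minimum of a list -/

/-- The minimum of a list, as a list with at most one member. -/
def minL (l : List ℕ) : List ℕ :=
  l.foldl (fun acc x => if acc = [] then [x] else if x ≤ acc.headD 0 then [x] else acc) []

/-- Either `l` is empty, or `minL l` consists of the least member of `l`. -/
theorem minL_spec (l : List ℕ) :
    (l = [] ∧ minL l = []) ∨ ∃ m, minL l = [m] ∧ m ∈ l ∧ ∀ x ∈ l, m ≤ x := by
  induction l using List.reverseRecOn with
  | nil => exact Or.inl ⟨rfl, rfl⟩
  | append_singleton l y ih =>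
    right
    have h : minL (l ++ [y]) = (if minL l = [] then [y] else
        if y ≤ (minL l).headD 0 then [y] else minL l) := by
      simp [minL, List.foldl_append]
    rcases ih with ⟨rfl, h'⟩ | ⟨m, h', hm, hmin⟩
    · exact ⟨y, by rw [h, h', if_pos rfl], by simp, by simp⟩
    · rw [h, h', if_neg (by simp), List.headD_cons]
      split_ifs with hy
      · refine ⟨y, rfl, by simp, fun x hx => ?_⟩
        rcases List.mem_append.mp hx with hx | hx
        · exact hy.trans (hmin x hx)
        · exact (List.mem_singleton.mp hx).ge
      · refine ⟨m, rfl, by simp [hm], fun x hx => ?_⟩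
        rcases List.mem_append.mp hx with hx | hx
        · exact hmin x hx
        · rw [List.mem_singleton.mp hx]
          omega

theorem minL_eq_singleton {l : List ℕ} {m : ℕ} (h : m ∈ l) (hm : ∀ x ∈ l, m ≤ x) :
    minL l = [m] := by
  rcases minL_spec l with ⟨rfl, _⟩ | ⟨m', h', hm', hmin⟩
  · simp at h
  · rw [h', le_antisymm (hmin m h) (hm m' hm')]

theorem length_minL_le (l : List ℕ) : (minL l).length ≤ 1 := by
  rcases minL_spec l with ⟨_, h⟩ | ⟨m, h, _⟩ <;> simp [h]

section

variable {S U : Type*} [DecidableEq S] [DecidableEq U]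

/-! ### Plans up to permutations of the users -/

/-- A partial pattern: the list of unused users, the list of used users, and the assignments
(step, user) made so far. -/
abbrev Pat (S U : Type*) := List U × List U × List (S × U)

/-- The extensions of a pattern to the step `s`: it is assigned to a used user or to the first
unused user. -/
def extendPat {S U : Type*} (s : S) (p : Pat S U) : List (Pat S U) :=
  p.2.1.foldl (fun acc u => (p.1, p.2.1, (s, u) :: p.2.2) :: acc)
    (if p.1 = [] then [] else p.1.head?.toList.map fun u =>
      (p.1.tail, u :: p.2.1, (s, u) :: p.2.2))

/-- The patterns of the plans for the steps of a sequence.  New users are taken in the order of the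
list `us`, so that a pattern represents all plans that differ by a renaming of the users. -/
def pats {S R U : Type*} (us : List U) (σ : List (S ⊕ R)) : List (Pat S U) :=
  σ.foldl (fun ps v => v.elim (fun s => ps.flatMap (extendPat s)) fun _ => ps) [(us, [], [])]

theorem mem_extendPat {S U : Type*} {s : S} {p q : Pat S U} :
    q ∈ extendPat s p ↔ (∃ u ∈ p.2.1, q = (p.1, p.2.1, (s, u) :: p.2.2)) ∨
      ∃ u rem, p.1 = u :: rem ∧ q = (rem, u :: p.2.1, (s, u) :: p.2.2) := by
  have h : ∀ (l : List U) (acc : List (Pat S U)),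
      q ∈ l.foldl (fun acc u => (p.1, p.2.1, (s, u) :: p.2.2) :: acc) acc ↔
        (∃ u ∈ l, q = (p.1, p.2.1, (s, u) :: p.2.2)) ∨ q ∈ acc := by
    intro l
    induction l with
    | nil => simp
    | cons u l ih =>
      intro acc
      rw [List.foldl_cons, ih]
      simp only [List.mem_cons, exists_eq_or_imp]
      rw [or_left_comm, or_assoc]
  unfold extendPat
  rw [h]
  refine or_congr_right ?_
  rcases p.1 with _ | ⟨u, rem⟩
  · simp
  · simp only [reduceCtorEq, if_false, List.head?_cons, Option.toList_some, List.map_cons,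
      List.map_nil, List.mem_singleton, List.tail_cons, List.cons.injEq]
    constructor
    · exact fun h => ⟨u, rem, ⟨rfl, rfl⟩, h⟩
    · rintro ⟨_, _, ⟨rfl, rfl⟩, h⟩
      exact h

theorem pats_append_inl {S R U : Type*} (us : List U) (σ : List (S ⊕ R)) (s : S) :
    pats us (σ ++ [Sum.inl s]) = (pats us σ).flatMap (extendPat s) := by
  simp [pats, List.foldl_append]

theorem pats_append_inr {S R U : Type*} (us : List U) (σ : List (S ⊕ R)) (r : R) :
    pats us (σ ++ [Sum.inr r]) = pats us σ := by
  simp [pats, List.foldl_append]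

/-- The patterns of a sequence are assignments of the steps that occur to used users. -/
theorem pats_spec {S R U : Type*} {us : List U} {σ : List (S ⊕ R)} :
    ∀ p ∈ pats us σ, (p.2.1 ++ p.1).Perm us ∧ (∀ a ∈ p.2.2, a.2 ∈ p.2.1) ∧
      p.2.2.map Prod.fst = (σ.filterMap Sum.getLeft?).reverse := by
  induction σ using List.reverseRecOn with
  | nil => simp [pats]
  | append_singleton σ v ih =>
    rcases v with s | r
    · intro q hq
      rw [pats_append_inl, List.mem_flatMap] at hq
      obtain ⟨p, hp, hq⟩ := hq
      obtain ⟨h₁, h₂, h₃⟩ := ih p hp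
      rw [mem_extendPat] at hq
      rcases hq with ⟨u, hu, rfl⟩ | ⟨u, rem, hrem, rfl⟩
      · refine ⟨h₁, ?_, by simp [h₃]⟩
        simpa [hu] using h₂
      · rw [hrem] at h₁
        refine ⟨List.perm_middle.symm.trans h₁, ?_, by simp [h₃]⟩
        simp only [List.mem_cons, forall_eq_or_imp, true_or, true_and]
        exact fun a ha => Or.inr (h₂ a ha)
    · rw [pats_append_inr, List.filterMap_append, List.filterMap_cons_none rfl, List.filterMap_nil,
        List.append_nil]
      exact ih

/-- Every plan arises from a pattern by renaming the users. -/
theorem exists_pat {S R U : Type*} {us : List U} (hus : us.Nodup) (σ : List (S ⊕ R)) (f : S → U)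
    (hf : ∀ s, Sum.inl s ∈ σ → f s ∈ us) :
    ∃ p ∈ pats us σ, ∃ ρ : U → U, Set.InjOn ρ {u | u ∈ p.2.1} ∧
      (∀ u ∈ p.2.1, ρ u ∈ us) ∧ ∀ a ∈ p.2.2, f a.1 = ρ a.2 := by
  classical
  induction σ using List.reverseRecOn with
  | nil => exact ⟨(us, [], []), by simp [pats], id, by simp⟩
  | append_singleton σ v ih =>
    obtain ⟨p, hp, ρ, h₁, h₂, h₃⟩ := ih fun s hs => hf s (by simp [hs])
    rcases v with s | r
    · rw [pats_append_inl]
      -- either the user of `s` has already been renamed from a used user, or a new one is needed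
      by_cases hu : ∃ u ∈ p.2.1, ρ u = f s
      · obtain ⟨u, hu, hus⟩ := hu
        refine ⟨_, List.mem_flatMap.mpr ⟨p, hp, mem_extendPat.mpr (Or.inl ⟨u, hu, rfl⟩)⟩, ρ, h₁,
          h₂, ?_⟩
        simp only [List.mem_cons, forall_eq_or_imp, hus, true_and]
        exact h₃
      · have hperm := (pats_spec p hp).1
        have hnd : (p.2.1 ++ p.1).Nodup := hperm.nodup_iff.mpr hus
        -- otherwise `ρ` would be injective from all users to the users other than `f s`
        have hrem : p.1 ≠ [] := by
          intro hrem
          rw [hrem, List.append_nil] at hperm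
          have hsub : (p.2.1.toFinset.image ρ) ⊆ us.toFinset.erase (f s) := by
            intro x hx
            obtain ⟨u, hu', rfl⟩ := Finset.mem_image.mp hx
            rw [List.mem_toFinset] at hu'
            exact Finset.mem_erase.mpr ⟨fun h => hu ⟨u, hu', h⟩,
              List.mem_toFinset.mpr (h₂ u hu')⟩
          have hcard := Finset.card_le_card hsub
          rw [Finset.card_image_of_injOn (by simpa [Set.InjOn] using h₁),
            Finset.card_erase_of_mem (List.mem_toFinset.mpr (hf s (by simp))),
            List.toFinset_eq_of_perm _ _ hperm] at hcard
          have : 0 < us.toFinset.card :=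
            Finset.card_pos.mpr ⟨f s, List.mem_toFinset.mpr (hf s (by simp))⟩
          omega
        obtain ⟨u, rem, hrem⟩ := List.exists_cons_of_ne_nil hrem
        have hu0 : u ∉ p.2.1 := by
          rw [hrem] at hnd
          exact fun h => (List.nodup_append'.mp hnd).2.2 h (by simp)
        have hne : ∀ x ∈ p.2.1, Function.update ρ u (f s) x = ρ x := fun x hx =>
          Function.update_of_ne (fun h : x = u => hu0 (h ▸ hx)) _ _
        refine ⟨_, List.mem_flatMap.mpr ⟨p, hp, mem_extendPat.mpr (Or.inr ⟨u, rem, hrem, rfl⟩)⟩,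
          Function.update ρ u (f s), ?_, ?_, ?_⟩
        · intro x hx y hy hxy
          simp only [List.mem_cons, Set.mem_ofPred_eq] at hx hy
          rcases hx with rfl | hx <;> rcases hy with rfl | hy
          · rfl
          · rw [Function.update_self, hne y hy] at hxy
            exact absurd ⟨y, hy, hxy.symm⟩ hu
          · rw [Function.update_self, hne x hx] at hxy
            exact absurd ⟨x, hx, hxy⟩ hu
          · rw [hne x hx, hne y hy] at hxy
            exact h₁ hx hy hxy
        · simp only [List.mem_cons, forall_eq_or_imp, Function.update_self]
          exact ⟨hf s (by simp), fun x hx => hne x hx ▸ h₂ x hx⟩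
        · simp only [List.mem_cons, forall_eq_or_imp, Function.update_self, true_and]
          exact fun a ha => (hne a.2 ((pats_spec p hp).2.1 a ha)) ▸ h₃ a ha
    · exact ⟨p, by rwa [pats_append_inr], ρ, h₁, h₂, h₃⟩

/-- One extension for each used user has the same weight, and the extension by a new user has four
times the weight. -/
theorem sum_four_pow_extendPat {S U : Type*} (s : S) (p : Pat S U) :
    ((extendPat s p).map fun q => 4 ^ q.2.1.length).sum ≤
      (p.2.1.length + 4) * 4 ^ p.2.1.length := by
  have h : ∀ (l : List U) (acc : List (Pat S U)),
      ((l.foldl (fun acc u => (p.1, p.2.1, (s, u) :: p.2.2) :: acc) acc).map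
        fun q => 4 ^ q.2.1.length).sum =
      l.length * 4 ^ p.2.1.length + (acc.map fun q => 4 ^ q.2.1.length).sum := by
    intro l
    induction l with
    | nil => simp
    | cons u l ih =>
      intro acc
      rw [List.foldl_cons, ih, List.map_cons, List.sum_cons, List.length_cons]
      ring
  unfold extendPat
  rw [h, add_mul]
  refine Nat.add_le_add_left ?_ _
  rcases p.1 with _ | ⟨u, rem⟩
  · simp
  · simp [pow_succ, mul_comm]

/-- The number of patterns, weighted with `4` to the number of used users, is at most `(j + 3)!`,
because the `j`-th step has at most `j + 4` weighted choices. -/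
theorem sum_four_pow_pats {S R U : Type*} (us : List U) (σ : List (S ⊕ R)) :
    (∀ p ∈ pats us σ, p.2.1.length ≤ (σ.filterMap Sum.getLeft?).length) ∧
    ((pats us σ).map fun q => 4 ^ q.2.1.length).sum ≤
      Nat.factorial ((σ.filterMap Sum.getLeft?).length + 3) := by
  induction σ using List.reverseRecOn with
  | nil => simp [pats, Nat.factorial]
  | append_singleton σ v ih =>
    obtain ⟨ih₁, ih₂⟩ := ih
    rcases v with s | r
    · rw [pats_append_inl]
      simp only [List.filterMap_append, List.filterMap_cons, Sum.getLeft?_inl, List.filterMap_nil,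
        List.length_append, List.length_cons, List.length_nil]
      constructor
      · intro q hq
        obtain ⟨p, hp, hq⟩ := List.mem_flatMap.mp hq
        have := ih₁ p hp
        rcases mem_extendPat.mp hq with ⟨u, _, rfl⟩ | ⟨u, rem, _, rfl⟩
        · simp only
          omega
        · simp only [List.length_cons]
          omega
      · have h : ∀ L : List (Pat S U),
            (∀ p ∈ L, p.2.1.length ≤ (σ.filterMap Sum.getLeft?).length) →
            ((L.flatMap (extendPat s)).map fun q => 4 ^ q.2.1.length).sum ≤
              ((σ.filterMap Sum.getLeft?).length + 4) *
                (L.map fun q => 4 ^ q.2.1.length).sum := by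
          intro L hL
          induction L with
          | nil => simp
          | cons p L ih =>
            rw [List.flatMap_cons, List.map_append, List.sum_append, List.map_cons,
              List.sum_cons, mul_add]
            refine Nat.add_le_add ((sum_four_pow_extendPat s p).trans ?_)
              (ih fun p hp => hL p (by simp [hp]))
            exact Nat.mul_le_mul_right _ (by have := hL p (by simp); omega)
        refine (h _ ih₁).trans ?_
        rw [show (σ.filterMap Sum.getLeft?).length + (0 + 1) + 3 =
          ((σ.filterMap Sum.getLeft?).length + 3) + 1 by ring, Nat.factorial_succ]
        exact Nat.mul_le_mul_left _ ih₂
    · rw [pats_append_inr, List.filterMap_append, List.filterMap_cons_none rfl, List.filterMap_nil,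
        List.append_nil]
      exact ⟨ih₁, ih₂⟩

/-! ### The dynamic program for the assignment of users -/

/-- The costs of the injective maps from `A` to `us`, where `w l u` is the cost of mapping `l` to
`u`. -/
def injCosts {U : Type*} (w : U → U → ℕ) (us A : List U) : Set ℕ :=
  {c | ∃ ρ : U → U, Set.InjOn ρ {l | l ∈ A} ∧ (∀ l ∈ A, ρ l ∈ us) ∧
    c = (A.map fun l => w l (ρ l)).sum}

theorem injCosts_nil {U : Type*} [DecidableEq U] {w : U → U → ℕ} {A : List U} {c : ℕ} :
    c ∈ injCosts w [] A ↔ A = [] ∧ c = 0 := by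
  constructor
  · rintro ⟨ρ, _, h, rfl⟩
    have : A = [] := List.eq_nil_iff_forall_not_mem.mpr fun l hl => by simpa using h l hl
    simp [this]
  · rintro ⟨rfl, rfl⟩
    exact ⟨id, by simp⟩

theorem sum_map_filter_ne {A : List U} (hA : A.Nodup) {l : U} (hl : l ∈ A) (g : U → ℕ) :
    (A.map g).sum = ((A.filter (· ≠ l)).map g).sum + g l := by
  have h : A.filter (· ≠ l) = A.erase l := by
    rw [hA.erase_eq_filter]
    exact List.filter_congr fun x _ => by by_cases h : x = l <;> simp [h]
  rw [h, ← List.sum_map_erase g hl, add_comm]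

/-- The recursion of the dynamic program: an injective map to the users in `us` and `u` either does
not attain `u`, or attains it exactly once. -/
theorem injCosts_append {w : U → U → ℕ} {us A : List U} {u : U} (hu : u ∉ us) (hA : A.Nodup)
    {c : ℕ} :
    c ∈ injCosts w (us ++ [u]) A ↔ c ∈ injCosts w us A ∨
      ∃ l ∈ A, ∃ c' ∈ injCosts w us (A.filter (· ≠ l)), c = c' + w l u := by
  constructor
  · rintro ⟨ρ, h₁, h₂, rfl⟩
    -- if `u` is attained, the member of `A` that is mapped to `u` is removed
    by_cases h : ∃ l ∈ A, ρ l = u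
    · obtain ⟨l, hl, rfl⟩ := h
      right
      refine ⟨l, hl, ((A.filter (· ≠ l)).map fun l => w l (ρ l)).sum, ⟨ρ, ?_, ?_, rfl⟩,
        sum_map_filter_ne hA hl fun l => w l (ρ l)⟩
      · refine h₁.mono fun x hx => ?_
        simp only [List.mem_filter, Set.mem_ofPred_eq] at hx
        exact hx.1
      · intro x hx
        simp only [List.mem_filter, decide_eq_true_eq] at hx
        have := h₂ x hx.1
        rw [List.mem_append, List.mem_singleton] at this
        exact this.resolve_right fun h => hx.2 (h₁ hx.1 hl h)
    · left
      refine ⟨ρ, h₁, fun l hl => ?_, rfl⟩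
      have := h₂ l hl
      rw [List.mem_append, List.mem_singleton] at this
      exact this.resolve_right fun h' => h ⟨l, hl, h'⟩
  · rintro (⟨ρ, h₁, h₂, rfl⟩ | ⟨l, hl, _, ⟨ρ, h₁, h₂, rfl⟩, rfl⟩)
    · exact ⟨ρ, h₁, fun l hl => List.mem_append_left _ (h₂ l hl), rfl⟩
    · have hmem : ∀ x ∈ A, x ≠ l → x ∈ A.filter (· ≠ l) := fun x hx hxl => by simp [hx, hxl]
      refine ⟨Function.update ρ l u, ?_, ?_, ?_⟩
      · intro x hx y hy hxy
        by_cases hxl : x = l <;> by_cases hyl : y = l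
        · rw [hxl, hyl]
        · rw [hxl, Function.update_self, Function.update_of_ne hyl] at hxy
          exact absurd (hxy ▸ h₂ y (hmem y hy hyl)) hu
        · rw [hyl, Function.update_self, Function.update_of_ne hxl] at hxy
          exact absurd (hxy ▸ h₂ x (hmem x hx hxl)) hu
        · rw [Function.update_of_ne hxl, Function.update_of_ne hyl] at hxy
          exact h₁ (hmem x hx hxl) (hmem y hy hyl) hxy
      · intro x hx
        by_cases hxl : x = l
        · simp [hxl]
        · rw [Function.update_of_ne hxl]
          exact List.mem_append_left _ (h₂ x (hmem x hx hxl))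
      · rw [sum_map_filter_ne hA hl, Function.update_self]
        congr 2
        refine List.map_congr_left fun x hx => ?_
        simp only [List.mem_filter, decide_eq_true_eq] at hx
        rw [Function.update_of_ne hx.2]

/-- All sublists of the reversed list. -/
def subs {U : Type*} (l : List U) : List (List U) :=
  l.foldl (fun acc x => acc.flatMap fun A => [A, x :: A]) [[]]

theorem mem_subs {U : Type*} {l A : List U} : A ∈ subs l ↔ A.Sublist l.reverse := by
  induction l using List.reverseRecOn generalizing A with
  | nil => simp [subs]
  | append_singleton l x ih =>
    have h : subs (l ++ [x]) = (subs l).flatMap fun A => [A, x :: A] := by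
      simp [subs, List.foldl_append]
    rw [h, List.reverse_append, List.reverse_singleton, List.singleton_append,
      List.sublist_cons_iff, List.mem_flatMap]
    simp only [List.mem_cons, List.not_mem_nil, or_false, ih]
    constructor
    · rintro ⟨B, hB, rfl | rfl⟩
      · exact Or.inl hB
      · exact Or.inr ⟨B, rfl, hB⟩
    · rintro (hB | ⟨B, rfl, hB⟩)
      · exact ⟨A, hB, Or.inl rfl⟩
      · exact ⟨B, hB, Or.inr rfl⟩

theorem length_subs {U : Type*} (l : List U) : (subs l).length = 2 ^ l.length := by
  induction l using List.reverseRecOn with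
  | nil => simp [subs]
  | append_singleton l x ih =>
    have h : subs (l ++ [x]) = (subs l).flatMap fun A => [A, x :: A] := by
      simp [subs, List.foldl_append]
    rw [h, List.length_flatMap, List.length_append, List.length_singleton, pow_succ, ← ih]
    simp

/-- The costs of the assignments of the members of `A`, when the last user is `u` and the table `T`
contains the costs for the other users. -/
def cands (w : U → U → ℕ) (u : U) (T : List (List U × ℕ)) (A : List U) : List ℕ :=
  A.foldl (fun acc l => T.foldl (fun acc e =>
      if e.1 = A.filter (· ≠ l) then (e.2 + w l u) :: acc else acc) acc)
    (T.flatMap fun e => if e.1 = A then [e.2] else [])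

/-- One round of the dynamic program: the table is extended by the user `u`. -/
def tableStep (w : U → U → ℕ) (Ss : List (List U)) (T : List (List U × ℕ)) (u : U) :
    List (List U × ℕ) :=
  Ss.flatMap fun A => (minL (cands w u T A)).map fun c => (A, c)

/-- The candidates correspond to the two cases in `injCosts_append`. -/
theorem mem_cands {w : U → U → ℕ} {u : U} {T : List (List U × ℕ)} {A : List U} {c : ℕ} :
    c ∈ cands w u T A ↔ (A, c) ∈ T ∨
      ∃ l ∈ A, ∃ c', (A.filter (· ≠ l), c') ∈ T ∧ c = c' + w l u := by
  have h₁ : ∀ (B : List U) (n : ℕ) (T : List (List U × ℕ)) (acc : List ℕ),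
      c ∈ T.foldl (fun acc e => if e.1 = B then (e.2 + n) :: acc else acc) acc ↔
        (∃ c', (B, c') ∈ T ∧ c = c' + n) ∨ c ∈ acc := by
    intro B n T
    induction T with
    | nil => simp
    | cons e T ih =>
      intro acc
      rw [List.foldl_cons, ih]
      by_cases he : e.1 = B
      · rw [if_pos he, List.mem_cons]
        obtain ⟨e₁, e₂⟩ := e
        simp only at he
        subst he
        constructor
        · rintro (⟨c', h, rfl⟩ | rfl | h)
          · exact Or.inl ⟨c', by simp [h], rfl⟩
          · exact Or.inl ⟨e₂, by simp, rfl⟩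
          · exact Or.inr h
        · rintro (⟨c', h, rfl⟩ | h)
          · rcases List.mem_cons.mp h with h | h
            · simp only [Prod.mk.injEq, true_and] at h
              subst h
              exact Or.inr (Or.inl rfl)
            · exact Or.inl ⟨c', h, rfl⟩
          · exact Or.inr (Or.inr h)
      · rw [if_neg he]
        refine or_congr_left (exists_congr fun c' => and_congr_left fun _ => ?_)
        rw [List.mem_cons]
        refine (or_iff_right fun h => he ?_).symm
        rw [← h]
  have h₂ : ∀ (L : List U) (acc : List ℕ),
      c ∈ L.foldl (fun acc l => T.foldl (fun acc e =>
        if e.1 = A.filter (· ≠ l) then (e.2 + w l u) :: acc else acc) acc) acc ↔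
        (∃ l ∈ L, ∃ c', (A.filter (· ≠ l), c') ∈ T ∧ c = c' + w l u) ∨ c ∈ acc := by
    intro L
    induction L with
    | nil => simp
    | cons l L ih =>
      intro acc
      rw [List.foldl_cons, ih, h₁]
      simp only [List.mem_cons, exists_eq_or_imp]
      rw [or_left_comm, or_assoc]
  unfold cands
  rw [h₂, or_comm]
  refine or_congr_left ?_
  rw [List.mem_flatMap]
  constructor
  · rintro ⟨e, he, h⟩
    split_ifs at h with h'
    · rw [List.mem_singleton] at h
      rw [← h', h]
      exact he
    · simp at h
  · exact fun h => ⟨_, h, by simp⟩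

/-- The table contains for every list of labels the least cost of an injective map to `us`, if there
is one. -/
structure IsTable (w : U → U → ℕ) (used us : List U) (T : List (List U × ℕ)) : Prop where
  sound : ∀ e ∈ T, e.2 ∈ injCosts w us e.1
  complete : ∀ A ∈ subs used, ∀ c ∈ injCosts w us A, ∃ c' ≤ c, (A, c') ∈ T

/-- Without users, the only injective map is the one of the empty set. -/
theorem isTable_nil (w : U → U → ℕ) (used : List U) : IsTable w used [] [([], 0)] where
  sound := by simp [injCosts_nil]
  complete := by
    intro A _ c hc
    obtain ⟨rfl, rfl⟩ := injCosts_nil.mp hc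
    exact ⟨0, le_rfl, by simp⟩

/-- The candidates are costs of injective maps to the users in `us` and `u`. -/
theorem IsTable.mem_injCosts {w : U → U → ℕ} {used us : List U} (hused : used.Nodup)
    {T : List (List U × ℕ)} (h : IsTable w used us T) {u : U} (hu : u ∉ us) {A : List U}
    (hA : A ∈ subs used) {c : ℕ} (hc : c ∈ cands w u T A) : c ∈ injCosts w (us ++ [u]) A := by
  rw [mem_cands] at hc
  rw [injCosts_append hu ((List.nodup_reverse.mpr hused).sublist (mem_subs.mp hA))]
  rcases hc with hc | ⟨l, hl, c', hc', rfl⟩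
  · exact Or.inl (h.sound _ hc)
  · exact Or.inr ⟨l, hl, c', h.sound _ hc', rfl⟩

/-- One round of the dynamic program extends a correct table by one user. -/
theorem IsTable.step {w : U → U → ℕ} {used us : List U} (hused : used.Nodup)
    {T : List (List U × ℕ)} (h : IsTable w used us T) {u : U} (hu : u ∉ us) :
    IsTable w used (us ++ [u]) (tableStep w (subs used) T u) := by
  have hnd : ∀ A ∈ subs used, A.Nodup := fun A hA =>
    (List.nodup_reverse.mpr hused).sublist (mem_subs.mp hA)
  constructor
  · rintro ⟨A, c⟩ he
    unfold tableStep at he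
    simp only [List.mem_flatMap, List.mem_map] at he
    obtain ⟨B, hB, c', hc', hBc⟩ := he
    simp only [Prod.mk.injEq] at hBc
    obtain ⟨rfl, rfl⟩ := hBc
    have hmem : c' ∈ cands w u T B := by
      rcases minL_spec (cands w u T B) with ⟨_, h'⟩ | ⟨m, h', hm, _⟩
      · simp [h'] at hc'
      · rw [h', List.mem_singleton] at hc'
        exact hc' ▸ hm
    exact h.mem_injCosts hused hu hB hmem
  · intro A hA c hc
    have key : ∃ c' ≤ c, c' ∈ cands w u T A := by
      rw [injCosts_append hu (hnd A hA)] at hc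
      rcases hc with hc | ⟨l, hl, c'', hc'', rfl⟩
      · obtain ⟨c', hc', hT⟩ := h.complete A hA c hc
        exact ⟨c', hc', mem_cands.mpr (Or.inl hT)⟩
      · obtain ⟨c', hc', hT⟩ := h.complete _
          (mem_subs.mpr (List.filter_sublist.trans (mem_subs.mp hA))) c'' hc''
        exact ⟨c' + w l u, by omega, mem_cands.mpr (Or.inr ⟨l, hl, c', hT, rfl⟩)⟩
    obtain ⟨c', hc', hmem⟩ := key
    rcases minL_spec (cands w u T A) with ⟨h', _⟩ | ⟨m, h', hm, hmin⟩
    · simp [h'] at hmem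
    · refine ⟨m, (hmin c' hmem).trans hc', ?_⟩
      unfold tableStep
      simp only [List.mem_flatMap, List.mem_map]
      exact ⟨A, hA, m, by simp [h'], rfl⟩

/-- The table for all users. -/
def table (w : U → U → ℕ) (used us : List U) : List (List U × ℕ) :=
  us.foldl (tableStep w (subs used)) [([], 0)]

theorem isTable_table (w : U → U → ℕ) {used us : List U} (hused : used.Nodup) (hus : us.Nodup) :
    IsTable w used us (table w used us) := by
  induction us using List.reverseRecOn with
  | nil => exact isTable_nil w used
  | append_singleton us u ih =>
    have hu : u ∉ us := fun h => (List.nodup_append'.mp hus).2.2 h (by simp)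
    have : table w used (us ++ [u]) = tableStep w (subs used) (table w used us) u := by
      simp [table, List.foldl_append]
    rw [this]
    exact (ih (List.nodup_append'.mp hus).1).step hused hu

/-- The costs of the complete assignments in the table. -/
def finals (w : U → U → ℕ) (used us : List U) : List ℕ :=
  (table w used us).flatMap fun e => if e.1 = used.reverse then [e.2] else []

theorem mem_finals {w : U → U → ℕ} {used us : List U} {c : ℕ} :
    c ∈ finals w used us ↔ (used.reverse, c) ∈ table w used us := by
  unfold finals
  rw [List.mem_flatMap]
  constructor
  · rintro ⟨e, he, h⟩
    split_ifs at h with h'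
    · rw [List.mem_singleton] at h
      rw [← h', h]
      exact he
    · simp at h
  · exact fun h => ⟨_, h, by simp⟩

end

/-! ### Correctness of the computation of minimum costs -/

section

variable {S R U : Type*} [Fintype S] [Fintype U] [DecidableEq S] [DecidableEq R] [DecidableEq U]
  (W : Schema S R U)

/-- The partial plan given by a list of assignments. -/
def planOf {S U : Type*} [DecidableEq S] (asg : List (S × U)) : Plan S U := fun s => asg.lookup s

/-- The sum of the weights of all constraints. -/
def Schema.constraintCost {S R U : Type*} [DecidableEq S] [DecidableEq R] (W : Schema S R U)
    (σ : List (S ⊕ R)) (π : Plan S U) : ℕ :=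
  (W.constraints.map fun c => c.weight (c.subscopes σ) π).sum

/-- The steps that are assigned to the user `l`. -/
def block {S U : Type*} [DecidableEq S] [DecidableEq U] (asg : List (S × U)) (l : U) : List S :=
  asg.flatMap fun a => if a.2 = l then [a.1] else []

/-- The costs of the plans that the dynamic program finds for `σ`. -/
def Schema.planCosts {S R U : Type*} [DecidableEq S] [DecidableEq R] [DecidableEq U]
    (W : Schema S R U) (us : List U) (σ : List (S ⊕ R)) : List ℕ :=
  (pats us σ).flatMap fun p =>
    (finals (fun l u => W.authWeight (block p.2.2 l).toFinset u) p.2.1 us).map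
      fun c => c + W.constraintCost σ (planOf p.2.2)

theorem lookup_eq_some_iff {S U : Type*} [DecidableEq S] {asg : List (S × U)}
    (h : (asg.map Prod.fst).Nodup) {s : S} {u : U} :
    asg.lookup s = some u ↔ (s, u) ∈ asg := by
  induction asg with
  | nil => simp
  | cons a asg ih =>
    obtain ⟨s', u'⟩ := a
    simp only [List.map_cons, List.nodup_cons] at h
    by_cases hs : s = s'
    · subst hs
      have : ∀ u, (s, u) ∉ asg := fun u hu => h.1 (List.mem_map.mpr ⟨_, hu, rfl⟩)
      simp only [List.lookup_cons, beq_self_eq_true, Option.some.injEq, List.mem_cons,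
        Prod.mk.injEq, true_and, this, or_false]
      exact eq_comm
    · have hb : (s == s') = false := by simpa using hs
      simp only [List.lookup_cons, hb, ih h.2, List.mem_cons, Prod.mk.injEq, hs, false_and,
        false_or]

theorem mem_of_mem_splitOnP {α : Type*} {p : α → Bool} {σ l : List α} (hl : l ∈ σ.splitOnP p)
    {v : α} (hv : v ∈ l) : v ∈ σ := by
  induction σ generalizing l with
  | nil =>
    rw [List.splitOnP_nil, List.mem_singleton] at hl
    rwa [hl] at hv
  | cons x σ ih =>
    rw [List.splitOnP_cons_eq_if_modifyHead] at hl
    split_ifs at hl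
    · rcases List.mem_cons.mp hl with rfl | hl
      · simp at hv
      · exact List.mem_cons_of_mem _ (ih hl hv)
    · rcases hs : σ.splitOnP p with _ | ⟨l₀, L⟩
      · exact absurd hs (List.splitOnP_ne_nil p σ)
      · rw [hs, List.modifyHead_cons] at hl
        rcases List.mem_cons.mp hl with rfl | hl
        · rcases List.mem_cons.mp hv with rfl | hv
          · simp
          · exact List.mem_cons_of_mem _ (ih (hs ▸ List.mem_cons_self) hv)
        · exact List.mem_cons_of_mem _ (ih (hs ▸ List.mem_cons_of_mem _ hl) hv)

theorem mem_filterMap_getLeft {S R : Type*} {σ : List (S ⊕ R)} {s : S} :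
    s ∈ σ.filterMap Sum.getLeft? ↔ Sum.inl s ∈ σ := by
  simp only [List.mem_filterMap]
  constructor
  · rintro ⟨v, hv, h⟩
    rwa [← Sum.getLeft?_eq_some_iff.mp h]
  · exact fun h => ⟨_, h, rfl⟩

theorem nodup_fst_of_mem_pats {S R U : Type*} {σ : List (S ⊕ R)} (hσ : σ.Nodup) {us : List U}
    {p : Pat S U} (hp : p ∈ pats us σ) : (p.2.2.map Prod.fst).Nodup := by
  rw [(pats_spec p hp).2.2, List.nodup_reverse]
  refine hσ.filterMap fun a a' b h h' => ?_
  rw [Option.mem_def, Sum.getLeft?_eq_some_iff] at h h'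
  rw [h, h']

theorem isSome_planOf_iff {S R U : Type*} [DecidableEq S] {σ : List (S ⊕ R)} (hσ : σ.Nodup)
    {us : List U} {p : Pat S U} (hp : p ∈ pats us σ) (s : S) :
    (planOf p.2.2 s).isSome ↔ Sum.inl s ∈ σ := by
  rw [Option.isSome_iff_exists, ← mem_filterMap_getLeft, ← List.mem_reverse,
    ← (pats_spec p hp).2.2, List.mem_map]
  simp only [planOf, lookup_eq_some_iff (nodup_fst_of_mem_pats hσ hp)]
  constructor
  · rintro ⟨u, h⟩
    exact ⟨_, h, rfl⟩
  · rintro ⟨⟨s', u⟩, h, rfl⟩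
    exact ⟨u, h⟩

theorem WeightedConstraint.subset_of_mem_subscopes {S R U : Type*} [DecidableEq S] [DecidableEq R]
    {c : WeightedConstraint S R U} {σ : List (S ⊕ R)} {T : Finset S} (hT : T ∈ c.subscopes σ) :
    T ⊆ c.scope ∧ ∀ s ∈ T, Sum.inl s ∈ σ := by
  unfold WeightedConstraint.subscopes at hT
  obtain ⟨l, hl, rfl⟩ := List.mem_map.mp hT
  refine ⟨Finset.inter_subset_left, fun s hs => ?_⟩
  simp only [Finset.mem_inter, List.mem_toFinset, mem_filterMap_getLeft] at hs
  exact mem_of_mem_splitOnP hl hs.2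

/-- A renaming of the users does not change the weights of user-independent constraints, and turns
the blocks of a pattern into the sets of steps of the renamed users. -/
theorem Schema.cost_rename (hui : ∀ c ∈ W.constraints, c.UserIndependent) {σ : List (S ⊕ R)}
    (hσ : σ.Nodup) {us : List U} (hus : us.Nodup) {p : Pat S U} (hp : p ∈ pats us σ) (ρ : U → U)
    (hρ : Set.InjOn ρ {u | u ∈ p.2.1}) :
    IsPlanFor σ (fun s => (planOf p.2.2 s).map ρ) ∧
    W.cost σ (fun s => (planOf p.2.2 s).map ρ) =
      (p.2.1.map fun l => W.authWeight (block p.2.2 l).toFinset (ρ l)).sum +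
        W.constraintCost σ (planOf p.2.2) := by
  obtain ⟨hperm, hmem, _⟩ := pats_spec p hp
  have hnd := nodup_fst_of_mem_pats hσ hp
  have hused : p.2.1.Nodup := (List.nodup_append'.mp (hperm.nodup_iff.mpr hus)).1
  have hsome : ∀ s u, planOf p.2.2 s = some u ↔ (s, u) ∈ p.2.2 := fun s u =>
    lookup_eq_some_iff hnd
  have hdom := isSome_planOf_iff hσ hp
  have hplan : ∀ ρ : U → U, Plan.dom (fun s => (planOf p.2.2 s).map ρ) =
      {s | Sum.inl s ∈ σ} := by
    intro ρ
    ext s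
    simp only [Plan.dom, Set.mem_ofPred_eq, Option.isSome_map, hdom]
  refine ⟨hplan ρ, ?_⟩
  -- an injective map on the used users extends to a permutation
  obtain ⟨φ, hφ⟩ : ∃ φ : Equiv.Perm U, ∀ u ∈ p.2.1, φ u = ρ u := by
    let e : {u // u ∈ p.2.1} ≃ {u // u ∈ ρ '' {u | u ∈ p.2.1}} :=
      Equiv.Set.imageOfInjOn ρ {u | u ∈ p.2.1} hρ
    classical
    refine ⟨e.extendSubtype, fun u hu => ?_⟩
    rw [Equiv.extendSubtype_apply_of_mem e u hu]
    rfl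
  have hφplan : (fun s => (planOf p.2.2 s).map ρ : Plan S U) =
      (planOf p.2.2).permute φ := by
    funext s
    unfold Plan.permute
    rcases hs : planOf p.2.2 s with _ | u
    · rfl
    · rw [hsome] at hs
      simp only [Option.map_some, hφ u (hmem _ hs)]
  rw [hφplan]
  unfold Schema.cost
  rw [add_comm]
  congr 1
  · rw [← Equiv.sum_comp φ]
    have hblock : ∀ l, (Finset.univ.filter fun s => (planOf p.2.2).permute φ s = some (φ l)) =
        (block p.2.2 l).toFinset := by
      intro l
      ext s
      unfold Plan.permute block
      rw [Finset.mem_filter, List.mem_toFinset, List.mem_flatMap]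
      simp only [Finset.mem_univ, true_and, Option.map_eq_some_iff, EmbeddingLike.apply_eq_iff_eq,
        exists_eq_right, hsome]
      constructor
      · exact fun h => ⟨_, h, by simp⟩
      · rintro ⟨a, ha, h⟩
        split_ifs at h with h'
        · rw [List.mem_singleton] at h
          rw [h, ← h']
          exact ha
        · simp at h
    simp only [hblock]
    rw [← Finset.sum_subset (Finset.subset_univ p.2.1.toFinset), List.sum_toFinset _ hused]
    · congr 1
      exact List.map_congr_left fun l hl => by rw [hφ l hl]
    -- a user without steps has authorization weight `0`
    · intro l _ hl
      rw [W.authWeight_eq_zero_iff]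
      intro s hs
      rw [List.mem_toFinset, block, List.mem_flatMap] at hs
      obtain ⟨a, ha, h⟩ := hs
      split_ifs at h with h'
      · exact absurd (List.mem_toFinset.mpr (h' ▸ hmem a ha)) hl
      · simp at h
  · unfold Schema.constraintCost
    refine congrArg List.sum (List.map_congr_left fun c hc => ?_)
    refine (hui c hc).2 _ _ (fun T hT => ?_) φ
    obtain ⟨h₁, h₂⟩ := WeightedConstraint.subset_of_mem_subscopes hT
    refine ⟨h₁, fun s hs => ?_⟩
    simp only [Plan.dom, Set.mem_ofPred_eq, hdom]
    exact h₂ s hs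

/-- The dynamic program finds the minimum cost. -/
theorem Schema.minL_planCosts (hui : ∀ c ∈ W.constraints, c.UserIndependent) {σ : List (S ⊕ R)}
    (hσ : σ.Nodup) {us : List U} (hus : us.Nodup) (hall : ∀ u, u ∈ us) :
    minL (W.planCosts us σ) = [W.minCost σ] := by
  -- every cost that is found is the cost of a renamed pattern
  have hsound : ∀ c ∈ W.planCosts us σ, ∃ π : Plan S U, IsPlanFor σ π ∧ W.cost σ π = c := by
    intro c hc
    unfold Schema.planCosts at hc
    simp only [List.mem_flatMap, List.mem_map] at hc
    obtain ⟨p, hp, c, hc, rfl⟩ := hc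
    have hused : p.2.1.Nodup :=
      (List.nodup_append'.mp ((pats_spec p hp).1.nodup_iff.mpr hus)).1
    obtain ⟨ρ, h₁, _, h₃⟩ := (isTable_table _ hused hus).sound _ (mem_finals.mp hc)
    simp only [List.mem_reverse] at h₁ h₃
    obtain ⟨h₄, h₅⟩ := W.cost_rename hui hσ hus hp ρ h₁
    refine ⟨_, h₄, ?_⟩
    rw [h₅, h₃, List.map_reverse, List.sum_reverse]
  -- every plan is a renamed pattern, and the table contains an assignment that costs no more
  have hcomplete : ∀ π : Plan S U, IsPlanFor σ π → ∃ c ∈ W.planCosts us σ, c ≤ W.cost σ π := by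
    intro π hπ
    have hdom : ∀ s, (π s).isSome ↔ Sum.inl s ∈ σ := fun s => Set.ext_iff.mp hπ s
    by_cases hne : Nonempty U
    · obtain ⟨u₀⟩ := hne
      obtain ⟨p, hp, ρ, h₁, h₂, h₃⟩ := exists_pat hus σ (fun s => (π s).getD u₀)
        fun s _ => hall _
      have hused : p.2.1.Nodup :=
        (List.nodup_append'.mp ((pats_spec p hp).1.nodup_iff.mpr hus)).1
      obtain ⟨h₄, h₅⟩ := W.cost_rename hui hσ hus hp ρ h₁
      have hπeq : (fun s => (planOf p.2.2 s).map ρ) = π := by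
        funext s
        rcases hs : planOf p.2.2 s with _ | u
        · have h₆ : s ∉ Plan.dom (fun s => (planOf p.2.2 s).map ρ) := by
            simp [Plan.dom, hs]
          rw [h₄, ← hπ] at h₆
          simpa [Plan.dom] using Eq.symm (by simpa [Plan.dom] using h₆ : π s = none)
        · have h₆ : s ∈ Plan.dom (fun s => (planOf p.2.2 s).map ρ) := by
            simp [Plan.dom, hs]
          rw [h₄, ← hπ] at h₆
          obtain ⟨u', hu'⟩ := Option.isSome_iff_exists.mp h₆
          have hmem : (s, u) ∈ p.2.2 :=
            (lookup_eq_some_iff (nodup_fst_of_mem_pats hσ hp)).mp hs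
          have := h₃ _ hmem
          simp only [hu', Option.getD_some] at this
          rw [hu', Option.map_some, ← this]
      rw [hπeq] at h₅
      obtain ⟨c, hc, hT⟩ := (isTable_table (fun l u =>
        W.authWeight (block p.2.2 l).toFinset u) hused hus).complete p.2.1.reverse
        (mem_subs.mpr (List.Sublist.refl _)) _ ⟨ρ, by simpa using h₁, by simpa using h₂, rfl⟩
      refine ⟨c + W.constraintCost σ (planOf p.2.2), ?_, ?_⟩
      · unfold Schema.planCosts
        exact List.mem_flatMap.mpr ⟨p, hp, List.mem_map.mpr ⟨c, mem_finals.mpr hT, rfl⟩⟩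
      · rw [h₅]
        rw [List.map_reverse, List.sum_reverse] at hc
        exact Nat.add_le_add_right hc _
    · -- without users there are no steps, and the empty pattern has cost `0`
      have hnos : ∀ s : S, False := fun s => hne ⟨(W.exists_auth s).choose⟩
      have hus0 : us = [] := List.eq_nil_iff_forall_not_mem.mpr fun u _ => hne ⟨u⟩
      have hpats : (([], [], []) : Pat S U) ∈ pats us σ := by
        subst hus0
        clear hdom hπ hsound hσ
        induction σ using List.reverseRecOn with
        | nil => simp [pats]
        | append_singleton σ v ih =>
          rcases v with s | r
          · exact (hnos s).elim
          · rw [pats_append_inr]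
            exact ih
      have hπeq : planOf ([] : List (S × U)) = π := funext fun s => (hnos s).elim
      refine ⟨0 + W.constraintCost σ (planOf []), ?_, ?_⟩
      · unfold Schema.planCosts
        refine List.mem_flatMap.mpr ⟨_, hpats, List.mem_map.mpr ⟨0, ?_, rfl⟩⟩
        rw [mem_finals, hus0]
        simp [table]
      · rw [hπeq, zero_add]
        exact Nat.le_add_right _ _
  obtain ⟨⟨π, hπ, hcost⟩, hmin⟩ := W.minCost_isLeast σ
  refine minL_eq_singleton ?_ fun c hc => hmin (hsound c hc)
  obtain ⟨c, hc, hle⟩ := hcomplete π hπ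
  rw [hcost] at hle
  rwa [← le_antisymm hle (hmin (hsound c hc))]

end

namespace Exp

variable {O : Val → ℕ} {κ : ℕ}

/-! ### Programs for minima, blocks and patterns -/

theorem Ev.iteTrue {c a b : Exp} {v w : Val} {n r s : ℕ} (hc : Ev O κ c v (.nat n) r) (hn : n ≠ 0)
    (ha : Ev O κ a v w s) : Ev O κ (.ite c a b) v w (r + s + 1) := by
  have h₁ := hc.2
  have h₂ := ha.2
  refine ⟨by simp [eval, hc.1, Val.num, hn, ha.1], ?_⟩
  simp only [time, hc.1, Val.num, hn, if_false]
  omega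

theorem Ev.iteFalse {c a b : Exp} {v w : Val} {r s : ℕ} (hc : Ev O κ c v (.nat 0) r)
    (hb : Ev O κ b v w s) : Ev O κ (.ite c a b) v w (r + s + 1) := by
  have h₁ := hc.2
  have h₂ := hb.2
  refine ⟨by simp [eval, hc.1, Val.num, hb.1], ?_⟩
  simp only [time, hc.1, Val.num, if_true]
  omega

/-- The minimum of the list that is the environment. -/
def minLE : Exp :=
  .fold .env (.const 0)
    (.ite (.isPair (.var 1))
      (.ite (.le (.var 0) (.fst (.var 1))) (.pair (.var 0) (.const 0)) (.var 1))
      (.pair (.var 0) (.const 0)))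

theorem ev_minLE {M : ℕ} (l : List ℕ) (hl : ∀ x ∈ l, Nat.size x ≤ M) :
    Ev O κ minLE (.ofList (l.map .nat)) (.ofList ((minL l).map .nat))
      (20 + l.length * (60 + 2 * M)) := by
  refine (Ev.foldConst (O := O) (κ := κ) Val.nat (fun l : List ℕ => Val.ofList (l.map .nat))
    (fun acc x => if acc = [] then [x] else if x ≤ acc.headD 0 then [x] else acc)
    (fun acc => ∀ x ∈ acc, Nat.size x ≤ M) (T := 30 + 2 * M)
    (Ev.env (.ofList (l.map .nat))) (b₀ := []) (Ev.const 0 _) (by simp)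
    (fun x hx acc hacc => ?_)).mono ?_
  · have hx := hl x hx
    rcases acc with _ | ⟨a, acc⟩
    · refine ⟨⟨rfl, ?_⟩, by simpa using hx⟩
      simp [time, eval, lookup, Val.fst, Val.snd, Val.ofList, Val.isPair, Val.num]
      omega
    · have ha := hacc a (by simp)
      by_cases h : x ≤ a
      · refine ⟨⟨?_, ?_⟩, by simpa [h] using hx⟩
        · simp [eval, lookup, Val.fst, Val.snd, Val.ofList, Val.isPair, Val.num, h]
        · simp [time, eval, lookup, Val.fst, Val.snd, Val.ofList, Val.isPair, Val.num, h]
          omega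
      · refine ⟨⟨?_, ?_⟩, by simpa [h] using hacc⟩
        · simp [eval, lookup, Val.fst, Val.snd, Val.ofList, Val.isPair, Val.num, h]
        · simp [time, eval, lookup, Val.fst, Val.snd, Val.ofList, Val.isPair, Val.num, h]
          omega
  · have : l.length * (18 + (30 + 2 * M)) ≤ l.length * (60 + 2 * M) :=
      Nat.mul_le_mul_left _ (by omega)
    omega

/-- The encoding of a list of numbered users. -/
def encUs {n : ℕ} (l : List (Fin n)) : Val := .ofList (l.map fun u : Fin n => .nat u)

/-- Equality of the lists `var 0` and `var 1` of numbers. -/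
def listEqE : Exp :=
  .app (.ite (.isPair (.snd .env)) (.const 0) (.fst .env))
    (.fold (.var 0) (.pair (.const 1) (.var 1))
      (.ite (.isPair (.snd (.var 1)))
        (.pair (.ite (eqE (.var 0) (.fst (.snd (.var 1)))) (.fst (.var 1)) (.const 0))
          (.snd (.snd (.var 1))))
        (.pair (.const 0) (.const 0))))

/-- One step of the comparison of two lists; the state consists of the result so far and the rest of
the second list. -/
def listEqStep {n : ℕ} (b : Bool × List (Fin n)) (x : Fin n) : Bool × List (Fin n) :=
  match b.2 with
  | [] => (false, [])
  | y :: r => (if x = y then b.1 else false, r)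

/-- The lists are equal if and only if no comparison fails and nothing remains of the second list.
-/
theorem foldl_listEqStep {n : ℕ} (xs ys : List (Fin n)) (ok : Bool) :
    (if (xs.foldl listEqStep (ok, ys)).2 = [] then (xs.foldl listEqStep (ok, ys)).1 else false) =
      (ok && decide (xs = ys)) := by
  induction xs generalizing ok ys with
  | nil => cases ys <;> simp
  | cons x xs ih =>
    rw [List.foldl_cons]
    rcases ys with _ | ⟨y, ys⟩
    · exact (ih [] false).trans (by simp)
    · refine (ih ys (if x = y then ok else false)).trans ?_
      by_cases h : x = y <;> simp [h]

theorem ev_listEqE {n N : ℕ} (hN : 1000 ≤ N) (hn : n ≤ N) (xs ys : List (Fin n))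
    (hxs : xs.length ≤ N) (ρ : Val) :
    Ev O κ listEqE (.pair (encUs xs) (.pair (encUs ys) ρ)) (.nat (if xs = ys then 1 else 0))
      (N ^ 3) := by
  set v := Val.pair (encUs xs) (.pair (encUs ys) ρ) with hv
  have e₁ := Ev.foldConst (O := O) (κ := κ) (fun u : Fin n => Val.nat u)
    (fun b : Bool × List (Fin n) => Val.pair (.nat b.1.toNat) (encUs b.2)) listEqStep
    (fun _ => True) (T := 100 + 4 * N) (xs := xs) (b₀ := (true, ys))
    (Ev.var 0 v) (i := .pair (.const 1) (.var 1)) (t := 5) ⟨rfl, le_rfl⟩ trivial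
    (b := .ite (.isPair (.snd (.var 1)))
        (.pair (.ite (eqE (.var 0) (.fst (.snd (.var 1)))) (.fst (.var 1)) (.const 0))
          (.snd (.snd (.var 1))))
        (.pair (.const 0) (.const 0)))
    (fun x _ b _ => ⟨by
      obtain ⟨ok, rest⟩ := b
      rcases rest with _ | ⟨y, r⟩
      · refine ⟨rfl, ?_⟩
        simp [time, eval, lookup, Val.fst, Val.snd, encUs, Val.ofList, Val.isPair, Val.num]
        omega
      · have hx : Nat.size x ≤ N := size_le_of_le (x.isLt.le.trans hn)
        have hy : Nat.size y ≤ N := size_le_of_le (y.isLt.le.trans hn)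
        set w := Val.pair (.nat x) (.pair (.pair (.nat ok.toNat) (encUs (y :: r))) v) with hw
        have h₁ : Ev O κ (.fst (.snd (.var 1))) w (.nat y) 7 := ⟨rfl, le_rfl⟩
        have h₂ := Ev.ite (p := x = y) ((Ev.var 0 w).eq (x := x) h₁)
          (by split_ifs with h <;> simp_all [Fin.ext_iff])
          (a := .fst (.var 1)) (w := .nat ok.toNat) (s := 5)
          (fun _ => ⟨rfl, le_rfl⟩) (fun _ => Ev.const 0 w)
        have h₃ := h₂.pair (b := .snd (.snd (.var 1))) (x := encUs r) (t := 7) ⟨rfl, le_rfl⟩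
        have h₄ : Ev O κ (.isPair (.snd (.var 1))) w (.nat 1) 7 := ⟨rfl, le_rfl⟩
        have h₅ := Ev.ite (p := True) h₄ (by simp) (fun _ => h₃) (b := .pair (.const 0) (.const 0))
          (x := .pair (.nat 0) (.nat 0)) (t := 3) (fun h => absurd trivial h)
        rw [if_pos trivial] at h₅
        refine ⟨h₅.1.trans ?_, h₅.2.trans ?_⟩
        · by_cases h : x = y <;> simp [listEqStep, h]
        · simp only [max_eq_left (show 1 ≤ 5 by omega)]
          have : ∀ a : ℕ, 3 ≤ a → max a 3 = a := fun a h => max_eq_left h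
          rw [this _ (by omega)]
          omega, trivial⟩)
  have e₂ := e₁.app (f := .ite (.isPair (.snd .env)) (.const 0) (.fst .env)) (t := 10)
    (x := .nat (if xs = ys then 1 else 0)) (by
      have h := foldl_listEqStep xs ys true
      rcases hb : xs.foldl listEqStep (true, ys) with ⟨ok, rest⟩
      rw [hb] at h
      rcases rest with _ | ⟨y, r⟩
      · simp only [if_true, Bool.true_and] at h
        subst h
        constructor
        · by_cases h : xs = ys <;>
          simp [eval, encUs, Val.ofList, Val.isPair, Val.num, Val.fst, Val.snd, h]
        · simp [time, eval, encUs, Val.ofList, Val.isPair, Val.num, Val.snd]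
      · have h' : xs ≠ ys := by simpa using h
        constructor
        · simp [eval, encUs, Val.ofList, Val.isPair, Val.num, Val.snd, h']
        · simp [time, eval, encUs, Val.ofList, Val.isPair, Val.num, Val.snd])
  refine e₂.mono ?_
  have := Nat.mul_le_mul_right (18 + (100 + 4 * N)) hxs
  nlinarith [Nat.mul_le_mul hN hN, Nat.mul_le_mul (Nat.mul_le_mul hN hN) (le_refl N)]

/-- The list `var 1` of numbers without the number `var 0`. -/
def filterNeE : Exp :=
  bindE (.var 1) (.ite (eqE (.var 0) (.var 1)) (.const 0) (.pair (.var 0) (.const 0)))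

theorem filter_eq_flatMap {α : Type*} (p : α → Prop) [DecidablePred p] (l : List α) :
    l.filter (fun x => decide (p x)) = l.flatMap fun x => if p x then [x] else [] := by
  induction l with
  | nil => rfl
  | cons x l ih => by_cases h : p x <;> simp [h, ih]

theorem ev_filterNeE {n N : ℕ} (hN : 1000 ≤ N) (hn : n ≤ N) (l : Fin n) (A : List (Fin n))
    (hA : A.length ≤ N) (ρ : Val) :
    Ev O κ filterNeE (.pair (.nat l) (.pair (encUs A) ρ)) (encUs (A.filter (· ≠ l))) (N ^ 3) := by
  set v := Val.pair (.nat l) (.pair (encUs A) ρ)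
  have e := Ev.bindConst (O := O) (κ := κ) (fun u : Fin n => Val.nat u) (fun u : Fin n => Val.nat u)
    (fun x => if x ≠ l then [x] else []) (T := 40 + 4 * N) (xs := A) (Ev.var 1 v)
    (b := .ite (eqE (.var 0) (.var 1)) (.const 0) (.pair (.var 0) (.const 0)))
    (fun x _ => by
      have hx : Nat.size x ≤ N := size_le_of_le (x.isLt.le.trans hn)
      have hl : Nat.size l ≤ N := size_le_of_le (l.isLt.le.trans hn)
      set w := Val.pair (.nat x) v
      have h := Ev.ite (O := O) (κ := κ) (p := x = l)
        ((Ev.var 0 w).eq (x := x) (Ev.var 1 w) (y := l))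
        (by split_ifs with h <;> simp_all [Fin.ext_iff]) (fun _ => Ev.const 0 w)
        (fun _ => (Ev.var 0 w).pair (Ev.const 0 w))
      refine ⟨h.1.trans ?_, h.2.trans ?_⟩
      · by_cases h : x = l <;> simp [h, Val.ofList, lookup, w, Val.fst]
      · simp only [max_eq_right (show 1 ≤ 2 * 0 + 1 + 1 + 1 by omega)]
        omega)
  rw [← filter_eq_flatMap] at e
  refine Ev.mono e ?_
  have h₁ := List.length_filter_le (fun x => decide (x ≠ l)) A
  have := Nat.mul_le_mul_right (40 + 4 * N + 60) hA
  nlinarith [Nat.mul_le_mul hN hN, Nat.mul_le_mul (Nat.mul_le_mul hN hN) (le_refl N)]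

/-- The encoding of an assignment (step, user). -/
def encA {k n : ℕ} (a : Fin k × Fin n) : Val := .pair (.nat a.1) (.nat a.2)

/-- The steps that are assigned to the user `var 0` in the list `var 1` of assignments. -/
def blockE : Exp :=
  bindE (.var 1) (.ite (eqE (.snd (.var 0)) (.var 1)) (.pair (.fst (.var 0)) (.const 0)) (.const 0))

theorem length_block_le {S U : Type*} [DecidableEq S] [DecidableEq U] (asg : List (S × U)) (l : U) :
    (block asg l).length ≤ asg.length := by
  unfold block
  induction asg with
  | nil => simp
  | cons a asg ih =>
    rw [List.flatMap_cons, List.length_append, List.length_cons]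
    split_ifs <;> simp only [List.length_singleton, List.length_nil] <;> omega

theorem ev_blockE {k n N : ℕ} (hN : 1000 ≤ N) (hn : n ≤ N) (l : Fin n) (asg : List (Fin k × Fin n))
    (hA : asg.length ≤ N) (ρ : Val) :
    Ev O κ blockE (.pair (.nat l) (.pair (.ofList (asg.map encA)) ρ))
      (.ofList ((block asg l).map fun s : Fin k => .nat s)) (N ^ 3) := by
  set v := Val.pair (.nat l) (.pair (.ofList (asg.map encA)) ρ)
  have e := Ev.bindConst (O := O) (κ := κ) encA (fun s : Fin k => Val.nat s)
    (fun a : Fin k × Fin n => if a.2 = l then [a.1] else []) (T := 50 + 4 * N) (xs := asg)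
    (Ev.var 1 v)
    (b := .ite (eqE (.snd (.var 0)) (.var 1)) (.pair (.fst (.var 0)) (.const 0)) (.const 0))
    (fun a _ => by
      have hx : Nat.size a.2 ≤ N := size_le_of_le (a.2.isLt.le.trans hn)
      have hl : Nat.size l ≤ N := size_le_of_le (l.isLt.le.trans hn)
      set w := Val.pair (encA a) v
      have h₁ : Ev O κ (.snd (.var 0)) w (.nat a.2) 3 := ⟨rfl, le_rfl⟩
      have h := Ev.ite (O := O) (κ := κ) (p := a.2 = l) (h₁.eq (Ev.var 1 w) (y := l))
        (by split_ifs with h <;> simp_all [Fin.ext_iff])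
        (a := .pair (.fst (.var 0)) (.const 0)) (w := .pair (.nat a.1) (.nat 0)) (s := 5)
        (fun _ => ⟨rfl, le_rfl⟩) (fun _ => Ev.const 0 w)
      refine ⟨h.1.trans ?_, h.2.trans ?_⟩
      · by_cases h : a.2 = l <;> simp [h, Val.ofList]
      · simp only [max_eq_left (show 1 ≤ 5 by omega)]
        omega)
  refine Ev.mono e ?_
  have h₁ := length_block_le asg l
  unfold block at h₁
  have := Nat.mul_le_mul_right (50 + 4 * N + 60) hA
  nlinarith [Nat.mul_le_mul hN hN, Nat.mul_le_mul (Nat.mul_le_mul hN hN) (le_refl N)]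

/-- All sublists of the reverse of the list `var 0`. -/
def subsE : Exp :=
  .fold (.var 0) (.pair (.const 0) (.const 0))
    (bindE (.var 1) (.pair (.var 0) (.pair (.pair (.var 1) (.var 0)) (.const 0))))

theorem subs_append {U : Type*} (l : List U) (x : U) :
    subs (l ++ [x]) = (subs l).flatMap fun A => [A, x :: A] := by
  simp [subs, List.foldl_append]

theorem ev_subsE {n N : ℕ} (hN : 1000 ≤ N) (l : List (Fin n)) (hl : l.length ≤ N) (ρ : Val) :
    Ev O κ subsE (.pair (encUs l) ρ) (.ofList ((subs l).map encUs)) (2 ^ l.length * N ^ 3) := by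
  refine (Ev.foldRem (O := O) (κ := κ) (fun u : Fin n => Val.nat u)
    (fun L : List (List (Fin n)) => Val.ofList (L.map encUs))
    (fun acc x => acc.flatMap fun A => [A, x :: A])
    (fun rest acc => ∃ pre, pre ++ rest = l ∧ acc = subs pre) (T := 2 ^ l.length * 300) (b₀ := [[]])
    (Ev.var 0 (.pair (encUs l) ρ)) (i := .pair (.const 0) (.const 0)) (t := 3) ⟨rfl, le_rfl⟩
    ⟨[], rfl, rfl⟩ ?_).mono ?_
  · rintro x _ rest _ ⟨pre, hpre, rfl⟩
    refine ⟨?_, pre ++ [x], by simp [hpre], (subs_append pre x).symm⟩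
    refine (Ev.bindConst (O := O) (κ := κ) encUs encUs (fun A => [A, x :: A]) (T := 20)
      (Ev.var 1 (.pair (.nat x) (.pair (.ofList ((subs pre).map encUs)) (.pair (encUs l) ρ))))
      (fun A _ => ⟨rfl, by simp [time]⟩)).mono ?_
    rw [← subs_append, length_subs, length_subs, List.length_append, List.length_singleton]
    have h₁ : 2 ^ (pre.length + 1) ≤ 2 ^ l.length :=
      Nat.pow_le_pow_right (by omega) (by rw [← hpre]; simp)
    have h₂ : 1 ≤ 2 ^ pre.length := Nat.one_le_two_pow
    rw [pow_succ] at h₁ ⊢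
    omega
  · have h₁ := Nat.mul_le_mul_right (18 + 2 ^ l.length * 300) hl
    have h₂ : 1 ≤ 2 ^ l.length := Nat.one_le_two_pow
    have h₃ : N * (18 + 2 ^ l.length * 300) + 20 ≤ 2 ^ l.length * (N * 338) := by nlinarith
    have h₄ : N * 338 ≤ N ^ 3 := by nlinarith [Nat.mul_le_mul hN hN]
    have h₅ := Nat.mul_le_mul_left (2 ^ l.length) h₄
    omega

/-- The encoding of a pattern. -/
def encPat {k n : ℕ} (p : Pat (Fin k) (Fin n)) : Val :=
  .pair (encUs p.1) (.pair (encUs p.2.1) (.ofList (p.2.2.map encA)))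

/-- The extensions of the pattern `var 0` to the vertex `var 1`, a step. -/
def extendE : Exp :=
  .fold (.fst (.snd (.var 0)))
    (.ite (.isPair (.fst (.var 0)))
      (.pair (.pair (.snd (.fst (.var 0)))
        (.pair (.pair (.fst (.fst (.var 0))) (.fst (.snd (.var 0))))
          (.pair (.pair (.snd (.var 1)) (.fst (.fst (.var 0)))) (.snd (.snd (.var 0))))))
        (.const 0))
      (.const 0))
    (.pair (.pair (.fst (.var 2)) (.pair (.fst (.snd (.var 2)))
      (.pair (.pair (.snd (.var 3)) (.var 0)) (.snd (.snd (.var 2)))))) (.var 1))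

theorem ev_extendE {k n : ℕ} (p : Pat (Fin k) (Fin n)) (s : Fin k) (ρ : Val) :
    Ev O κ extendE (.pair (encPat p) (.pair (.pair (.nat 0) (.nat s)) ρ))
      (.ofList ((extendPat s p).map encPat)) (120 + p.2.1.length * 80) := by
  obtain ⟨rem, used, asg⟩ := p
  set v := Val.pair (encPat (rem, used, asg)) (.pair (.pair (.nat 0) (.nat s)) ρ) with hv
  refine (Ev.foldConst (O := O) (κ := κ) (fun u : Fin n => Val.nat u)
    (fun L : List (Pat (Fin k) (Fin n)) => Val.ofList (L.map encPat))
    (fun acc u => (rem, used, (s, u) :: asg) :: acc) (fun _ => True) (T := 60) (xs := used)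
    (b₀ := if rem = [] then [] else rem.head?.toList.map fun u =>
      (rem.tail, u :: used, (s, u) :: asg))
    (l := .fst (.snd (.var 0))) (v := v) (s := 5) (t := 80) ⟨rfl, le_rfl⟩ ?_ trivial
    (fun u _ acc _ => ⟨⟨rfl, by simp [time]⟩, trivial⟩)).mono (by
      show _ ≤ 120 + used.length * 80
      omega)
  rcases rem with _ | ⟨u, rem⟩
  · exact ⟨rfl, by simp [time, eval, lookup, hv, encPat, Val.fst, encUs, Val.ofList, Val.isPair,
      Val.num]⟩
  · constructor
    · simp [eval, lookup, hv, encPat, Val.fst, Val.snd, encUs, Val.ofList, Val.isPair, Val.num,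
        encA]
    · simp [time, eval, lookup, hv, encPat, Val.fst, encUs, Val.ofList, Val.isPair, Val.num]

/-- The patterns of the sequence `var 0` with the list `var 1` of users. -/
def patsE : Exp :=
  .fold (.var 0) (.pair (.pair (.var 1) (.pair (.const 0) (.const 0))) (.const 0))
    (.ite (.fst (.var 0)) (.var 1) (bindE (.var 1) extendE))

theorem length_le_sum_four_pow {S U : Type*} (L : List (Pat S U)) :
    L.length ≤ (L.map fun q => 4 ^ q.2.1.length).sum := by
  induction L with
  | nil => simp
  | cons q L ih =>
    have : 1 ≤ 4 ^ q.2.1.length := Nat.one_le_pow _ _ (by omega)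
    simp only [List.length_cons, List.map_cons, List.sum_cons]
    omega

/-- The time is proportional to the number of patterns, which is bounded by the weighted count of
`sum_four_pow_pats`. -/
theorem ev_patsE {k m n N : ℕ} (hN : 1000 ≤ N) (us : List (Fin n)) (σ : List (Fin k ⊕ Fin m))
    (hσ : σ.length ≤ N) (ρ : Val) :
    Ev O κ patsE (.pair (encSeq σ) (.pair (encUs us) ρ)) (.ofList ((pats us σ).map encPat))
      (Nat.factorial ((σ.filterMap Sum.getLeft?).length + 3) * N ^ 4) := by
  set Y := Nat.factorial ((σ.filterMap Sum.getLeft?).length + 3) with hY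
  set v := Val.pair (encSeq σ) (.pair (encUs us) ρ) with hv
  have hY1 : 1 ≤ Y := Nat.factorial_pos _
  have hlen : ∀ pre rest, pre ++ rest = σ → (pats us pre).length ≤ Y := by
    intro pre rest h
    refine (length_le_sum_four_pow _).trans ((sum_four_pow_pats us pre).2.trans ?_)
    refine Nat.factorial_le (Nat.add_le_add_right ?_ 3)
    rw [← h, List.filterMap_append, List.length_append]
    omega
  refine (Ev.foldRem (O := O) (κ := κ) encV
    (fun L : List (Pat (Fin k) (Fin n)) => Val.ofList (L.map encPat))
    (fun ps v => v.elim (fun s => ps.flatMap (extendPat s)) fun _ => ps)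
    (fun rest acc => ∃ pre, pre ++ rest = σ ∧ acc = pats us pre) (T := Y * (300 + N * 80))
    (b₀ := [(us, [], [])]) (Ev.var 0 v)
    (i := .pair (.pair (.var 1) (.pair (.const 0) (.const 0))) (.const 0)) (t := 10)
    ⟨rfl, by simp [time]⟩ ⟨[], rfl, rfl⟩ ?_).mono ?_
  · rintro x _ rest _ ⟨pre, hpre, rfl⟩
    have h0 := hlen pre _ hpre
    have h0' := Nat.mul_le_mul hY1 (show 290 ≤ 300 + N * 80 by omega)
    set w := Val.pair (encV x) (.pair (.ofList ((pats us pre).map encPat)) v) with hw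
    rcases x with s | r
    · have hpre' : (pre ++ [Sum.inl s]) ++ rest = σ := by simp [hpre]
      refine ⟨?_, pre ++ [Sum.inl s], hpre', (pats_append_inl us pre s).symm⟩
      have e₁ := Ev.bindConst (O := O) (κ := κ) encPat encPat (extendPat s) (T := 120 + N * 80)
        (Ev.var 1 w) (b := extendE) (fun p hp => (ev_extendE p s _).mono (by
          have h₁ := (sum_four_pow_pats us pre).1 p hp
          have h₂ := List.length_filterMap_le (Sum.getLeft? : Fin k ⊕ Fin m → _) pre
          have h₃ : pre.length ≤ σ.length := by rw [← hpre]; simp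
          omega))
      have h₁ := hlen _ _ hpre'
      rw [pats_append_inl] at h₁
      refine (Ev.iteFalse (r := 3) ⟨rfl, le_rfl⟩ e₁).mono ?_
      have h₃ := Nat.mul_le_mul_right (120 + N * 80 + 60) h0
      nlinarith
    · refine ⟨?_, pre ++ [Sum.inr r], by simp [hpre], (pats_append_inr us pre r).symm⟩
      refine (Ev.iteTrue (n := 1) (r := 3) ⟨rfl, le_rfl⟩ one_ne_zero (Ev.var 1 w)).mono ?_
      omega
  · have h₁ := Nat.mul_le_mul_right (18 + Y * (300 + N * 80)) hσ
    have h₂ : N * (18 + Y * (300 + N * 80)) + 40 ≤ Y * (N * (360 + N * 80)) := by nlinarith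
    have h₃ : N * (360 + N * 80) ≤ N ^ 4 := by
      nlinarith [Nat.mul_le_mul hN hN, Nat.mul_le_mul (Nat.mul_le_mul hN hN) (Nat.mul_le_mul hN hN)]
    have h₄ := Nat.mul_le_mul_left Y h₃
    omega

end Exp

/-! ### The program for the dynamic program -/

section

variable {U : Type*} [DecidableEq U]

theorem size_le_of_mem_injCosts {U : Type*} {w : U → U → ℕ} {us A : List U} {κ N c : ℕ}
    (hw : ∀ l u, Nat.size (w l u) ≤ κ) (hA : A.length ≤ N) (hc : c ∈ injCosts w us A) :
    Nat.size c ≤ N + κ := by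
  obtain ⟨ρ, _, _, rfl⟩ := hc
  rw [Nat.size_le]
  have h₁ : (A.map fun l => w l (ρ l)).sum ≤ A.length * 2 ^ κ :=
    Exp.sum_map_le_length_mul fun l _ => (Nat.size_le.mp (hw l (ρ l))).le
  calc _ ≤ A.length * 2 ^ κ := h₁
    _ ≤ N * 2 ^ κ := Nat.mul_le_mul_right _ hA
    _ < 2 ^ N * 2 ^ κ := Nat.mul_lt_mul_of_pos_right N.lt_two_pow_self (by positivity)
    _ = _ := (pow_add 2 N κ).symm

theorem length_le_of_mem_subs {U : Type*} {l A : List U} (hA : A ∈ subs l) :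
    A.length ≤ l.length := by
  simpa using (mem_subs.mp hA).length_le

theorem table_append (w : U → U → ℕ) (used us : List U) (u : U) :
    table w used (us ++ [u]) = tableStep w (subs used) (table w used us) u := by
  simp [table, List.foldl_append]

/-- The table has at most one entry for every sublist of the used users. -/
theorem length_table_le (w : U → U → ℕ) (used us : List U) :
    (table w used us).length ≤ 2 ^ used.length := by
  induction us using List.reverseRecOn with
  | nil => exact Nat.one_le_two_pow
  | append_singleton us u _ =>
    rw [table_append, ← length_subs]
    unfold tableStep
    generalize subs used = Ss
    induction Ss with
    | nil => simp
    | cons A Ss ih =>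
      rw [List.flatMap_cons, List.length_append, List.length_map, List.length_cons]
      have := length_minL_le (cands w u (table w used us) A)
      omega

theorem fst_mem_subs_of_mem_table {w : U → U → ℕ} {used us : List U} {e : List U × ℕ}
    (he : e ∈ table w used us) : e.1 ∈ subs used := by
  induction us using List.reverseRecOn with
  | nil =>
    have he : e = ([], 0) := by simpa [table] using he
    rw [he, mem_subs]
    exact List.nil_sublist _
  | append_singleton us u _ =>
    rw [table_append] at he
    unfold tableStep at he
    simp only [List.mem_flatMap, List.mem_map] at he
    obtain ⟨A, hA, c, _, rfl⟩ := he
    exact hA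

theorem size_le_of_mem_table {w : U → U → ℕ} {used us : List U} (hused : used.Nodup)
    (hus : us.Nodup) {κ N : ℕ} (hw : ∀ l u, Nat.size (w l u) ≤ κ) (hN : used.length ≤ N)
    {e : List U × ℕ} (he : e ∈ table w used us) : Nat.size e.2 ≤ N + κ :=
  size_le_of_mem_injCosts hw ((length_le_of_mem_subs (fst_mem_subs_of_mem_table he)).trans hN)
    ((isTable_table w hused hus).sound e he)

theorem length_foldl_ite_le {T : List (List U × ℕ)} (B : List U) (c : ℕ) (acc : List ℕ) :
    (T.foldl (fun acc e => if e.1 = B then (e.2 + c) :: acc else acc) acc).length ≤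
      acc.length + T.length := by
  induction T generalizing acc with
  | nil => simp
  | cons e T ih =>
    rw [List.foldl_cons, List.length_cons]
    refine (ih _).trans ?_
    split_ifs
    · rw [List.length_cons]
      omega
    · omega

theorem length_flatMap_ite_singleton_le {α β : Type*} (p : α → Prop) [DecidablePred p] (f : α → β)
    (T : List α) : (T.flatMap fun e => if p e then [f e] else []).length ≤ T.length := by
  induction T with
  | nil => simp
  | cons e T ih =>
    rw [List.flatMap_cons, List.length_append, List.length_cons]
    split_ifs <;> simp only [List.length_singleton, List.length_nil] <;> omega

theorem length_cands_le (w : U → U → ℕ) (u : U) (T : List (List U × ℕ)) (A : List U) :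
    (cands w u T A).length ≤ (A.length + 1) * T.length := by
  have h : ∀ (L : List U) (acc : List ℕ), (L.foldl (fun acc l => T.foldl (fun acc e =>
      if e.1 = A.filter (· ≠ l) then (e.2 + w l u) :: acc else acc) acc) acc).length ≤
      acc.length + L.length * T.length := by
    intro L
    induction L with
    | nil => simp
    | cons l L ih =>
      intro acc
      rw [List.foldl_cons, List.length_cons, add_mul]
      have h₁ := length_foldl_ite_le (T := T) (A.filter (· ≠ l)) (w l u) acc
      have h₂ := ih (T.foldl (fun acc e =>
        if e.1 = A.filter (· ≠ l) then (e.2 + w l u) :: acc else acc) acc)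
      omega
  have h₁ := length_flatMap_ite_singleton_le (fun e : List U × ℕ => e.1 = A) Prod.snd T
  have h₂ := h A (T.flatMap fun e => if e.1 = A then [e.2] else [])
  unfold cands
  rw [add_mul]
  omega

end

namespace Exp

variable {O : Val → ℕ} {κ : ℕ}

/-- Equality of two lists of numbers. -/
def eqListsE (a b : Exp) : Exp := .app listEqE (.pair a (.pair b (.const 0)))

theorem Ev.eqLists {n N : ℕ} (hN : 1000 ≤ N) (hn : n ≤ N) {a b : Exp} {v : Val} {s t : ℕ}
    {xs ys : List (Fin n)} (hxs : xs.length ≤ N) (ha : Ev O κ a v (encUs xs) s)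
    (hb : Ev O κ b v (encUs ys) t) :
    Ev O κ (eqListsE a b) v (.nat (if xs = ys then 1 else 0)) (s + t + 4 + N ^ 3) :=
  ((ha.pair (hb.pair (Ev.const 0 v))).app (ev_listEqE hN hn xs ys hxs (.nat 0))).mono (by omega)

/-- The encoding of an entry of the table of the dynamic program. -/
def encE {n : ℕ} (e : List (Fin n) × ℕ) : Val := .pair (encUs e.1) (.nat e.2)

/-- The list `var 2` together with the numbers of the entries of the table `var 3` for the set
`var 0`, increased by `var 1`. -/
def addEntriesE : Exp :=
  .fold (.var 3) (.var 2)
    (.ite (eqListsE (.var 2) (.fst (.var 0))) (.pair (.add (.snd (.var 0)) (.var 3)) (.var 1))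
      (.var 1))

theorem ev_addEntriesE {n N : ℕ} (hN : 1000 ≤ N) (hn : n ≤ N) (B : List (Fin n))
    (hB : B.length ≤ N) (c : ℕ) (hc : Nat.size c ≤ N) (acc : List ℕ) (T : List (List (Fin n) × ℕ))
    (hT : ∀ e ∈ T, Nat.size e.2 ≤ 2 * N) (ρ : Val) :
    Ev O κ addEntriesE
      (.pair (encUs B) (.pair (.nat c) (.pair (.ofList (acc.map .nat))
        (.pair (.ofList (T.map encE)) ρ))))
      (.ofList ((T.foldl (fun acc e => if e.1 = B then (e.2 + c) :: acc else acc) acc).map .nat))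
      (30 + T.length * (2 * N ^ 3)) := by
  set v := Val.pair (encUs B) (.pair (.nat c) (.pair (.ofList (acc.map .nat))
        (.pair (.ofList (T.map encE)) ρ)))
  refine (Ev.foldConst (O := O) (κ := κ) encE (fun l : List ℕ => Val.ofList (l.map .nat))
    (fun acc e => if e.1 = B then (e.2 + c) :: acc else acc) (fun _ => True)
    (T := N ^ 3 + 3 * N + 60)
    (Ev.var 3 v) (Ev.var 2 v) trivial (fun e he acc _ => ⟨?_, trivial⟩)).mono ?_
  · have he := hT e he
    set w := Val.pair (encE e) (.pair (.ofList (acc.map .nat)) v) with hw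
    have h₁ : Ev O κ (.fst (.var 0)) w (encUs e.1) 3 := ⟨rfl, le_rfl⟩
    have h₂ : Ev O κ (.snd (.var 0)) w (.nat e.2) 3 := ⟨rfl, le_rfl⟩
    have h := Ev.ite (p := e.1 = B) ((Ev.var 2 w).eqLists hN hn hB h₁)
      (ite_one_zero_ne_zero_iff.trans eq_comm)
      (fun _ => (h₂.add (Ev.var 3 w) (y := c)).pair (Ev.var 1 w))
      (fun _ => Ev.var 1 w)
    refine ⟨h.1.trans ?_, h.2.trans ?_⟩
    · by_cases h : e.1 = B
      · simp [h, Val.ofList, w, lookup, Val.fst, Val.snd]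
      · simp [h, w, lookup, Val.fst, Val.snd]
    · have : ∀ a : ℕ, 2 * 1 + 1 ≤ a → max a (2 * 1 + 1) = a := fun a h => max_eq_left h
      rw [this _ (by omega)]
      omega
  · have h₁ : 3 * N + 78 ≤ N ^ 3 := by nlinarith [Nat.mul_le_mul hN hN]
    have h₂ := Nat.mul_le_mul_left T.length (show 18 + (N ^ 3 + 3 * N + 60) ≤ 2 * N ^ 3 by omega)
    omega

theorem size_ofList_le {l : List Val} {M : ℕ} (h : ∀ v ∈ l, v.size ≤ M) :
    (Val.ofList l).size ≤ 1 + l.length * (M + 1) := by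
  induction l with
  | nil => simp [Val.ofList, Val.size]
  | cons v l ih =>
    have h₁ := h v (by simp)
    have h₂ := ih fun v hv => h v (by simp [hv])
    simp only [Val.ofList, Val.size, List.length_cons, add_mul]
    omega

/-- The list `var 5` of assignments yields the candidates for the set `var 0` and the user `var 1`
from the table `var 2`. -/
def candsE : Exp :=
  .fold (.var 0)
    (bindE (.var 2)
      (.ite (eqListsE (.var 1) (.fst (.var 0))) (.pair (.snd (.var 0)) (.const 0)) (.const 0)))
    (.app addEntriesE
      (.pair (.app filterNeE (.pair (.var 0) (.pair (.var 2) (.const 0))))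
        (.pair (.call (.pair (.const 1)
            (.pair (.app blockE (.pair (.var 0) (.pair (.var 7) (.const 0)))) (.var 3))))
          (.pair (.var 1) (.pair (.var 4) (.const 0))))))

/-- The weights `aw` are obtained from the subroutine `O`, called with the tag `1`. -/
theorem ev_candsE {k n N : ℕ} (hN : 1000 ≤ N) (hk : k ≤ N) (hn : n ≤ N) (hκ : κ ≤ N)
    {aw : List (Fin k) → Fin n → ℕ} (haw : ∀ B u, Nat.size (aw B u) ≤ κ)
    (hO : ∀ (B : List (Fin k)) (u : Fin n),
      O (.pair (.nat 1) (.pair (.ofList (B.map fun s : Fin k => .nat s)) (.nat u))) = aw B u)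
    (A : List (Fin n)) (hA : A.length ≤ N) (u : Fin n) (T : List (List (Fin n) × ℕ))
    (hT : ∀ e ∈ T, Nat.size e.2 ≤ 2 * N) {Z : ℕ} (hZ : 1 ≤ Z) (hTZ : T.length ≤ Z)
    (asg : List (Fin k × Fin n)) (hasg : asg.length ≤ N) (x y ρ : Val) :
    Ev O κ candsE (.pair (encUs A) (.pair (.nat u) (.pair (.ofList (T.map encE)) (.pair x (.pair y
        (.pair (.ofList (asg.map encA)) ρ))))))
      (.ofList ((cands (fun l u => aw (block asg l) u) u T A).map .nat)) (Z * N ^ 5) := by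
  set v := Val.pair (encUs A) (.pair (.nat u) (.pair (.ofList (T.map encE)) (.pair x (.pair y
        (.pair (.ofList (asg.map encA)) ρ))))) with hv
  have hN3 : 1000 * 1000 * N ≤ N ^ 3 := by
    have := Nat.mul_le_mul_right N (Nat.mul_le_mul hN hN)
    rwa [show N ^ 3 = N * N * N by ring]
  -- the entries of the table for the set `A` itself
  have e₁ := Ev.bindConst (O := O) (κ := κ) encE Val.nat
    (fun e : List (Fin n) × ℕ => if e.1 = A then [e.2] else []) (T := N ^ 3 + 30) (Ev.var 2 v)
    (b := .ite (eqListsE (.var 1) (.fst (.var 0))) (.pair (.snd (.var 0)) (.const 0)) (.const 0))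
    (fun e he => by
      set w := Val.pair (encE e) v
      have h₁ : Ev O κ (.fst (.var 0)) w (encUs e.1) 3 := ⟨rfl, le_rfl⟩
      have h := Ev.ite (p := e.1 = A) ((Ev.var 1 w).eqLists hN hn hA h₁)
        (ite_one_zero_ne_zero_iff.trans eq_comm)
        (a := .pair (.snd (.var 0)) (.const 0)) (w := .pair (.nat e.2) (.nat 0)) (s := 5)
        (fun _ => ⟨rfl, le_rfl⟩) (fun _ => Ev.const 0 w)
      refine ⟨h.1.trans ?_, h.2.trans ?_⟩
      · by_cases h : e.1 = A <;> simp [h, Val.ofList]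
      · simp only [max_eq_left (show 1 ≤ 5 by omega)]
        omega)
  have h₁ := length_flatMap_ite_singleton_le (fun e : List (Fin n) × ℕ => e.1 = A) Prod.snd T
  refine (Ev.foldConst (O := O) (κ := κ) (fun u : Fin n => Val.nat u)
    (fun l : List ℕ => Val.ofList (l.map .nat))
    (fun acc l => T.foldl (fun acc e =>
      if e.1 = A.filter (· ≠ l) then (e.2 + aw (block asg l) u) :: acc else acc) acc)
    (fun _ => True) (T := 4 * N ^ 3 + Z * (2 * N ^ 3)) (Ev.var 0 v) e₁ trivial
    (fun l _ acc _ => ⟨?_, trivial⟩)).mono ?_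
  · set w := Val.pair (.nat l) (.pair (.ofList (acc.map .nat)) v) with hw
    have f₁ := ((Ev.var 0 w).pair ((Ev.var 2 w).pair (Ev.const 0 w))).app
      (ev_filterNeE (O := O) (κ := κ) hN hn l A hA (.nat 0))
    have f₂ := ((Ev.const 1 w).pair ((((Ev.var 0 w).pair ((Ev.var 7 w).pair (Ev.const 0 w))).app
      (ev_blockE (O := O) (κ := κ) hN hn l asg hasg (.nat 0))).pair (Ev.var 3 w))).call
    have f₃ : lookup 3 w = .nat u := rfl
    rw [f₃, hO] at f₂
    have f₄ := (f₁.pair (f₂.pair ((Ev.var 1 w).pair ((Ev.var 4 w).pair (Ev.const 0 w))))).app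
      (ev_addEntriesE hN hn (A.filter (· ≠ l)) ((List.length_filter_le _ A).trans hA)
        (aw (block asg l) u) ((haw _ _).trans hκ) acc T hT (.nat 0))
    refine f₄.mono ?_
    have hb : (Val.ofList ((block asg l).map fun s : Fin k => Val.nat s)).size ≤
        N ^ 2 + 2 * N + 1 := by
      refine (size_ofList_le (M := N + 1) fun v hv => ?_).trans ?_
      · obtain ⟨s, _, rfl⟩ := List.mem_map.mp hv
        have : Nat.size s ≤ N := size_le_of_le (s.isLt.le.trans hk)
        simp only [Val.size]
        omega
      · rw [List.length_map]
        have := Nat.mul_le_mul_right (N + 1 + 1) ((length_block_le asg l).trans hasg)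
        nlinarith
    have hu : Nat.size u ≤ N := size_le_of_le (u.isLt.le.trans hn)
    have h2 := Nat.mul_le_mul_right (2 * N ^ 3) hTZ
    have h4 : Z * (2 * N ^ 3) = 2 * (Z * N ^ 3) := by ring
    have h3 : N ^ 2 * 1000 ≤ N ^ 3 := by
      rw [pow_succ N 2]
      exact Nat.mul_le_mul_left _ hN
    simp only [Val.size, Nat.size_one]
    omega
  · have e₂ := Nat.mul_le_mul_right (18 + (4 * N ^ 3 + Z * (2 * N ^ 3))) hA
    have e₃ := Nat.mul_le_mul_right (N ^ 3 + 30 + 60) hTZ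
    have e₄ : N ^ 3 ≤ Z * N ^ 3 := Nat.le_mul_of_pos_left _ hZ
    have e₀ : Z * (2 * N ^ 3) = 2 * (Z * N ^ 3) := by ring
    have e₅ : N * (18 + (4 * N ^ 3 + Z * (2 * N ^ 3))) ≤ N * (Z * N ^ 3 * 7) :=
      Nat.mul_le_mul_left _ (by omega)
    have e₆ : Z * (N ^ 3 + 30 + 60) ≤ Z * N ^ 3 * 2 := by
      rw [mul_assoc]
      exact Nat.mul_le_mul_left _ (by omega)
    have e₇ : N * (Z * N ^ 3 * 7) = Z * N ^ 4 * 7 := by ring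
    have e₈ : Z * N ^ 4 * 1000 ≤ Z * N ^ 5 := by
      rw [show Z * N ^ 5 = Z * N ^ 4 * N by ring]
      exact Nat.mul_le_mul_left _ hN
    have e₉ : Z * N ^ 3 * 1000 ≤ Z * N ^ 4 := by
      rw [show Z * N ^ 4 = Z * N ^ 3 * N by ring]
      exact Nat.mul_le_mul_left _ hN
    have e₁₀ : Z ≤ Z * N ^ 3 := Nat.le_mul_of_pos_right _ (by positivity)
    omega

/-- One round of the dynamic program. -/
def tableStepE : Exp := bindE (.var 2) (mapE (.app minLE candsE) (.pair (.var 1) (.var 0)))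

/-- Each of the `2 ^ |used|` sets takes one pass through a table with at most `2 ^ |used|` entries
for each of its members, which gives the factor `4 ^ |used|`. -/
theorem ev_tableStepE {k n N : ℕ} (hN : 1000 ≤ N) (hk : k ≤ N) (hn : n ≤ N) (hκ : κ ≤ N)
    {aw : List (Fin k) → Fin n → ℕ} (haw : ∀ B u, Nat.size (aw B u) ≤ κ)
    (hO : ∀ (B : List (Fin k)) (u : Fin n),
      O (.pair (.nat 1) (.pair (.ofList (B.map fun s : Fin k => .nat s)) (.nat u))) = aw B u)
    {used pre : List (Fin n)} (hused : used.Nodup) (hlen : used.length ≤ N) {u : Fin n}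
    (hpre : (pre ++ [u]).Nodup)
    (asg : List (Fin k × Fin n)) (hasg : asg.length ≤ N) (y ρ : Val) :
    Ev O κ tableStepE (.pair (.nat u)
        (.pair (.ofList ((table (fun l u => aw (block asg l) u) used pre).map encE))
          (.pair (.ofList ((subs used).map encUs)) (.pair y (.pair (.ofList (asg.map encA)) ρ)))))
      (.ofList ((table (fun l u => aw (block asg l) u) used (pre ++ [u])).map encE))
      (4 ^ used.length * N ^ 6) := by
  set w : Fin n → Fin n → ℕ := fun l u => aw (block asg l) u with hw
  have hwκ : ∀ l u, Nat.size (w l u) ≤ κ := fun l u => haw _ _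
  set T := table w used pre with hT
  set Z := 2 ^ used.length with hZ
  have hZ1 : 1 ≤ Z := Nat.one_le_two_pow
  have hu : u ∉ pre := fun h => (List.nodup_append'.mp hpre).2.2 h (by simp)
  have hpre' := (List.nodup_append'.mp hpre).1
  have e := Ev.bindConst (O := O) (κ := κ) encUs encE
    (fun A => (minL (cands w u T A)).map fun c => (A, c)) (T := Z * N ^ 5 * 2)
    (Ev.var 2 (.pair (.nat u) (.pair (.ofList (T.map encE))
      (.pair (.ofList ((subs used).map encUs)) (.pair y (.pair (.ofList (asg.map encA)) ρ))))))
    (b := mapE (.app minLE candsE) (.pair (.var 1) (.var 0)))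
    (fun A hA => by
      have hAN := (length_le_of_mem_subs hA).trans hlen
      have h₁ : Ev O κ candsE _ (.ofList ((cands w u T A).map .nat)) _ :=
        ev_candsE hN hk hn hκ haw hO A hAN u T
        (fun e he => (size_le_of_mem_table hused hpre' hwκ hlen he).trans (by omega)) hZ1
        (length_table_le w used pre) asg hasg (.ofList ((subs used).map encUs)) y ρ
      have h₂ := h₁.app (ev_minLE (M := 2 * N) _ fun c hc =>
        (size_le_of_mem_injCosts hwκ hAN
          ((isTable_table w hused hpre').mem_injCosts hused hu hA hc)).trans (by omega))
      refine (Ev.mapConst Val.nat encE (fun c => (A, c)) (T := 5) h₂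
        (fun c _ => ⟨rfl, le_rfl⟩)).mono ?_
      have h₃ := length_minL_le (cands w u T A)
      have h₄ : (cands w u T A).length ≤ (N + 1) * Z := (length_cands_le w u T A).trans
        (Nat.mul_le_mul (Nat.add_le_add_right hAN 1) (length_table_le w used pre))
      have h₅ := Nat.mul_le_mul_right (60 + 2 * (2 * N)) h₄
      have h₆ : (N + 1) * Z * (60 + 2 * (2 * N)) ≤ Z * (N ^ 2 * 6) := by
        rw [mul_right_comm, mul_comm _ Z]
        exact Nat.mul_le_mul_left _ (by nlinarith)
      have h₇ : Z * (N ^ 2 * 1000) ≤ Z * N ^ 5 := by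
        refine Nat.mul_le_mul_left _ ?_
        rw [show N ^ 5 = N ^ 2 * N ^ 3 by ring]
        exact Nat.mul_le_mul_left _ (hN.trans (Nat.le_self_pow (by omega) N))
      have h₈ : 1 * (1000 ^ 2) ≤ Z * N ^ 2 := Nat.mul_le_mul hZ1 (Nat.pow_le_pow_left hN 2)
      have h₉ := Nat.mul_le_mul_right (5 + 120) h₃
      rw [← mul_assoc Z] at h₆ h₇
      omega)
  rw [table_append]
  refine Ev.mono e ?_
  have h₁ : ((subs used).flatMap fun A => (minL (cands w u T A)).map fun c => (A, c)).length ≤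
      Z := by
    have := length_table_le w used (pre ++ [u])
    rwa [table_append] at this
  rw [length_subs, ← hZ, show (4 : ℕ) = 2 * 2 by norm_num, mul_pow, ← hZ]
  have h₂ : Z ≤ Z * Z := Nat.le_mul_of_pos_left _ hZ1
  have h₃ : 1000 * (Z * Z * N ^ 5) ≤ Z * Z * N ^ 6 := by
    rw [show Z * Z * N ^ 6 = N * (Z * Z * N ^ 5) by ring]
    exact Nat.mul_le_mul_right _ hN
  have h₄ : Z * Z * 1 ≤ Z * Z * N ^ 5 := Nat.mul_le_mul_left _ (Nat.one_le_pow _ _ (by omega))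
  have h₅ : Z * (Z * N ^ 5 * 2 + 60) = 2 * (Z * Z * N ^ 5) + 60 * Z := by ring
  omega

/-- The costs of the complete assignments for the pattern `var 0` with the list `var 2` of users. -/
def finalsE : Exp :=
  .app (bindE (.fold (.var 3) (.pair (.pair (.const 0) (.const 0)) (.const 0)) tableStepE)
      (.ite (eqListsE (.app revE (.var 2)) (.fst (.var 0))) (.pair (.snd (.var 0)) (.const 0))
        (.const 0)))
    (.pair (.app subsE (.pair (.fst (.snd (.var 0))) (.const 0)))
      (.pair (.fst (.snd (.var 0))) (.pair (.snd (.snd (.var 0))) (.pair (.var 2) (.const 0)))))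

theorem ev_finalsE {k n N : ℕ} (hN : 1000 ≤ N) (hk : k ≤ N) (hn : n ≤ N) (hκ : κ ≤ N)
    {aw : List (Fin k) → Fin n → ℕ} (haw : ∀ B u, Nat.size (aw B u) ≤ κ)
    (hO : ∀ (B : List (Fin k)) (u : Fin n),
      O (.pair (.nat 1) (.pair (.ofList (B.map fun s : Fin k => .nat s)) (.nat u))) = aw B u)
    {us : List (Fin n)} (hus : us.Nodup) (hlus : us.length ≤ N) (p : Pat (Fin k) (Fin n))
    (hused : p.2.1.Nodup) (hlen : p.2.1.length ≤ N) (hasg : p.2.2.length ≤ N) (x ρ : Val) :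
    Ev O κ finalsE (.pair (encPat p) (.pair x (.pair (encUs us) ρ)))
      (.ofList ((finals (fun l u => aw (block p.2.2 l) u) p.2.1 us).map .nat))
      (4 ^ p.2.1.length * N ^ 8) := by
  obtain ⟨rem, used, asg⟩ := p
  simp only at hused hlen hasg ⊢
  set w : Fin n → Fin n → ℕ := fun l u => aw (block asg l) u with hw
  set v := Val.pair (encPat (rem, used, asg)) (.pair x (.pair (encUs us) ρ)) with hv
  set E := Val.pair (.ofList ((subs used).map encUs)) (.pair (encUs used)
    (.pair (.ofList (asg.map encA)) (.pair (encUs us) (.nat 0)))) with hE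
  set Z := 2 ^ used.length with hZ
  have hZ1 : 1 ≤ Z := Nat.one_le_two_pow
  have hZZ : 4 ^ used.length = Z * Z := by rw [show (4 : ℕ) = 2 * 2 by norm_num, mul_pow]
  have e₁ : Ev O κ (.pair (.app subsE (.pair (.fst (.snd (.var 0))) (.const 0)))
      (.pair (.fst (.snd (.var 0))) (.pair (.snd (.snd (.var 0))) (.pair (.var 2) (.const 0)))))
      v E (Z * N ^ 3 + 40) := by
    have h₁ : Ev O κ (.fst (.snd (.var 0))) v (encUs used) 5 := ⟨rfl, le_rfl⟩
    have h₂ : Ev O κ (.pair (.fst (.snd (.var 0))) (.pair (.snd (.snd (.var 0)))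
      (.pair (.var 2) (.const 0)))) v (.pair (encUs used)
        (.pair (.ofList (asg.map encA)) (.pair (encUs us) (.nat 0)))) 20 :=
      ⟨rfl, by simp [time]⟩
    exact (((h₁.pair (Ev.const 0 v)).app (ev_subsE hN used hlen (.nat 0))).pair h₂).mono (by
      rw [← hZ]
      omega)
  have e₂ := Ev.foldRem (O := O) (κ := κ) (fun u : Fin n => Val.nat u)
    (fun T : List (List (Fin n) × ℕ) => Val.ofList (T.map encE)) (tableStep w (subs used))
    (fun rest T => ∃ pre, pre ++ rest = us ∧ T = table w used pre) (T := Z * Z * N ^ 6)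
    (b₀ := [([], 0)]) (xs := us) (Ev.var 3 E) (i := .pair (.pair (.const 0) (.const 0)) (.const 0))
    (t := 5) ⟨rfl, le_rfl⟩ ⟨[], rfl, rfl⟩ (b := tableStepE) (by
      rintro u _ rest _ ⟨pre, hpre, rfl⟩
      have hpre' : (pre ++ [u]) ++ rest = us := by simp [hpre]
      refine ⟨?_, pre ++ [u], hpre', (table_append w used pre u).symm⟩
      rw [← table_append, ← hZZ]
      exact ev_tableStepE hN hk hn hκ haw hO hused hlen
        (List.nodup_append'.mp (hpre' ▸ hus)).1 asg hasg (encUs used) _)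
  have e₃ := Ev.bindConst (O := O) (κ := κ) encE Val.nat
    (fun e : List (Fin n) × ℕ => if e.1 = used.reverse then [e.2] else [])
    (T := N ^ 3 + 23 * N + 80)
    e₂
    (b := .ite (eqListsE (.app revE (.var 2)) (.fst (.var 0))) (.pair (.snd (.var 0)) (.const 0))
        (.const 0))
    (fun e _ => by
      set w' := Val.pair (encE e) E
      have h₁ : Ev O κ (.fst (.var 0)) w' (encUs e.1) 3 := ⟨rfl, le_rfl⟩
      have h₂ := (Ev.var 2 w').app (ev_revE (O := O) (κ := κ) (fun u : Fin n => Val.nat u) used)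
      have h := Ev.ite (p := e.1 = used.reverse) (Ev.eqLists hN hn (xs := used.reverse)
        (by simpa using hlen) h₂ h₁)
        (ite_one_zero_ne_zero_iff.trans eq_comm)
        (a := .pair (.snd (.var 0)) (.const 0)) (w := .pair (.nat e.2) (.nat 0)) (s := 5)
        (fun _ => ⟨rfl, le_rfl⟩) (fun _ => Ev.const 0 w')
      refine ⟨h.1.trans ?_, h.2.trans ?_⟩
      · by_cases h : e.1 = used.reverse <;> simp [h, Val.ofList]
      · simp only [max_eq_left (show 1 ≤ 5 by omega)]
        omega)
  refine (e₁.app e₃).mono ?_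
  change _ + ((_ + 40 + (table w used us).length * _ + 50 * (finals w used us).length)) + 1 ≤ _
  have h₁ := length_table_le w used us
  have h₂ : (finals w used us).length ≤ (table w used us).length :=
    length_flatMap_ite_singleton_le (fun e : List (Fin n) × ℕ => e.1 = used.reverse) Prod.snd _
  have h₃ := Nat.mul_le_mul_right (18 + Z * Z * N ^ 6) hlus
  have h₄ := Nat.mul_le_mul_right (N ^ 3 + 23 * N + 80 + 60) h₁
  have h₅ : Z ≤ Z * Z := Nat.le_mul_of_pos_left _ hZ1
  have h₆ : ∀ a b : ℕ, a ≤ b → Z * N ^ a ≤ Z * Z * N ^ b := fun a b h =>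
    Nat.mul_le_mul h₅ (Nat.pow_le_pow_right (by omega) h)
  have h₇ := h₆ 3 7 (by omega)
  have h₈ := h₆ 0 7 (by omega)
  have h₉ : 1000 * (Z * Z * N ^ 7) ≤ Z * Z * N ^ 8 := by
    rw [show Z * Z * N ^ 8 = N * (Z * Z * N ^ 7) by ring]
    exact Nat.mul_le_mul_right _ hN
  have h₁₀ := h₆ 1 7 (by omega)
  have h₁₁ : N ≤ Z * N := Nat.le_mul_of_pos_left _ hZ1
  have h₁₂ : N * (18 + Z * Z * N ^ 6) = 18 * N + Z * Z * N ^ 7 := by ring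
  have h₁₃ : 2 ^ used.length * (N ^ 3 + 23 * N + 80 + 60) = Z * N ^ 3 + 23 * (Z * N) + 140 * Z := by
    rw [← hZ]
    ring
  rw [hZZ]
  simp only [pow_zero, pow_one, mul_one] at h₇ h₈ h₁₀
  omega

end Exp

/-! ### The minimum cost of an execution sequence -/

/-- The numbers of the members of a set. -/
def numbers {n : ℕ} (T : Finset (Fin n)) : List ℕ :=
  ((List.finRange n).filter fun i => decide (i ∈ T)).map fun i : Fin n => (i : ℕ)

theorem codeFinset_eq {n : ℕ} (T : Finset (Fin n)) :
    codeFinset T = .ofList ((numbers T).map .nat) := by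
  unfold codeFinset numbers
  congr 2
  simp only [List.map_eq_flatMap]
  rfl

theorem mem_numbers {n : ℕ} {T : Finset (Fin n)} {i : Fin n} : (i : ℕ) ∈ numbers T ↔ i ∈ T := by
  unfold numbers
  simp only [List.mem_map, List.mem_filter, List.mem_finRange, true_and, decide_eq_true_eq]
  constructor
  · rintro ⟨j, hj, h⟩
    rwa [← Fin.ext h]
  · exact fun h => ⟨i, h, rfl⟩

theorem le_of_mem_numbers {n : ℕ} {T : Finset (Fin n)} {a : ℕ} (h : a ∈ numbers T) : a ≤ n := by
  obtain ⟨j, _, rfl⟩ := List.mem_map.mp h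
  exact j.isLt.le

theorem length_numbers_le {n : ℕ} (T : Finset (Fin n)) : (numbers T).length ≤ n := by
  unfold numbers
  rw [List.length_map]
  exact (List.length_filter_le _ _).trans (List.length_finRange).le

/-- One step of the computation of the subscopes; the vertex `v` is put in front of a sequence with
the subscopes `acc`. -/
def segStep {k m : ℕ} (T : Finset (Fin k)) (P : Finset (Fin m)) (acc : List (List (Fin k)))
    (v : Fin k ⊕ Fin m) : List (List (Fin k)) :=
  v.elim (fun s => if s ∈ T then (s :: acc.headD []) :: acc.tail else acc)
    fun r => if r ∈ P then [] :: acc else acc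

/-- The subscopes of a sequence, as lists. -/
def segs {k m : ℕ} (T : Finset (Fin k)) (P : Finset (Fin m)) (σ : List (Fin k ⊕ Fin m)) :
    List (List (Fin k)) :=
  σ.reverse.foldl (segStep T P) [[]]

theorem segs_cons {k m : ℕ} (T : Finset (Fin k)) (P : Finset (Fin m)) (v : Fin k ⊕ Fin m)
    (σ : List (Fin k ⊕ Fin m)) : segs T P (v :: σ) = segStep T P (segs T P σ) v := by
  simp [segs, List.foldl_append]

/-- The subscopes are computed from right to left. -/
theorem map_toFinset_segs {k m n : ℕ} (c : WeightedConstraint (Fin k) (Fin m) (Fin n))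
    (σ : List (Fin k ⊕ Fin m)) :
    (segs c.scope c.releases σ).map List.toFinset = c.subscopes σ := by
  unfold WeightedConstraint.subscopes
  generalize hp : (fun v : Fin k ⊕ Fin m =>
    v.elim (fun _ => false) fun r => decide (r ∈ c.releases)) = p
  induction σ with
  | nil => simp [segs]
  | cons v σ ih =>
    rw [segs_cons, List.splitOnP_cons_eq_if_modifyHead]
    rcases hs : σ.splitOnP p with _ | ⟨l, L⟩
    · exact absurd hs (List.splitOnP_ne_nil _ _)
    rw [hs] at ih
    rcases hg : segs c.scope c.releases σ with _ | ⟨g, G⟩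
    · simp [hg] at ih
    rw [hg, List.map_cons, List.map_cons, List.cons.injEq] at ih
    obtain ⟨h₁, h₂⟩ := ih
    rcases v with s | r
    · have hps : ¬ p (Sum.inl s) = true := by simp [← hp]
      rw [if_neg hps, List.modifyHead_cons, List.map_cons,
        List.filterMap_cons_some (Sum.getLeft?_inl (x := s)),
        List.toFinset_cons]
      simp only [segStep, Sum.elim_inl, List.headD_cons, List.tail_cons]
      by_cases hs : s ∈ c.scope
      · rw [if_pos hs, List.map_cons, List.toFinset_cons, h₁, h₂, Finset.inter_insert_of_mem hs]
      · rw [if_neg hs, List.map_cons, h₁, h₂, Finset.inter_insert_of_notMem hs]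
    · simp only [segStep, Sum.elim_inr]
      by_cases hr : r ∈ c.releases
      · have hpr : p (Sum.inr r) = true := by simp [← hp, hr]
        rw [if_pos hr, if_pos hpr]
        simp [h₁, h₂]
      · have hpr : ¬ p (Sum.inr r) = true := by simp [← hp, hr]
        rw [if_neg hr, if_neg hpr, List.modifyHead_cons, List.map_cons, List.map_cons, h₁, h₂,
          List.filterMap_cons_none rfl]

/-- The subscopes of a sequence are disjoint pieces of it. -/
theorem sum_length_segs_le {k m : ℕ} (T : Finset (Fin k)) (P : Finset (Fin m))
    (σ : List (Fin k ⊕ Fin m)) :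
    ((segs T P σ).map fun l => l.length + 1).sum ≤ σ.length + 1 := by
  induction σ with
  | nil => simp [segs]
  | cons v σ ih =>
    rw [segs_cons, List.length_cons]
    rcases v with s | r
    · simp only [Sum.elim_inl, segStep]
      split_ifs
      · rcases hg : segs T P σ with _ | ⟨g, G⟩
        · simp
        · rw [hg] at ih
          simp only [List.map_cons, List.sum_cons, List.headD_cons, List.tail_cons,
            List.length_cons] at ih ⊢
          omega
      · omega
    · simp only [Sum.elim_inr, segStep]
      split_ifs
      · simp only [List.map_cons, List.sum_cons, List.length_nil]
        omega
      · omega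

theorem decodeSteps_ofList {k : ℕ} (B : List (Fin k)) :
    CCWS.decodeSteps (.ofList (B.map fun s : Fin k => .nat s)) = B.toFinset := by
  ext s
  simp only [CCWS.decodeSteps, Val.toList_ofList, Finset.mem_filter, Finset.mem_univ, true_and,
    List.mem_map, Val.nat.injEq, List.mem_toFinset, Fin.val_inj, exists_eq_right]

theorem decodePlan_ofList {k n : ℕ} {asg : List (Fin k × Fin n)}
    (h : (asg.map Prod.fst).Nodup) :
    CCWS.decodePlan (.ofList (asg.map Exp.encA)) = planOf asg := by
  have hmem : ∀ (s : Fin k) (u : Fin n),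
      Val.pair (.nat s) (.nat u) ∈ (Val.ofList (asg.map Exp.encA)).toList ↔ (s, u) ∈ asg := by
    intro s u
    rw [Val.toList_ofList, List.mem_map]
    constructor
    · rintro ⟨⟨s', u'⟩, ha, he⟩
      simp only [Exp.encA, Val.pair.injEq, Val.nat.injEq] at he
      rwa [← Fin.ext he.1, ← Fin.ext he.2]
    · exact fun h => ⟨_, h, rfl⟩
  funext s
  unfold CCWS.decodePlan planOf
  simp only [hmem]
  rcases hf : (List.finRange n).find? (fun u => decide ((s, u) ∈ asg)) with _ | u
  · rw [List.find?_eq_none] at hf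
    rcases hl : asg.lookup s with _ | u
    · rfl
    · exact absurd ((lookup_eq_some_iff h).mp hl) (by simpa using hf u (List.mem_finRange u))
  · have := List.find?_some hf
    rw [decide_eq_true_eq] at this
    exact ((lookup_eq_some_iff h).mpr this).symm

namespace Exp

variable {O : Val → ℕ} {κ : ℕ}

theorem Ev.mem {N : ℕ} {a b : Exp} {v : Val} {x s t : ℕ} {xs : List ℕ} (hx : x ≤ N)
    (hxs : ∀ y ∈ xs, y ≤ N) (ha : Ev O κ a v (.nat x) s)
    (hb : Ev O κ b v (.ofList (xs.map .nat)) t) :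
    Ev O κ (.app memE (.pair a (.pair b (.const 0)))) v (.nat (if x ∈ xs then 1 else 0))
      (s + t + 30 + xs.length * (60 + 4 * N)) :=
  ((ha.pair (hb.pair (Ev.const 0 v))).app (ev_memE x hx xs hxs (.nat 0))).mono (by omega)

/-- The encoding of the scope and the release points of a constraint. -/
def encC {k m n : ℕ} (c : WeightedConstraint (Fin k) (Fin m) (Fin n)) : Val :=
  .pair (codeFinset c.scope) (codeFinset c.releases)

/-- The encoding of a list of steps. -/
def encB {k : ℕ} (B : List (Fin k)) : Val := .ofList (B.map fun s : Fin k => .nat s)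

/-- The subscopes of the constraint `var 0` in the sequence `var 1`. -/
def subscopesE : Exp :=
  .fold (.app revE (.var 1)) (.pair (.const 0) (.const 0))
    (.ite (.fst (.var 0))
      (.ite (.app memE (.pair (.snd (.var 0)) (.pair (.snd (.var 2)) (.const 0))))
        (.pair (.const 0) (.var 1)) (.var 1))
      (.ite (.app memE (.pair (.snd (.var 0)) (.pair (.fst (.var 2)) (.const 0))))
        (.pair (.pair (.snd (.var 0)) (.fst (.var 1))) (.snd (.var 1))) (.var 1)))

theorem ev_subscopesE {k m n N : ℕ} (hN : 1000 ≤ N) (hk : k ≤ N) (hm : m ≤ N)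
    (c : WeightedConstraint (Fin k) (Fin m) (Fin n)) (σ : List (Fin k ⊕ Fin m))
    (hσ : σ.length ≤ N) (ρ : Val) :
    Ev O κ subscopesE (.pair (encC c) (.pair (encSeq σ) ρ))
      (.ofList ((segs c.scope c.releases σ).map encB)) (N ^ 4) := by
  set v := Val.pair (encC c) (.pair (encSeq σ) ρ)
  have hmem : ∀ {j : ℕ} (T : Finset (Fin j)) (i : Fin j) (e : Exp) (w : Val) (t : ℕ), j ≤ N →
      t ≤ 10 → Ev O κ e w (codeFinset T) t → ∀ e' : Exp, Ev O κ e' w (.nat i) t →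
      Ev O κ (.app memE (.pair e' (.pair e (.const 0)))) w
        (.nat (if i ∈ T then 1 else 0)) (50 + N * (60 + 4 * N)) := by
    intro j T i e w t hj ht he e' he'
    rw [codeFinset_eq] at he
    have := Ev.mem (i.isLt.le.trans hj) (fun y hy => (le_of_mem_numbers hy).trans hj) he' he
    simp only [mem_numbers] at this
    have h := Nat.mul_le_mul_right (60 + 4 * N) ((length_numbers_le T).trans hj)
    exact this.mono (by omega)
  refine (Ev.foldConst (O := O) (κ := κ) encV
    (fun L : List (List (Fin k)) => Val.ofList (L.map encB)) (segStep c.scope c.releases)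
    (fun acc => acc ≠ []) (T := 100 + N * (60 + 4 * N)) ((Ev.var 1 v).app (ev_revE encV σ))
    (i := .pair (.const 0) (.const 0)) (b₀ := [[]]) (t := 3) ⟨rfl, le_rfl⟩ (by simp)
    (fun x _ acc hacc => ?_)).mono ?_
  · obtain ⟨g, G, rfl⟩ := List.exists_cons_of_ne_nil hacc
    set w := Val.pair (encV x) (.pair (.ofList ((g :: G).map encB)) v)
    rcases x with s | r
    · refine ⟨?_, by simp only [segStep, Sum.elim_inl]; split_ifs <;> simp⟩
      have h := Ev.ite (p := s ∈ c.scope) (hmem c.scope s (.fst (.var 2)) w 7 hk (by omega)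
        ⟨rfl, by simp [time]⟩ (.snd (.var 0)) ⟨rfl, by simp [time]⟩) ite_one_zero_ne_zero_iff
        (a := .pair (.pair (.snd (.var 0)) (.fst (.var 1))) (.snd (.var 1)))
        (w := .ofList (((s :: g) :: G).map encB)) (s := 20) (fun _ => ⟨rfl, by simp [time]⟩)
        (fun _ => Ev.var 1 w)
      have h' := Ev.iteFalse (c := .fst (.var 0)) (r := 3) ⟨rfl, le_rfl⟩ h
        (a := .ite (.app memE (.pair (.snd (.var 0)) (.pair (.snd (.var 2)) (.const 0))))
          (.pair (.const 0) (.var 1)) (.var 1))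
      refine ⟨h'.1.trans ?_, h'.2.trans ?_⟩
      · by_cases hs : s ∈ c.scope <;> simp [segStep, hs, w, lookup, Val.fst, Val.snd]
      · simp only [max_eq_left (show 2 * 1 + 1 ≤ 20 by omega)]
        omega
    · refine ⟨?_, by simp only [segStep, Sum.elim_inr]; split_ifs <;> simp⟩
      have h := Ev.ite (p := r ∈ c.releases) (hmem c.releases r (.snd (.var 2)) w 7 hm (by omega)
        ⟨rfl, by simp [time]⟩ (.snd (.var 0)) ⟨rfl, by simp [time]⟩) ite_one_zero_ne_zero_iff
        (a := .pair (.const 0) (.var 1))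
        (w := .ofList (([] :: g :: G).map encB)) (s := 5) (fun _ => ⟨rfl, by simp [time]⟩)
        (fun _ => Ev.var 1 w)
      have h' := Ev.iteTrue (c := .fst (.var 0)) (n := 1) (r := 3) ⟨rfl, le_rfl⟩ one_ne_zero h
        (b := .ite (.app memE (.pair (.snd (.var 0)) (.pair (.fst (.var 2)) (.const 0))))
          (.pair (.pair (.snd (.var 0)) (.fst (.var 1))) (.snd (.var 1))) (.var 1))
      refine ⟨h'.1.trans ?_, h'.2.trans ?_⟩
      · by_cases hr : r ∈ c.releases <;> simp [segStep, hr, w, lookup, Val.fst, Val.snd]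
      · simp only [max_eq_left (show 2 * 1 + 1 ≤ 5 by omega)]
        omega
  · rw [List.length_reverse]
    have h₁ := Nat.mul_le_mul_right (18 + (100 + N * (60 + 4 * N))) hσ
    have h₂ : N * (18 + (100 + N * (60 + 4 * N))) + 100 + 23 * N ≤ 5 * N ^ 3 := by
      nlinarith [Nat.mul_le_mul hN hN, Nat.mul_le_mul (Nat.mul_le_mul hN hN) (le_refl N)]
    have h₃ : 1000 * N ^ 3 ≤ N ^ 4 := by
      rw [show N ^ 4 = N * N ^ 3 by ring]
      exact Nat.mul_le_mul_right _ hN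
    omega

/-- The argument of a call of the subroutine has polynomial size, so that a call takes polynomial
time. -/
theorem size_segs_le {k m N : ℕ} (hk : k ≤ N) (T : Finset (Fin k)) (P : Finset (Fin m))
    (σ : List (Fin k ⊕ Fin m)) (hσ : σ.length ≤ N) :
    (Val.ofList ((segs T P σ).map encB)).size ≤ 1 + (N + 1) * (N + 3) := by
  have h := sum_length_segs_le T P σ
  have h' : ∀ L : List (List (Fin k)), (Val.ofList (L.map encB)).size ≤
      1 + (L.map fun l => l.length + 1).sum * (N + 3) := by
    intro L
    induction L with
    | nil => simp [Val.ofList, Val.size]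
    | cons l L ih =>
      have h₁ : (encB l).size ≤ 1 + l.length * (N + 1 + 1) := by
        refine (size_ofList_le (M := N + 1) fun v hv => ?_).trans (by rw [List.length_map])
        obtain ⟨s, _, rfl⟩ := List.mem_map.mp hv
        have : Nat.size s ≤ N := size_le_of_le (s.isLt.le.trans hk)
        simp only [Val.size]
        omega
      simp only [List.map_cons, Val.ofList, Val.size, List.sum_cons]
      nlinarith
  refine (h' _).trans (Nat.add_le_add_left (Nat.mul_le_mul_right _ ?_) _)
  omega

/-- The sum of the weights of the constraints in the list `var 3` for the plan of the pattern
`var 0` and the sequence `var 1`. -/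
def constraintCostE : Exp :=
  .snd (.fold (.var 3) (.pair (.const 0) (.const 0))
    (.pair (.add (.fst (.var 1)) (.const 1))
      (.add (.snd (.var 1)) (.call (.pair (.const 0) (.pair (.fst (.var 1))
        (.pair (.app subscopesE (.pair (.var 0) (.pair (.var 3) (.const 0))))
          (.snd (.snd (.var 2))))))))))

theorem foldl_count_sum {α : Type*} (g : α → ℕ) (xs : List α) (j t : ℕ) :
    xs.foldl (fun (b : ℕ × ℕ) x => (b.1 + 1, b.2 + g x)) (j, t) =
      (j + xs.length, t + (xs.map g).sum) := by
  induction xs generalizing j t with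
  | nil => rfl
  | cons x xs ih =>
    rw [List.foldl_cons, ih, List.length_cons, List.map_cons, List.sum_cons]
    simp only [Prod.mk.injEq]
    omega

/-- A sum of at most `N` numbers with `κ` bits has at most `N + κ` bits. -/
theorem size_sum_le {α : Type*} {g : α → ℕ} {xs : List α} {N : ℕ} (hN : xs.length ≤ N)
    (hg : ∀ x ∈ xs, Nat.size (g x) ≤ κ) : Nat.size (xs.map g).sum ≤ N + κ := by
  rw [Nat.size_le]
  have h₁ : (xs.map g).sum ≤ xs.length * 2 ^ κ :=
    sum_map_le_length_mul fun x hx => (Nat.size_le.mp (hg x hx)).le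
  calc _ ≤ xs.length * 2 ^ κ := h₁
    _ ≤ N * 2 ^ κ := Nat.mul_le_mul_right _ hN
    _ < 2 ^ N * 2 ^ κ := Nat.mul_lt_mul_of_pos_right N.lt_two_pow_self (by positivity)
    _ = _ := (pow_add 2 N κ).symm

/-- The weights `g` of the constraints are obtained from the subroutine `O`, called with the tag `0`
and the position `j` of the constraint. -/
theorem ev_constraintCostE {k m n N : ℕ} (hN : 1000 ≤ N) (hk : k ≤ N) (hm : m ≤ N) (hn : n ≤ N)
    (hκ : κ ≤ N) (cs : List (WeightedConstraint (Fin k) (Fin m) (Fin n))) (hcs : cs.length ≤ N)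
    (p : Pat (Fin k) (Fin n)) (hp : p.2.2.length ≤ N) (σ : List (Fin k ⊕ Fin m))
    (hσ : σ.length ≤ N) (g : WeightedConstraint (Fin k) (Fin m) (Fin n) → ℕ)
    (hg : ∀ c ∈ cs, Nat.size (g c) ≤ κ)
    (hO : ∀ (j : ℕ) (c : WeightedConstraint (Fin k) (Fin m) (Fin n)), cs[j]? = some c →
      O (.pair (.nat 0) (.pair (.nat j)
        (.pair (.ofList ((segs c.scope c.releases σ).map encB)) (.ofList (p.2.2.map encA))))) = g c)
    (x ρ : Val) :
    Ev O κ constraintCostE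
      (.pair (encPat p) (.pair (encSeq σ) (.pair x (.pair (.ofList (cs.map encC)) ρ))))
      (.nat (cs.map g).sum) (N ^ 6) := by
  set v := Val.pair (encPat p)
    (.pair (encSeq σ) (.pair x (.pair (.ofList (cs.map encC)) ρ))) with hv
  have hN2 : 1000 * N ≤ N ^ 2 := by nlinarith
  have hN3 : 1000 * N ^ 2 ≤ N ^ 3 := by
    rw [show N ^ 3 = N * N ^ 2 by ring]
    exact Nat.mul_le_mul_right _ hN
  have hN4 : 1000 * N ^ 3 ≤ N ^ 4 := by
    rw [show N ^ 4 = N * N ^ 3 by ring]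
    exact Nat.mul_le_mul_right _ hN
  have hN5 : 1000 * N ^ 4 ≤ N ^ 5 := by
    rw [show N ^ 5 = N * N ^ 4 by ring]
    exact Nat.mul_le_mul_right _ hN
  have hN6 : 1000 * N ^ 5 ≤ N ^ 6 := by
    rw [show N ^ 6 = N * N ^ 5 by ring]
    exact Nat.mul_le_mul_right _ hN
  have e := Ev.foldRem (O := O) (κ := κ) encC
    (fun b : ℕ × ℕ => Val.pair (.nat b.1) (.nat b.2)) (fun b c => (b.1 + 1, b.2 + g c))
    (fun rest b => ∃ pre, pre ++ rest = cs ∧ b = (pre.length, (pre.map g).sum)) (T := 2 * N ^ 4)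
    (b₀ := (0, 0)) (xs := cs) (Ev.var 3 v) (i := .pair (.const 0) (.const 0)) (t := 3)
    ⟨rfl, le_rfl⟩ ⟨[], rfl, rfl⟩
    (b := .pair (.add (.fst (.var 1)) (.const 1))
      (.add (.snd (.var 1)) (.call (.pair (.const 0) (.pair (.fst (.var 1))
        (.pair (.app subscopesE (.pair (.var 0) (.pair (.var 3) (.const 0))))
          (.snd (.snd (.var 2)))))))))
    (by
      rintro c hc rest _ ⟨pre, hpre, rfl⟩
      refine ⟨?_, pre ++ [c], by simp [hpre], by simp⟩
      set j := pre.length with hj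
      set tot := (pre.map g).sum with htot
      set w := Val.pair (encC c) (.pair (.pair (.nat j) (.nat tot)) v) with hw
      have hcj : cs[j]? = some c := by
        rw [← hpre, List.getElem?_append_right le_rfl, Nat.sub_self]
        rfl
      have hjN : j ≤ N := by
        refine le_trans ?_ hcs
        rw [← hpre, List.length_append]
        omega
      have hjs : Nat.size j ≤ N := size_le_of_le hjN
      have htots : Nat.size tot ≤ N + κ :=
        size_sum_le hjN fun c' hc' => hg c' (by rw [← hpre]; simp [hc'])
      have h₁ : Ev O κ (.fst (.var 1)) w (.nat j) 5 := ⟨rfl, le_rfl⟩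
      have h₂ : Ev O κ (.snd (.var 1)) w (.nat tot) 5 := ⟨rfl, le_rfl⟩
      have h₃ := ((Ev.var 0 w).pair ((Ev.var 3 w).pair (Ev.const 0 w))).app
        (ev_subscopesE (O := O) (κ := κ) hN hk hm c σ hσ (.nat 0))
      have h₄ : Ev O κ (.snd (.snd (.var 2))) w (.ofList (p.2.2.map encA)) 9 := ⟨rfl, le_rfl⟩
      have h₅ := ((Ev.const 0 w).pair (h₁.pair (h₃.pair h₄))).call
      rw [hO j c hcj] at h₅
      refine ((h₁.add (Ev.const 1 w)).pair (h₂.add h₅)).mono ?_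
      have h₆ := size_segs_le hk c.scope c.releases σ hσ
      have h₇ : (Val.ofList (p.2.2.map encA)).size ≤ 1 + N * (2 * N + 3 + 1) := by
        refine (size_ofList_le (M := 2 * N + 3) fun v hv => ?_).trans ?_
        · obtain ⟨a, _, rfl⟩ := List.mem_map.mp hv
          have h₁ : Nat.size a.1 ≤ N := size_le_of_le (a.1.isLt.le.trans hk)
          have h₂ : Nat.size a.2 ≤ N := size_le_of_le (a.2.isLt.le.trans hn)
          simp only [encA, Val.size]
          omega
        · rw [List.length_map]
          exact Nat.add_le_add_left (Nat.mul_le_mul_right _ hp) _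
      have h₈ := hg c hc
      have h₉ : (N + 1) * (N + 3) = N ^ 2 + 4 * N + 3 := by ring
      have h₁₀ : N * (2 * N + 3 + 1) = 2 * N ^ 2 + 4 * N := by ring
      simp only [Val.size, Nat.size_one, Nat.size_zero]
      omega)
  rw [foldl_count_sum, zero_add, zero_add] at e
  refine (Ev.snd e).mono ?_
  have h₁ := Nat.mul_le_mul_right (18 + 2 * N ^ 4) hcs
  have h₂ : N * (18 + 2 * N ^ 4) = 18 * N + 2 * N ^ 5 := by ring
  omega

/-- The minimum cost of a plan for the sequence `var 0`, with the list `var 1` of users and the list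
`var 2` of constraints. -/
def wstarE : Exp :=
  .fst (.app minLE (bindE patsE
    (.app (mapE (.var 0) (.add (.var 0) (.var 2)))
      (.pair finalsE (.pair constraintCostE (.const 0))))))

theorem length_finals_le {n : ℕ} (w : Fin n → Fin n → ℕ) (used us : List (Fin n)) :
    (finals w used us).length ≤ 2 ^ used.length :=
  (length_flatMap_ite_singleton_le (fun e : List (Fin n) × ℕ => e.1 = used.reverse)
    Prod.snd _).trans (length_table_le w used us)

/-- The minimum cost is computed by running the dynamic program for every pattern, in time at most a
polynomial times the weighted number of patterns. -/
theorem ev_wstarE (I : CCWS) {N : ℕ} (hN : 1000 ≤ N) (hk : I.numSteps ≤ N)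
    (hm : I.numReleases ≤ N) (hn : I.numUsers ≤ N) (hκ : κ ≤ N) (hW : I.WeightBitsLE κ)
    (hcs : I.schema.constraints.length ≤ N) (σ : List (Fin I.numSteps ⊕ Fin I.numReleases))
    (hσ : σ.Nodup) (hσN : σ.length ≤ N) (ρ : Val) :
    Ev I.weightOracle κ wstarE
      (.pair (encSeq σ) (.pair (encUs (List.finRange I.numUsers))
        (.pair (.ofList (I.schema.constraints.map encC)) ρ)))
      (.nat (I.schema.minCost σ)) (Nat.factorial (I.numSteps + 3) * N ^ 10) := by
  set us := List.finRange I.numUsers with hus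
  have husnd : us.Nodup := List.nodup_finRange _
  have husN : us.length ≤ N := by simpa [hus] using hn
  set v := Val.pair (encSeq σ) (.pair (encUs us)
    (.pair (.ofList (I.schema.constraints.map encC)) ρ)) with hv
  set Y := Nat.factorial (I.numSteps + 3) with hY
  have hY1 : 1 ≤ Y := Nat.factorial_pos _
  have hsteps : (σ.filterMap Sum.getLeft?).length ≤ I.numSteps := by
    have hnd : (σ.filterMap Sum.getLeft?).Nodup := by
      refine hσ.filterMap fun a a' b h h' => ?_
      rw [Option.mem_def, Sum.getLeft?_eq_some_iff] at h h'
      rw [h, h']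
    simpa using hnd.length_le_card
  have hYσ : Nat.factorial ((σ.filterMap Sum.getLeft?).length + 3) ≤ Y :=
    Nat.factorial_le (by omega)
  have hused : ∀ p ∈ pats us σ, p.2.1.Nodup := fun p hp =>
    (List.nodup_append'.mp ((pats_spec p hp).1.nodup_iff.mpr husnd)).1
  have hlen : ∀ p ∈ pats us σ, p.2.1.length ≤ N := fun p hp =>
    ((sum_four_pow_pats us σ).1 p hp).trans (hsteps.trans hk)
  have hasg : ∀ p ∈ pats us σ, p.2.2.length ≤ N := fun p hp => by
    rw [← List.length_map (f := Prod.fst), (pats_spec p hp).2.2, List.length_reverse]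
    exact hsteps.trans hk
  let aw : List (Fin I.numSteps) → Fin I.numUsers → ℕ := fun B u => I.schema.authWeight B.toFinset u
  have haw : ∀ B u, Nat.size (aw B u) ≤ κ := fun B u => hW.2 _ _
  let cc : Pat (Fin I.numSteps) (Fin I.numUsers) → ℕ := fun p =>
    I.schema.constraintCost σ (planOf p.2.2)
  let fin : Pat (Fin I.numSteps) (Fin I.numUsers) → List ℕ := fun p =>
    finals (fun l u => aw (block p.2.2 l) u) p.2.1 us
  -- the subroutine yields the authorization weights
  have hO₁ : ∀ (B : List (Fin I.numSteps)) (u : Fin I.numUsers), I.weightOracle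
      (.pair (.nat 1) (.pair (.ofList (B.map fun s : Fin I.numSteps => .nat s)) (.nat u))) =
        aw B u := by
    intro B u
    change (if h : (u : ℕ) < I.numUsers then I.schema.authWeight
      (CCWS.decodeSteps (.ofList (B.map fun s : Fin I.numSteps => .nat s))) ⟨u, h⟩ else 0) = _
    rw [dif_pos u.isLt, decodeSteps_ofList]
  have hbits : ∀ p ∈ pats us σ, ∀ c ∈ I.schema.constraints,
      Nat.size (c.weight (c.subscopes σ) (planOf p.2.2)) ≤ κ := by
    intro p hp c hc
    refine hW.1 c hc _ _ fun T hT => ?_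
    obtain ⟨h₁, h₂⟩ := WeightedConstraint.subset_of_mem_subscopes hT
    refine ⟨h₁, fun s hs => ?_⟩
    simp only [Plan.dom, Set.mem_ofPred_eq, isSome_planOf_iff hσ hp]
    exact h₂ s hs
  have hccs : ∀ p ∈ pats us σ, Nat.size (cc p) ≤ 2 * N := fun p hp =>
    (size_sum_le hcs (hbits p hp)).trans (by omega)
  have hfins : ∀ p ∈ pats us σ, ∀ c ∈ fin p, Nat.size c ≤ 2 * N := fun p hp c hc =>
    (size_le_of_mem_table (e := (p.2.1.reverse, c)) (hused p hp) husnd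
      (fun l u => haw (block p.2.2 l) u) (hlen p hp) (mem_finals.mp hc)).trans (by omega)
  -- the costs for one pattern
  have e₁ : ∀ p ∈ pats us σ, Ev I.weightOracle κ
      (.app (mapE (.var 0) (.add (.var 0) (.var 2)))
        (.pair finalsE (.pair constraintCostE (.const 0)))) (.pair (encPat p) v)
      (.ofList (((fin p).map fun c => c + cc p).map .nat)) (4 ^ p.2.1.length * (2 * N ^ 8)) := by
    intro p hp
    have h₁ := ev_finalsE hN hk hn hκ haw hO₁ husnd husN p (hused p hp) (hlen p hp) (hasg p hp)
      (encSeq σ) (.pair (.ofList (I.schema.constraints.map encC)) ρ)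
    have h₂ := ev_constraintCostE (O := I.weightOracle) hN hk hm hn hκ I.schema.constraints hcs p
      (hasg p hp) σ hσN (fun c => c.weight (c.subscopes σ) (planOf p.2.2)) (hbits p hp)
      (fun j c hj => by
        unfold CCWS.weightOracle
        simp only [hj]
        rw [decodePlan_ofList (nodup_fst_of_mem_pats hσ hp), Val.toList_ofList, List.map_map,
          ← map_toFinset_segs]
        congr 1
        exact List.map_congr_left fun B _ => decodeSteps_ofList B) (encUs us) ρ
    set w := Val.pair (.ofList ((fin p).map .nat)) (.pair (.nat (cc p)) (.nat 0)) with hw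
    have h₃ := Ev.mapConst (O := I.weightOracle) (κ := κ) Val.nat Val.nat (fun c => c + cc p)
      (xs := fin p) (T := 4 * N + 20) (Ev.var 0 w) (b := .add (.var 0) (.var 2)) (fun c hc => by
        have h₄ := hfins p hp c hc
        have h₅ := hccs p hp
        exact ((Ev.var 0 (.pair (.nat c) w)).add (Ev.var 2 (.pair (.nat c) w)) (y := cc p)).mono
          (by omega))
    refine ((h₁.pair (h₂.pair (Ev.const 0 (.pair (encPat p) v)))).app h₃).mono ?_
    have h₄ := length_finals_le (fun l u => aw (block p.2.2 l) u) p.2.1 us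
    have h₅ : 2 ^ p.2.1.length ≤ 4 ^ p.2.1.length := Nat.pow_le_pow_left (by norm_num) _
    have h₆ : (fin p).length * (4 * N + 20 + 120) ≤ _ :=
      Nat.mul_le_mul_right (4 * N + 20 + 120) (h₄.trans h₅)
    set Q := 4 ^ p.2.1.length with hQ
    have hQ1 : 1 ≤ Q := Nat.one_le_pow _ _ (by omega)
    have h₇ : N ^ 6 + 100 + (4 * N + 20 + 120) ≤ N ^ 8 := by
      have e₁ : 1000 * N ≤ N ^ 6 := by
        rw [show N ^ 6 = N ^ 5 * N by ring]
        exact Nat.mul_le_mul_right _ (hN.trans (Nat.le_self_pow (by omega) N))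
      have e₂ : 1000 * N ^ 6 ≤ N ^ 8 := by
        rw [show N ^ 8 = N ^ 2 * N ^ 6 by ring]
        exact Nat.mul_le_mul_right _ (hN.trans (Nat.le_self_pow (by omega) N))
      omega
    have h₈ := Nat.mul_le_mul_left Q h₇
    have h₉ : N ^ 6 + 100 ≤ Q * (N ^ 6 + 100) := Nat.le_mul_of_pos_left _ hQ1
    rw [mul_add] at h₈
    have h₁₀ : Q * (2 * N ^ 8) = Q * N ^ 8 + Q * N ^ 8 := by ring
    change _ + (_ + _ + 1) + 1 + (_ + 40 + (fin p).length * (4 * N + 20 + 120)) + 1 ≤ _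
    omega
  have e₂ := Ev.bind encPat Val.nat (fun p => (fin p).map fun c => c + cc p)
    (ev_patsE (O := I.weightOracle) (κ := κ) hN us σ hσN
      (.pair (.ofList (I.schema.constraints.map encC)) ρ)) e₁
  -- the sum of two numbers with `2 * N` bits has at most `3 * N` bits
  have e₃ := e₂.app (ev_minLE (M := 3 * N) _ fun c hc => by
    simp only [List.mem_flatMap, List.mem_map] at hc
    obtain ⟨p, hp, c, hc, rfl⟩ := hc
    have h₁ := Nat.size_le.mp (hfins p hp c hc)
    have h₂ := Nat.size_le.mp (hccs p hp)
    rw [Nat.size_le]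
    calc c + cc p < 2 ^ (2 * N) + 2 ^ (2 * N) := by omega
      _ = 2 ^ (2 * N + 1) := by ring
      _ ≤ 2 ^ (3 * N) := Nat.pow_le_pow_right (by omega) (by omega))
  have hmin : minL ((pats us σ).flatMap fun p => (fin p).map fun c => c + cc p) =
      [I.schema.minCost σ] :=
    I.schema.minL_planCosts I.userIndependent hσ husnd fun u => List.mem_finRange u
  rw [hmin] at e₃
  refine (Ev.fst (y := .nat 0) e₃).mono ?_
  -- the time for a pattern with `j` used users is proportional to `4 ^ j`
  have hsum := (sum_four_pow_pats us σ).2.trans hYσ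
  set F : ℕ := ((pats us σ).map fun q => 4 ^ q.2.1.length).sum with hF
  have h₁ : ((pats us σ).map fun p => 4 ^ p.2.1.length * (2 * N ^ 8) + 60 +
      50 * ((fin p).map fun c => c + cc p).length).sum ≤ F * (2 * N ^ 8 + 110) := by
    rw [hF, ← List.sum_map_mul_right]
    refine List.sum_le_sum fun p _ => ?_
    have h₄ := length_finals_le (fun l u => aw (block p.2.2 l) u) p.2.1 us
    have h₅ : 2 ^ p.2.1.length ≤ 4 ^ p.2.1.length := Nat.pow_le_pow_left (by norm_num) _
    have h₆ : 1 ≤ 4 ^ p.2.1.length := Nat.one_le_pow _ _ (by omega)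
    rw [List.length_map]
    change _ + 50 * (finals (fun l u => aw (block p.2.2 l) u) p.2.1 us).length ≤ _
    rw [mul_add]
    omega
  have h₂ : ((pats us σ).flatMap fun p => (fin p).map fun c => c + cc p).length ≤ F := by
    rw [List.length_flatMap, hF]
    refine List.sum_le_sum fun p _ => ?_
    rw [List.length_map]
    exact (length_finals_le (fun l u => aw (block p.2.2 l) u) p.2.1 us).trans
      (Nat.pow_le_pow_left (by norm_num) _)
  have h₃ := Nat.mul_le_mul_right (60 + 2 * (3 * N)) (h₂.trans hsum)
  have h₄ := h₁.trans (Nat.mul_le_mul_right _ hsum)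
  have h₅ := Nat.mul_le_mul_right (N ^ 4) hYσ
  have h₆ : N ^ 4 + (2 * N ^ 8 + 110) + (60 + 2 * (3 * N)) + 100 ≤ N ^ 10 := by
    have e₁ : 1000 * N ≤ N ^ 4 := by
      rw [show N ^ 4 = N ^ 3 * N by ring]
      exact Nat.mul_le_mul_right _ (hN.trans (Nat.le_self_pow (by omega) N))
    have e₂ : 1000 * N ^ 4 ≤ N ^ 8 := by
      rw [show N ^ 8 = N ^ 4 * N ^ 4 by ring]
      exact Nat.mul_le_mul_right _ (hN.trans (Nat.le_self_pow (by omega) N))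
    have e₃ : 1000 * N ^ 8 ≤ N ^ 10 := by
      rw [show N ^ 10 = N ^ 2 * N ^ 8 by ring]
      exact Nat.mul_le_mul_right _ (hN.trans (Nat.le_self_pow (by omega) N))
    omega
  have h₇ := Nat.mul_le_mul_left Y h₆
  simp only [mul_add] at h₇ h₄ h₃
  simp only [mul_add]
  omega

end Exp

/-! ### Bounds in terms of the size of an instance -/

theorem length_le_size_ofList (l : List Val) : l.length ≤ (Val.ofList l).size := by
  induction l with
  | nil => simp
  | cons v l ih =>
    simp only [Val.ofList, Val.size, List.length_cons]
    omega

theorem numXor_le_length_code {k m : ℕ} (G : Workflow (Fin k) (Fin m)) :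
    G.numXor ≤ G.code.length := by
  induction G with
  | step s => simp [Workflow.numXor]
  | release r => simp [Workflow.numXor]
  | seq G₁ G₂ h₁ h₂ => simp only [Workflow.numXor, Workflow.code, List.length_append]; omega
  | par G₁ G₂ h₁ h₂ => simp only [Workflow.numXor, Workflow.code, List.length_append]; omega
  | xor G₁ G₂ h₁ h₂ =>
    simp only [Workflow.numXor, Workflow.code, List.length_append, List.length_singleton]
    omega

/-- The tokens of a workflow in reverse Polish notation that are pairs are its vertices. -/
theorem flatMap_code {k m : ℕ} (G : Workflow (Fin k) (Fin m)) :
    (G.code.flatMap fun t => if t.isPair ≠ 0 then [t] else []) = G.vertices.map encV := by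
  induction G with
  | step s => rfl
  | release r => rfl
  | seq G₁ G₂ h₁ h₂ | par G₁ G₂ h₁ h₂ | xor G₁ G₂ h₁ h₂ =>
    simp only [Workflow.code, Workflow.vertices, List.flatMap_append, h₁, h₂, List.map_append]
    simp [Val.isPair]

namespace CCWS

theorem code_eq (I : CCWS) : I.code = .pair (.ofList I.schema.workflow.code)
    (.pair (Exp.encUs (List.finRange I.numUsers)) (.pair (codeAuth I.schema.auth)
      (.pair (.ofList (I.schema.constraints.map Exp.encC)) (.nat 0)))) := by
  have h : (List.finRange I.numUsers >>= fun a => pure (a : ℕ)) =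
      (List.finRange I.numUsers).map fun u : Fin I.numUsers => (u : ℕ) := by
    rw [List.map_eq_flatMap]
    rfl
  unfold CCWS.code Exp.encUs
  simp only [Val.ofList]
  rw [h, List.map_map]
  rfl

/-- The number `N` bounds all the quantities on which the polynomial factors of the running times
depend. -/
structure Fits (I : CCWS) (κ N : ℕ) : Prop where
  large : 1000 ≤ N
  workflow : I.schema.workflow.code.length ≤ N
  users : I.numUsers ≤ N
  constraints : I.schema.constraints.length ≤ N
  call : κ ≤ N
  bits : I.WeightBitsLE κ

/-- The size of the code of an instance bounds its dimensions. -/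
theorem fits (I : CCWS) {κ N : ℕ} (h : I.WeightBitsLE κ) (hN : I.code.size + κ + 1000 ≤ N) :
    I.Fits κ N := by
  rw [code_eq] at hN
  simp only [Val.size, Exp.encUs] at hN
  have h₁ := length_le_size_ofList I.schema.workflow.code
  have h₂ := length_le_size_ofList ((List.finRange I.numUsers).map fun u : Fin I.numUsers => .nat u)
  have h₃ := length_le_size_ofList (I.schema.constraints.map Exp.encC)
  rw [List.length_map] at h₂ h₃
  rw [List.length_finRange] at h₂
  exact ⟨by omega, by omega, by omega, by omega, by omega, h⟩

variable {I : CCWS} {κ N : ℕ}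

theorem Fits.steps_add_releases (h : I.Fits κ N) : I.numSteps + I.numReleases ≤ N := by
  refine le_trans ?_ (I.schema.workflow.length_vertices_le.trans h.workflow)
  have h₁ : (Finset.univ : Finset (Fin I.numSteps ⊕ Fin I.numReleases)) ⊆
      I.schema.workflow.vertices.toFinset := fun v _ =>
    List.mem_toFinset.mpr (I.schema.mem_vertices v)
  have h₂ := (Finset.card_le_card h₁).trans (List.toFinset_card_le _)
  simpa using h₂

/-- The minimum cost is at most the cost of some plan, a sum of polynomially many weights. -/
theorem Fits.size_minCost_le (h : I.Fits κ N) {σ : List (Fin I.numSteps ⊕ Fin I.numReleases)} :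
    Nat.size (I.schema.minCost σ) ≤ 3 * N := by
  obtain ⟨π, hπ, hcost⟩ := (I.schema.minCost_isLeast σ).1
  have hdom : ∀ s, Sum.inl s ∈ σ → s ∈ π.dom := fun s hs => (Set.ext_iff.mp hπ s).mpr hs
  have h₁ : (I.schema.constraints.map fun c => c.weight (c.subscopes σ) π).sum ≤
      I.schema.constraints.length * 2 ^ κ :=
    Exp.sum_map_le_length_mul fun c hc => (Nat.size_le.mp (h.bits.1 c hc _ _ fun T hT => by
      obtain ⟨h₁, h₂⟩ := WeightedConstraint.subset_of_mem_subscopes hT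
      exact ⟨h₁, fun s hs => hdom s (h₂ s hs)⟩)).le
  have h₂ : ∑ u, I.schema.authWeight (Finset.univ.filter fun s => π s = some u) u ≤
      I.numUsers * 2 ^ κ := by
    have := Finset.sum_le_card_nsmul Finset.univ
      (fun u => I.schema.authWeight (Finset.univ.filter fun s => π s = some u) u) (2 ^ κ)
      fun u _ => (Nat.size_le.mp (h.bits.2 _ u)).le
    simpa using this
  have h₃ := Nat.mul_le_mul_right (2 ^ κ) (Nat.add_le_add h.constraints h.users)
  have h₄ : (2 * N) * 2 ^ κ < 2 ^ (2 * N) * 2 ^ κ :=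
    Nat.mul_lt_mul_of_pos_right (2 * N).lt_two_pow_self (by positivity)
  have h₅ : 2 ^ (2 * N) * 2 ^ κ ≤ 2 ^ (3 * N) := by
    rw [← pow_add]
    exact Nat.pow_le_pow_right (by omega) (by have := h.call; omega)
  rw [Nat.size_le, ← hcost]
  unfold Schema.cost
  rw [← two_mul] at h₃
  rw [add_mul] at h₃
  omega

/-- The number of execution sequences is at most exponential in a polynomial, so that it has
polynomially many bits and the arithmetic on the counts takes polynomial time. -/
theorem Fits.card_execSeqs_le (h : I.Fits κ N) : I.schema.execSeqs.card ≤ 2 ^ (N + N * N) := by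
  have h₁ := I.schema.length_seqs_le
  have h₂ := I.schema.sum_seqs fun _ => 1
  simp only [List.map_const', List.sum_replicate, smul_eq_mul, mul_one, Finset.sum_const] at h₂
  rw [← h₂]
  refine h₁.trans ?_
  rw [Fintype.card_fin, Fintype.card_fin, pow_add, pow_mul]
  refine Nat.mul_le_mul (Nat.pow_le_pow_right (by omega)
    ((numXor_le_length_code _).trans h.workflow)) ?_
  calc Nat.factorial (I.numSteps + I.numReleases) ≤ Nat.factorial N :=
        Nat.factorial_le h.steps_add_releases
    _ ≤ N ^ N := Nat.factorial_le_pow N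
    _ ≤ (2 ^ N) ^ N := Nat.pow_le_pow_left N.lt_two_pow_self.le N

theorem Fits.size_card_le (h : I.Fits κ N) : Nat.size I.schema.execSeqs.card ≤ 2 * N ^ 2 := by
  rw [Nat.size_le]
  refine h.card_execSeqs_le.trans_lt (Nat.pow_lt_pow_right (by omega) ?_)
  have := h.large
  nlinarith

theorem Fits.size_sum_minCost_le (h : I.Fits κ N) :
    Nat.size (∑ σ ∈ I.schema.execSeqs, I.schema.minCost σ) ≤ 2 * N ^ 2 := by
  have h₁ := Finset.sum_le_card_nsmul I.schema.execSeqs I.schema.minCost (2 ^ (3 * N))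
    fun σ _ => (Nat.size_le.mp h.size_minCost_le).le
  rw [smul_eq_mul] at h₁
  rw [Nat.size_le]
  refine h₁.trans_lt ((Nat.mul_le_mul_right _ h.card_execSeqs_le).trans_lt ?_)
  rw [← pow_add]
  refine Nat.pow_lt_pow_right (by omega) ?_
  have := h.large
  nlinarith

/-! ### The summary of an instance -/

/-- The groups of execution sequences with equal keys, each given by its size and its minimum
cost. -/
noncomputable def summary (I : CCWS) : List (ℕ × ℕ) :=
  (Exp.groups I.schema.workflow.seqs I.schema.workflow.vertices).map fun g =>
    (g.length, I.schema.minCost (g.headD ([], [])).2)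

theorem isGrouping (I : CCWS) :
    IsGrouping I.schema.workflow.seqs (fun σ => I.schema.workflow.vertices.map (key σ))
      (List.range (I.schema.workflow.vertices.length + 1)).reverse 0
      (Exp.groups I.schema.workflow.seqs I.schema.workflow.vertices) :=
  Exp.isGrouping_groups I.schema.workflow.seqs_ne_nil fun _ hσ => Workflow.length_le_of_mem_seqs hσ

theorem mem_execSeqs_iff (I : CCWS) {σ : List (Fin I.numSteps ⊕ Fin I.numReleases)} :
    σ ∈ I.schema.execSeqs ↔ σ ∈ I.schema.workflow.seqs :=
  (Workflow.mem_seqs _ σ).symm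

theorem headD_mem {α : Type*} {l : List α} (h : l ≠ []) (a : α) : l.headD a ∈ l := by
  obtain ⟨x, l, rfl⟩ := List.exists_cons_of_ne_nil h
  simp

/-- Sequences in the same group have the same minimum cost, because equal keys imply equivalence. -/
theorem minCost_eq_of_mem_group (I : CCWS) {g : List (List ℕ × List (Fin I.numSteps ⊕
    Fin I.numReleases))} (hg : g ∈ Exp.groups I.schema.workflow.seqs I.schema.workflow.vertices)
    {it it' : List ℕ × List (Fin I.numSteps ⊕ Fin I.numReleases)} (h : it ∈ g) (h' : it' ∈ g) :
    I.schema.minCost it.2 = I.schema.minCost it'.2 := by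
  have h₁ := I.mem_execSeqs_iff.mpr (I.isGrouping.mem g hg it h)
  have h₂ := I.mem_execSeqs_iff.mpr (I.isGrouping.mem g hg it' h')
  refine I.schema.minCost_eq_of_seqEquiv h₁ h₂ (seqEquiv_of_key_eq
    (I.schema.nodup_of_mem_execSeqs h₁) (I.schema.nodup_of_mem_execSeqs h₂) fun v => ?_)
  exact List.map_inj_left.mp (I.isGrouping.key_eq hg h h') v (I.schema.mem_vertices v)

/-- A sum over the execution sequences is a sum over the groups, weighted with their sizes.  The
groups need not be known to be whole execution arrangements. -/
theorem sum_summary (I : CCWS) (F : ℕ → ℕ) :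
    (I.summary.map fun x => x.1 * F x.2).sum = ∑ σ ∈ I.schema.execSeqs, F (I.schema.minCost σ) := by
  rw [← I.schema.sum_seqs, ← I.isGrouping.sum_eq fun σ => F (I.schema.minCost σ), summary,
    List.map_map]
  refine congrArg List.sum (List.map_congr_left fun g hg => ?_)
  have h := headD_mem (I.isGrouping.ne_nil g hg) ([], [])
  rw [List.map_congr_left fun it hit => by rw [I.minCost_eq_of_mem_group hg hit h]]
  simp

/-- There are at most as many groups as families of keys of execution sequences. -/
theorem length_summary_le (I : CCWS) : I.summary.length ≤
    2 ^ I.numXor * (Nat.factorial I.numReleases * (I.numReleases + 1) ^ I.numSteps) := by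
  rw [summary, List.length_map]
  refine I.isGrouping.length_le_card.trans ?_
  have h : (I.schema.workflow.seqs.toFinset.image
      fun σ => I.schema.workflow.vertices.map (key σ)) =
      (I.schema.execSeqs.image key).image fun f => I.schema.workflow.vertices.map f := by
    rw [Finset.image_image]
    congr 1
    ext σ
    rw [List.mem_toFinset, mem_execSeqs_iff]
  rw [h]
  refine Finset.card_image_le.trans (I.schema.card_image_key_le.trans ?_)
  rw [Fintype.card_fin, Fintype.card_fin]
  exact le_rfl

theorem one_le_timeFactor (I : CCWS) : 1 ≤ I.timeFactor := by
  unfold timeFactor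
  have h₁ : 0 < I.numSteps ^ I.numSteps := by
    rcases Nat.eq_zero_or_pos I.numSteps with h | h
    · simp [h]
    · positivity
  have h₂ := Nat.factorial_pos I.numReleases
  exact Nat.succ_le_of_lt (by positivity)

/-- All execution sequences can be listed within the time bound. -/
theorem length_seqs_le_timeFactor (I : CCWS) : I.schema.workflow.seqs.length ≤ I.timeFactor := by
  refine I.schema.length_seqs_le.trans ?_
  rw [Fintype.card_fin, Fintype.card_fin]
  unfold timeFactor
  rw [mul_assoc, mul_assoc]
  refine Nat.mul_le_mul_left _ ((factorial_add_le _ _).trans ?_)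
  rw [mul_assoc]
  exact Nat.mul_le_mul_left _ (Nat.mul_le_mul_left _ (Nat.factorial_le_pow _))

/-- The minimum costs of all groups can be computed within the time bound. -/
theorem Fits.length_summary_mul_le (h : I.Fits κ N) :
    I.summary.length * Nat.factorial (I.numSteps + 3) ≤ I.timeFactor * (8 * N ^ 3) := by
  have h₁ : Nat.factorial (I.numSteps + 3) ≤ I.numSteps ^ I.numSteps * (8 * N ^ 3) := by
    have hk := h.steps_add_releases
    have hN := h.large
    rw [Nat.factorial_succ, Nat.factorial_succ, Nat.factorial_succ]
    calc _ ≤ (2 * N) * ((2 * N) * ((2 * N) * Nat.factorial I.numSteps)) :=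
          Nat.mul_le_mul (by omega) (Nat.mul_le_mul (by omega) (Nat.mul_le_mul_right _ (by omega)))
      _ = Nat.factorial I.numSteps * (8 * N ^ 3) := by ring
      _ ≤ _ := Nat.mul_le_mul_right _ (Nat.factorial_le_pow _)
  refine (Nat.mul_le_mul I.length_summary_le h₁).trans (le_of_eq ?_)
  unfold timeFactor
  ring

end CCWS

namespace Exp

variable {I : CCWS} {κ N : ℕ}

/-! ### The decision programs -/

/-- The vertices of the workflow `var 0`. -/
def vertsE : Exp := bindE (.var 0) (.ite (.isPair (.var 0)) (.pair (.var 0) (.const 0)) (.const 0))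

theorem ev_vertsE {O : Val → ℕ} {k m : ℕ} (hN : 1000 ≤ N) (G : Workflow (Fin k) (Fin m))
    (hG : G.code.length ≤ N) (ρ : Val) :
    Ev O κ vertsE (.pair (.ofList G.code) ρ) (.ofList (G.vertices.map encV)) (N ^ 2) := by
  have e := Ev.bindConst (O := O) (κ := κ) (id : Val → Val) (id : Val → Val)
    (fun t => if t.isPair ≠ 0 then [t] else []) (T := 20) (xs := G.code)
    (l := .var 0) (v := .pair (.ofList G.code) ρ) (s := 1) (by
      rw [List.map_id]
      exact Ev.var 0 _)
    (b := .ite (.isPair (.var 0)) (.pair (.var 0) (.const 0)) (.const 0)) (fun t _ => by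
      rcases t with n | ⟨a, b⟩
      · exact (Ev.iteFalse (r := 3) ⟨rfl, le_rfl⟩ (Ev.const 0 _)).mono (by omega)
      · exact (Ev.iteTrue (n := 1) (r := 3) (s := 3) ⟨rfl, le_rfl⟩ one_ne_zero
          ⟨rfl, le_rfl⟩).mono (by omega))
  rw [List.map_id, flatMap_code, List.length_map] at e
  refine Ev.mono e ?_
  have := G.length_vertices_le
  nlinarith

/-- The number of entries of the list `var 0`. -/
def lengthE : Exp := .fold (.var 0) (.const 0) (.add (.var 1) (.const 1))

theorem ev_lengthE {O : Val → ℕ} {α : Type*} (f : α → Val) (xs : List α) (ρ : Val) {D : ℕ}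
    (hD : Nat.size xs.length ≤ D) :
    Ev O κ lengthE (.pair (.ofList (xs.map f)) ρ) (.nat xs.length) (20 + xs.length * (30 + D)) := by
  have e := Ev.foldRem (O := O) (κ := κ) f Val.nat (fun n _ => n + 1)
    (fun rest n => n + rest.length = xs.length) (T := 10 + D) (b₀ := 0)
    (Ev.var 0 (.pair (.ofList (xs.map f)) ρ)) (i := .const 0) (Ev.const 0 _) (by simp)
    (b := .add (.var 1) (.const 1)) (fun x _ rest n hn => by
      rw [List.length_cons] at hn
      have : Nat.size n ≤ Nat.size xs.length := Nat.size_le_size (by omega)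
      refine ⟨((Ev.var 1 (.pair (f x) (.pair (.nat n) (.pair (.ofList (xs.map f)) ρ)))).add
        (Ev.const 1 _) (x := n)).mono ?_, by omega⟩
      rw [Nat.size_one]
      omega)
  have h : ∀ n : ℕ, xs.foldl (fun n _ => n + 1) n = n + xs.length := by
    clear e hD
    induction xs with
    | nil => simp
    | cons x xs ih =>
      intro n
      rw [List.foldl_cons, ih, List.length_cons]
      omega
  rw [h, zero_add] at e
  refine Ev.mono e ?_
  have := Nat.mul_le_mul_left xs.length (show 18 + (10 + D) ≤ 30 + D by omega)
  omega

/-- The summary of the schema that is the environment. -/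
def summaryE : Exp :=
  mapE (.app groupsE (.pair seqsE (.pair vertsE (.const 0))))
    (.pair (.app lengthE (.pair (.var 0) (.const 0)))
      (.app wstarE (.pair (.snd (.fst (.var 0))) (.pair (.var 2) (.pair (.var 4) (.const 0))))))

/-- The encoding of a pair of numbers. -/
def encNN (x : ℕ × ℕ) : Val := .pair (.nat x.1) (.nat x.2)

/-- Listing and grouping the sequences takes time linear in their number, and a minimum cost is
computed only for one sequence in each group. -/
theorem ev_summaryE (h : I.Fits κ N) :
    Ev I.weightOracle κ summaryE I.code (.ofList (I.summary.map encNN))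
      (I.timeFactor * N ^ 15) := by
  have hN := h.large
  have hkm := h.steps_add_releases
  have hk : I.numSteps ≤ N := by omega
  have hm : I.numReleases ≤ N := by omega
  have hvs := I.schema.workflow.length_vertices_le.trans h.workflow
  have hnd : ∀ σ ∈ I.schema.workflow.seqs, σ.Nodup := fun σ hσ =>
    I.schema.nodup_of_mem_execSeqs (I.mem_execSeqs_iff.mpr hσ)
  rw [I.code_eq]
  set ρ := Val.pair (encUs (List.finRange I.numUsers)) (.pair (codeAuth I.schema.auth)
      (.pair (.ofList (I.schema.constraints.map encC)) (.nat 0))) with hρ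
  set v := Val.pair (.ofList I.schema.workflow.code) ρ with hv
  have hTF1 : 1 ≤ I.timeFactor := I.one_le_timeFactor
  have e₁ := ev_seqsE (O := I.weightOracle) (κ := κ) I.schema.workflow ρ hN h.workflow
    I.length_seqs_le_timeFactor
  have e₂ := ev_vertsE (O := I.weightOracle) (κ := κ) hN I.schema.workflow h.workflow ρ
  have e₃ := (e₁.pair (e₂.pair (Ev.const 0 v))).app
    (ev_groupsE hN hk hm I.schema.workflow.seqs I.schema.workflow.seqs_ne_nil
      I.schema.workflow.vertices
      (fun σ hσ => ⟨hnd σ hσ, Workflow.length_le_of_mem_seqs hσ⟩) I.length_seqs_le_timeFactor hvs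
      (.nat 0))
  set gs := groups I.schema.workflow.seqs I.schema.workflow.vertices with hgs
  have hlen : ∀ g ∈ gs, Nat.size g.length ≤ 2 * N ^ 2 := fun g hg => by
    refine le_trans (Nat.size_le_size ?_) h.size_card_le
    have h₁ := I.sum_summary fun _ => 1
    simp only [mul_one, Finset.sum_const, smul_eq_mul] at h₁
    rw [← h₁]
    refine List.single_le_sum (by simp) _ (List.mem_map.mpr ⟨_, List.mem_map_of_mem hg, rfl⟩)
  -- a group is replaced by its size and the minimum cost of its first member
  have e₄ := Ev.map (O := I.weightOracle) (κ := κ)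
    (fun g : List (List ℕ × List (Fin I.numSteps ⊕ Fin I.numReleases)) =>
      Val.ofList (g.map (encItem encSeq))) encNN
    (fun g => (g.length, I.schema.minCost (g.headD ([], [])).2))
    (T := fun g => g.length * (30 + 2 * N ^ 2) + (Nat.factorial (I.numSteps + 3) * N ^ 10 + 100)) e₃
    (fun g hg => by
      set w := Val.pair (.ofList (g.map (encItem encSeq))) v with hw
      obtain ⟨it, g', rfl⟩ := List.exists_cons_of_ne_nil (I.isGrouping.ne_nil g hg)
      have hit := I.isGrouping.mem _ hg it (by simp)
      have f₁ := ((Ev.var 0 w).pair (Ev.const 0 w)).app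
        (ev_lengthE (O := I.weightOracle) (κ := κ) (encItem encSeq) (it :: g') (.nat 0)
          (hlen _ hg))
      have f₂ : Ev I.weightOracle κ (.pair (.snd (.fst (.var 0))) (.pair (.var 2)
          (.pair (.var 4) (.const 0)))) w (.pair (encSeq it.2)
            (.pair (encUs (List.finRange I.numUsers))
              (.pair (.ofList (I.schema.constraints.map encC)) (.nat 0)))) 40 :=
        ⟨rfl, by simp [time]⟩
      have f₃ := f₂.app (ev_wstarE I hN hk hm h.users h.call h.bits h.constraints it.2
        (hnd _ hit) ((Workflow.length_le_of_mem_seqs hit).trans hvs) (.nat 0))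
      exact (f₁.pair f₃).mono (by omega))
  refine Ev.mono e₄ ?_
  have h₁ : (gs.map fun g => g.length * (30 + 2 * N ^ 2) +
      (Nat.factorial (I.numSteps + 3) * N ^ 10 + 100) + 120).sum =
      I.schema.workflow.seqs.length * (30 + 2 * N ^ 2) +
        I.summary.length * (Nat.factorial (I.numSteps + 3) * N ^ 10 + 220) := by
    rw [← I.isGrouping.sum_length, CCWS.summary, List.length_map, ← hgs]
    generalize gs = gs
    induction gs with
    | nil => simp
    | cons g gs ih =>
      rw [List.map_cons, List.sum_cons, ih, List.map_cons, List.sum_cons, List.length_cons]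
      ring
  have h₂ := Nat.mul_le_mul_right (30 + 2 * N ^ 2) I.length_seqs_le_timeFactor
  have h₃ : I.summary.length * (Nat.factorial (I.numSteps + 3) * N ^ 10 + 220) ≤
      I.timeFactor * (8 * N ^ 3) * (N ^ 10 + 220) := by
    refine le_trans ?_ (Nat.mul_le_mul_right _ h.length_summary_mul_le)
    rw [mul_assoc]
    refine Nat.mul_le_mul_left _ ?_
    have := Nat.factorial_pos (I.numSteps + 3)
    nlinarith
  have p : ∀ a : ℕ, 1000 * N ^ a ≤ N ^ (a + 1) := fun a => by
    rw [pow_succ, mul_comm]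
    exact Nat.mul_le_mul_left _ hN
  have p2 : 1000 * N ^ 2 ≤ N ^ 3 := p 2
  have p3 : 1000 * N ^ 3 ≤ N ^ 4 := p 3
  have p4 : 1000 * N ^ 4 ≤ N ^ 5 := p 4
  have p5 : 1000 * N ^ 5 ≤ N ^ 6 := p 5
  have p6 : 1000 * N ^ 6 ≤ N ^ 7 := p 6
  have p7 : 1000 * N ^ 7 ≤ N ^ 8 := p 7
  have p8 : 1000 * N ^ 8 ≤ N ^ 9 := p 8
  have p9 : 1000 * N ^ 9 ≤ N ^ 10 := p 9
  have p10 : 1000 * N ^ 10 ≤ N ^ 11 := p 10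
  have p11 : 1000 * N ^ 11 ≤ N ^ 12 := p 11
  have p12 : 1000 * N ^ 12 ≤ N ^ 13 := p 12
  have p13 : 1000 * N ^ 13 ≤ N ^ 14 := p 13
  have p14 : 1000 * N ^ 14 ≤ N ^ 15 := p 14
  have p15 : 1 ≤ N ^ 2 := Nat.one_le_pow _ _ (by omega)
  have h₄ : 2 * N ^ 5 + 2 * N ^ 6 + N ^ 2 + (30 + 2 * N ^ 2) + 8 * N ^ 3 * (N ^ 10 + 220) + 100 ≤
      N ^ 15 := by
    have : 8 * N ^ 3 * (N ^ 10 + 220) = 8 * N ^ 13 + 1760 * N ^ 3 := by ring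
    omega
  have h₅ := Nat.mul_le_mul_left I.timeFactor h₄
  have h₆ : N ^ 2 + 100 ≤ I.timeFactor * (N ^ 2 + 100) := Nat.le_mul_of_pos_left _ hTF1
  have h₇ : (I.timeFactor + 1) * N ^ 5 ≤ I.timeFactor * (2 * N ^ 5) := by
    nlinarith [Nat.zero_le (N ^ 5)]
  have h₈ : (I.timeFactor + 1) * N ^ 6 ≤ I.timeFactor * (2 * N ^ 6) := by
    nlinarith [Nat.zero_le (N ^ 6)]
  rw [h₁]
  rw [mul_assoc] at h₃
  simp only [mul_add] at h₅ h₆ h₂ h₃ ⊢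
  omega

/-- The two totals over the summary of the schema `var 0`. -/
def totalsE (b : Exp) : Exp := .fold (.app summaryE (.var 0)) (.pair (.const 0) (.const 0)) b

/-- A fold over the summary computes a sum over all execution sequences, and their number. -/
theorem ev_totalsE (h : I.Fits κ N) (F : ℕ → ℕ)
    (hF : Nat.size (∑ σ ∈ I.schema.execSeqs, F (I.schema.minCost σ)) ≤ 2 * N ^ 2) {b : Exp}
    (x : Val) (hb : ∀ y acc : ℕ × ℕ, Nat.size y.1 ≤ 2 * N ^ 2 → Nat.size y.2 ≤ 3 * N →
      Nat.size acc.1 ≤ 2 * N ^ 2 → Nat.size acc.2 ≤ 2 * N ^ 2 →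
      Ev I.weightOracle κ b (.pair (encNN y) (.pair (encNN acc) (.pair I.code x)))
        (encNN (acc.1 + y.1 * F y.2, acc.2 + y.1)) (N ^ 4)) :
    Ev I.weightOracle κ (totalsE b) (.pair I.code x)
      (encNN (∑ σ ∈ I.schema.execSeqs, F (I.schema.minCost σ), I.schema.execSeqs.card))
      (I.timeFactor * N ^ 16) := by
  have hcard := I.sum_summary fun _ => 1
  simp only [mul_one, Finset.sum_const, smul_eq_mul] at hcard
  have hsum := I.sum_summary F
  have e := Ev.foldRem (O := I.weightOracle) (κ := κ) encNN encNN
    (fun acc y => (acc.1 + y.1 * F y.2, acc.2 + y.1))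
    (fun rest acc => (∀ y ∈ rest, Nat.size y.1 ≤ 2 * N ^ 2 ∧ Nat.size y.2 ≤ 3 * N) ∧
      acc.1 + (rest.map fun y => y.1 * F y.2).sum = (I.summary.map fun y => y.1 * F y.2).sum ∧
      acc.2 + (rest.map fun y => y.1).sum = (I.summary.map fun y => y.1).sum) (b₀ := (0, 0))
    ((Ev.var 0 (.pair I.code x)).app (ev_summaryE h)) (i := .pair (.const 0) (.const 0)) (t := 3)
    ⟨rfl, le_rfl⟩ ⟨fun y hy => ⟨?_, ?_⟩, by simp, by simp⟩ (T := N ^ 4) (b := b) ?_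
  · have h₁ : ∀ (L : List (ℕ × ℕ)) (acc : ℕ × ℕ),
        L.foldl (fun acc y => (acc.1 + y.1 * F y.2, acc.2 + y.1)) acc =
          (acc.1 + (L.map fun y => y.1 * F y.2).sum, acc.2 + (L.map fun y => y.1).sum) := by
      intro L
      induction L with
      | nil => simp
      | cons y L ih =>
        intro acc
        rw [List.foldl_cons, ih]
        simp only [List.map_cons, List.sum_cons, Prod.mk.injEq]
        omega
    rw [h₁, zero_add, zero_add, hsum, hcard] at e
    refine Ev.mono e ?_
    have hN := h.large
    have hTF1 := I.one_le_timeFactor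
    have h₂ := h.length_summary_mul_le
    have h₃ : I.summary.length ≤ I.timeFactor * (8 * N ^ 3) :=
      (Nat.le_mul_of_pos_right _ (Nat.factorial_pos _)).trans h₂
    have h₄ := Nat.mul_le_mul_right (18 + N ^ 4) h₃
    have p : ∀ a : ℕ, 1000 * N ^ a ≤ N ^ (a + 1) := fun a => by
      rw [pow_succ, mul_comm]
      exact Nat.mul_le_mul_left _ hN
    have h₅ : 8 * N ^ 3 * (18 + N ^ 4) + 100 + N ^ 15 ≤ N ^ 16 := by
      have : 1000 * N ^ 3 ≤ N ^ 4 := p 3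
      have : 1000 * N ^ 4 ≤ N ^ 5 := p 4
      have : 1000 * N ^ 5 ≤ N ^ 6 := p 5
      have : 1000 * N ^ 6 ≤ N ^ 7 := p 6
      have : 1000 * N ^ 7 ≤ N ^ 8 := p 7
      have : 1000 * N ^ 15 ≤ N ^ 16 := p 15
      have h₆ : N ^ 8 ≤ N ^ 15 := Nat.pow_le_pow_right (by omega) (by omega)
      have h₇ : 8 * N ^ 3 * (18 + N ^ 4) = 144 * N ^ 3 + 8 * N ^ 7 := by ring
      have : 1 ≤ N ^ 3 := Nat.one_le_pow _ _ (by omega)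
      omega
    have h₈ := Nat.mul_le_mul_left I.timeFactor h₅
    rw [mul_assoc] at h₄
    simp only [mul_add] at h₈ h₄ ⊢
    omega
  · refine le_trans (Nat.size_le_size ?_) h.size_card_le
    rw [← hcard]
    exact List.single_le_sum (by simp) _ (List.mem_map.mpr ⟨y, hy, rfl⟩)
  · obtain ⟨g, _, rfl⟩ := List.mem_map.mp hy
    exact h.size_minCost_le
  · rintro y _ rest acc ⟨h₁, h₂, h₃⟩
    rw [List.map_cons, List.sum_cons] at h₂ h₃
    obtain ⟨h₄, h₅⟩ := h₁ y (by simp)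
    refine ⟨hb y acc h₄ h₅ (le_trans (Nat.size_le_size ?_) hF)
      (le_trans (Nat.size_le_size ?_) h.size_card_le), fun z hz => h₁ z (by simp [hz]), ?_, ?_⟩
    · rw [← hsum]
      omega
    · rw [← hcard]
      omega
    · simp only
      omega
    · simp only
      omega

/-- The decision program for Bounded Expected Cost WSP. -/
def becE : Exp :=
  .app (.le (.mul (.fst (.var 0)) (.snd (.snd .env))) (.mul (.fst (.snd .env)) (.snd (.var 0))))
    (.pair (totalsE (.pair (.add (.fst (.var 1)) (.mul (.fst (.var 0)) (.snd (.var 0))))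
      (.add (.snd (.var 1)) (.fst (.var 0))))) (.snd .env))

/-- The budget is `a / b`; the comparison `∑ w / n ≤ a / b` is made without division. -/
theorem ev_becE (h : I.Fits κ N) {a b : ℕ} (ha : Nat.size a ≤ N) (hb : Nat.size b ≤ N) :
    Ev I.weightOracle κ becE (.pair I.code (.pair (.nat a) (.nat b)))
      (.nat (if (∑ σ ∈ I.schema.execSeqs, I.schema.minCost σ) * b ≤ a * I.schema.execSeqs.card
        then 1 else 0)) (I.timeFactor * N ^ 17) := by
  have hN := h.large
  have hTF1 := I.one_le_timeFactor
  set x := Val.pair (.nat a) (.nat b)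
  have p : ∀ a : ℕ, 1000 * N ^ a ≤ N ^ (a + 1) := fun a => by
    rw [pow_succ, mul_comm]
    exact Nat.mul_le_mul_left _ hN
  have p1 : 1000 * N ^ 1 ≤ N ^ 2 := p 1
  have p2 : 1000 * N ^ 2 ≤ N ^ 3 := p 2
  have p3 : 1000 * N ^ 3 ≤ N ^ 4 := p 3
  rw [pow_one] at p1
  have e₁ := ev_totalsE h (fun w => w) h.size_sum_minCost_le x
    (b := .pair (.add (.fst (.var 1)) (.mul (.fst (.var 0)) (.snd (.var 0))))
      (.add (.snd (.var 1)) (.fst (.var 0)))) (fun y acc hy₁ hy₂ hacc₁ hacc₂ => by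
      set w := Val.pair (encNN y) (.pair (encNN acc) (.pair I.code x))
      have f₁ : Ev I.weightOracle κ (.fst (.var 0)) w (.nat y.1) 3 := ⟨rfl, le_rfl⟩
      have f₂ : Ev I.weightOracle κ (.snd (.var 0)) w (.nat y.2) 3 := ⟨rfl, le_rfl⟩
      have f₃ : Ev I.weightOracle κ (.fst (.var 1)) w (.nat acc.1) 5 := ⟨rfl, le_rfl⟩
      have f₄ : Ev I.weightOracle κ (.snd (.var 1)) w (.nat acc.2) 5 := ⟨rfl, le_rfl⟩
      refine ((f₃.add (f₁.mul f₂)).pair (f₄.add f₁)).mono ?_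
      have h₁ := Nat.mul_le_mul hy₁ hy₂
      have h₂ : Nat.size (y.1 * y.2) ≤ 2 * N ^ 2 + 3 * N := by
        rw [Nat.size_le, pow_add]
        exact Nat.mul_lt_mul'' (Nat.size_le.mp hy₁) (Nat.size_le.mp hy₂)
      have h₃ : 2 * N ^ 2 * (3 * N) = 6 * N ^ 3 := by ring
      omega)
  set s := ∑ σ ∈ I.schema.execSeqs, I.schema.minCost σ with hs
  set n := I.schema.execSeqs.card with hn
  have e₂ : Ev I.weightOracle κ (.snd .env) (.pair I.code x) x 3 := ⟨rfl, le_rfl⟩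
  set w := Val.pair (encNN (s, n)) x
  have f₁ : Ev I.weightOracle κ (.fst (.var 0)) w (.nat s) 3 := ⟨rfl, le_rfl⟩
  have f₂ : Ev I.weightOracle κ (.snd (.var 0)) w (.nat n) 3 := ⟨rfl, le_rfl⟩
  have f₃ : Ev I.weightOracle κ (.fst (.snd .env)) w (.nat a) 5 := ⟨rfl, le_rfl⟩
  have f₄ : Ev I.weightOracle κ (.snd (.snd .env)) w (.nat b) 5 := ⟨rfl, le_rfl⟩
  refine ((e₁.pair e₂).app ((f₁.mul f₄).le (f₃.mul f₂))).mono ?_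
  have hs' : Nat.size s ≤ 2 * N ^ 2 := h.size_sum_minCost_le
  have hn' : Nat.size n ≤ 2 * N ^ 2 := h.size_card_le
  have h₁ := Nat.mul_le_mul hs' hb
  have h₂ := Nat.mul_le_mul ha hn'
  have h₃ : Nat.size (s * b) ≤ 2 * N ^ 2 + N := by
    rw [Nat.size_le, pow_add]
    exact Nat.mul_lt_mul'' (Nat.size_le.mp hs') (Nat.size_le.mp hb)
  have h₄ : Nat.size (a * n) ≤ 2 * N ^ 2 + N := by
    rw [Nat.size_le, pow_add, mul_comm]
    exact Nat.mul_lt_mul'' (Nat.size_le.mp hn') (Nat.size_le.mp ha)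
  have h₅ : 2 * N ^ 2 * N = 2 * N ^ 3 := by ring
  have h₆ : N * (2 * N ^ 2) = 2 * N ^ 3 := by ring
  have h₇ : N ^ 4 ≤ N ^ 16 := Nat.pow_le_pow_right (by omega) (by omega)
  have h₈ : N ^ 16 ≤ I.timeFactor * N ^ 16 := Nat.le_mul_of_pos_left _ hTF1
  have h₉ : 1000 * (I.timeFactor * N ^ 16) ≤ I.timeFactor * N ^ 17 := by
    rw [← mul_assoc, mul_comm 1000, mul_assoc]
    exact Nat.mul_le_mul_left _ (p 16)
  omega

/-- The decision program for Approximate BC-WSP. -/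
def approxE : Exp :=
  .app (.le (.mul (.fst (.snd (.snd .env))) (.snd (.var 0)))
      (.mul (.fst (.var 0)) (.snd (.snd (.snd .env)))))
    (.pair (totalsE (.pair
      (.add (.fst (.var 1)) (.mul (.fst (.var 0))
        (.le (.mul (.snd (.var 0)) (.snd (.fst (.snd (.snd (.snd .env))))))
          (.fst (.fst (.snd (.snd (.snd .env))))))))
      (.add (.snd (.var 1)) (.fst (.var 0))))) (.snd .env))

/-- The budget is `a / b` and the threshold is `c / d`; the comparisons are made without division.
-/
theorem ev_approxE (h : I.Fits κ N) {a b c d : ℕ} (ha : Nat.size a ≤ N) (hb : Nat.size b ≤ N)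
    (hc : Nat.size c ≤ N) (hd : Nat.size d ≤ N) :
    Ev I.weightOracle κ approxE (.pair I.code (.pair (.pair (.nat a) (.nat b))
        (.pair (.nat c) (.nat d))))
      (.nat (if c * I.schema.execSeqs.card ≤
        (∑ σ ∈ I.schema.execSeqs, if I.schema.minCost σ * b ≤ a then 1 else 0) * d
        then 1 else 0)) (I.timeFactor * N ^ 17) := by
  have hN := h.large
  have hTF1 := I.one_le_timeFactor
  set x := Val.pair (.pair (.nat a) (.nat b)) (.pair (.nat c) (.nat d))
  have p : ∀ a : ℕ, 1000 * N ^ a ≤ N ^ (a + 1) := fun a => by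
    rw [pow_succ, mul_comm]
    exact Nat.mul_le_mul_left _ hN
  have p1 : 1000 * N ^ 1 ≤ N ^ 2 := p 1
  have p2 : 1000 * N ^ 2 ≤ N ^ 3 := p 2
  have p3 : 1000 * N ^ 3 ≤ N ^ 4 := p 3
  rw [pow_one] at p1
  have hs' : Nat.size (∑ σ ∈ I.schema.execSeqs, if I.schema.minCost σ * b ≤ a then 1 else 0) ≤
      2 * N ^ 2 := by
    refine le_trans (Nat.size_le_size ?_) h.size_card_le
    rw [← Finset.card_filter]
    exact Finset.card_filter_le _ _
  have e₁ := ev_totalsE h (fun w => if w * b ≤ a then 1 else 0) hs' x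
    (b := .pair
      (.add (.fst (.var 1)) (.mul (.fst (.var 0))
        (.le (.mul (.snd (.var 0)) (.snd (.fst (.snd (.snd (.snd .env))))))
          (.fst (.fst (.snd (.snd (.snd .env))))))))
      (.add (.snd (.var 1)) (.fst (.var 0)))) (fun y acc hy₁ hy₂ hacc₁ hacc₂ => by
      set w := Val.pair (encNN y) (.pair (encNN acc) (.pair I.code x))
      have f₁ : Ev I.weightOracle κ (.fst (.var 0)) w (.nat y.1) 3 := ⟨rfl, le_rfl⟩
      have f₂ : Ev I.weightOracle κ (.snd (.var 0)) w (.nat y.2) 3 := ⟨rfl, le_rfl⟩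
      have f₃ : Ev I.weightOracle κ (.fst (.var 1)) w (.nat acc.1) 5 := ⟨rfl, le_rfl⟩
      have f₄ : Ev I.weightOracle κ (.snd (.var 1)) w (.nat acc.2) 5 := ⟨rfl, le_rfl⟩
      have f₅ : Ev I.weightOracle κ (.snd (.fst (.snd (.snd (.snd .env))))) w (.nat b) 11 :=
        ⟨rfl, le_rfl⟩
      have f₆ : Ev I.weightOracle κ (.fst (.fst (.snd (.snd (.snd .env))))) w (.nat a) 11 :=
        ⟨rfl, le_rfl⟩
      refine ((f₃.add (f₁.mul ((f₂.mul f₅).le f₆))).pair (f₄.add f₁)).mono ?_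
      have h₀ : Nat.size (if y.2 * b ≤ a then 1 else 0) ≤ 1 := by
        split_ifs <;> simp
      have h₁ := Nat.mul_le_mul hy₁ h₀
      have h₂ : Nat.size (y.1 * if y.2 * b ≤ a then 1 else 0) ≤ 2 * N ^ 2 := by
        refine le_trans (Nat.size_le_size ?_) hy₁
        split_ifs <;> simp
      have h₃ := Nat.mul_le_mul hy₂ hb
      have h₄ : Nat.size (y.2 * b) ≤ 3 * N + N := by
        rw [Nat.size_le, pow_add]
        exact Nat.mul_lt_mul'' (Nat.size_le.mp hy₂) (Nat.size_le.mp hb)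
      have h₅ : 3 * N * N = 3 * N ^ 2 := by ring
      omega)
  set s := ∑ σ ∈ I.schema.execSeqs, if I.schema.minCost σ * b ≤ a then 1 else 0 with hs
  set n := I.schema.execSeqs.card with hn
  have e₂ : Ev I.weightOracle κ (.snd .env) (.pair I.code x) x 3 := ⟨rfl, le_rfl⟩
  set w := Val.pair (encNN (s, n)) x
  have f₁ : Ev I.weightOracle κ (.fst (.var 0)) w (.nat s) 3 := ⟨rfl, le_rfl⟩
  have f₂ : Ev I.weightOracle κ (.snd (.var 0)) w (.nat n) 3 := ⟨rfl, le_rfl⟩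
  have f₃ : Ev I.weightOracle κ (.fst (.snd (.snd .env))) w (.nat c) 7 := ⟨rfl, le_rfl⟩
  have f₄ : Ev I.weightOracle κ (.snd (.snd (.snd .env))) w (.nat d) 7 := ⟨rfl, le_rfl⟩
  refine ((e₁.pair e₂).app ((f₃.mul f₂).le (f₁.mul f₄))).mono ?_
  have hn' : Nat.size n ≤ 2 * N ^ 2 := h.size_card_le
  have h₁ := Nat.mul_le_mul hs' hd
  have h₂ := Nat.mul_le_mul hc hn'
  have h₃ : Nat.size (s * d) ≤ 2 * N ^ 2 + N := by
    rw [Nat.size_le, pow_add]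
    exact Nat.mul_lt_mul'' (Nat.size_le.mp hs') (Nat.size_le.mp hd)
  have h₄ : Nat.size (c * n) ≤ 2 * N ^ 2 + N := by
    rw [Nat.size_le, pow_add, mul_comm]
    exact Nat.mul_lt_mul'' (Nat.size_le.mp hn') (Nat.size_le.mp hc)
  have h₅ : 2 * N ^ 2 * N = 2 * N ^ 3 := by ring
  have h₆ : N * (2 * N ^ 2) = 2 * N ^ 3 := by ring
  have h₇ : N ^ 4 ≤ N ^ 16 := Nat.pow_le_pow_right (by omega) (by omega)
  have h₈ : N ^ 16 ≤ I.timeFactor * N ^ 16 := Nat.le_mul_of_pos_left _ hTF1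
  have h₉ : 1000 * (I.timeFactor * N ^ 16) ≤ I.timeFactor * N ^ 17 := by
    rw [← mul_assoc, mul_comm 1000, mul_assoc]
    exact Nat.mul_le_mul_left _ (p 16)
  omega

end Exp

/-! ### Running times of the decision problems -/

/-- A program with a suitable running time bound solves a decision problem. -/
theorem DecisionProblem.solvableInOStar_of_ev (D : DecisionProblem) (e : Exp) (d : ℕ)
    (h : ∀ (I : CCWS) (x : D.Input) (κ N : ℕ), I.Fits κ N → (D.codeInstance I x).size ≤ N →
      ∃ b : Bool, Exp.Ev I.weightOracle κ e (D.codeInstance I x) (.nat b.toNat)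
        (I.timeFactor * N ^ d) ∧ (b = true ↔ D.IsYes I x)) :
    D.SolvableInOStar CCWS.timeFactor := by
  refine ⟨Exp.compile e, fun q => ⟨(Polynomial.X + q + Polynomial.C 1000) ^ d, fun I x hq => ?_⟩⟩
  set n := (D.codeInstance I x).size with hn
  have hcode : I.code.size ≤ n := by
    simp only [hn, DecisionProblem.codeInstance, Val.size]
    omega
  obtain ⟨b, ⟨h₁, h₂⟩, h₃⟩ := h I x (q.eval n) (n + q.eval n + 1000)
    (I.fits hq (by omega)) (by omega)
  refine ⟨b, _, h₁ ▸ Exp.run_compile I.weightOracle (q.eval n) e _, h₃, h₂.trans (le_of_eq ?_)⟩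
  simp

theorem DecisionProblem.SolvableInOStar.mono {D : DecisionProblem} {T T' : CCWS → ℕ}
    (h : D.SolvableInOStar T) (hT : ∀ I, T I ≤ T' I) : D.SolvableInOStar T' := by
  obtain ⟨P, hP⟩ := h
  refine ⟨P, fun q => ?_⟩
  obtain ⟨p, hp⟩ := hP q
  refine ⟨p, fun I x hq => ?_⟩
  obtain ⟨b, t, h₁, h₂, h₃⟩ := hp I x hq
  exact ⟨b, t, h₁, h₂, h₃.trans (Nat.mul_le_mul_right _ (hT I))⟩

theorem CCWS.execSeqs_card_pos (I : CCWS) : 0 < I.schema.execSeqs.card :=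
  Finset.card_pos.mpr I.schema.workflow.execSeqs_nonempty

theorem toNat_decide (P : Prop) [Decidable P] : (decide P).toNat = if P then 1 else 0 := by
  by_cases h : P <;> simp [h]

theorem becWSP_solvable : becWSP.SolvableInOStar CCWS.timeFactor := by
  refine becWSP.solvableInOStar_of_ev Exp.becE 17 fun I B κ N hfit hsize => ?_
  change NNRat at B
  change (Val.pair I.code (.pair (.nat B.num) (.nat B.den))).size ≤ N at hsize
  simp only [Val.size] at hsize
  refine ⟨decide ((∑ σ ∈ I.schema.execSeqs, I.schema.minCost σ) * B.den ≤
    B.num * I.schema.execSeqs.card), ?_, ?_⟩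
  · have e := Exp.ev_becE hfit (a := B.num) (b := B.den) (by omega) (by omega)
    rw [toNat_decide]
    exact e
  · change _ ↔ I.schema.BoundedExpectedCost I.schema.uniformFreq (B : ℝ)
    have hcard : (0 : ℝ) < I.schema.execSeqs.card := by exact_mod_cast I.execSeqs_card_pos
    have hden : (0 : ℝ) < B.den := by exact_mod_cast B.den_pos
    rw [decide_eq_true_eq, I.schema.boundedExpectedCost_iff, NNRat.cast_def,
      div_le_div_iff₀ hcard hden]
    exact_mod_cast Iff.rfl

theorem approxBCWSP_solvable : approxBCWSP.SolvableInOStar CCWS.timeFactor := by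
  refine approxBCWSP.solvableInOStar_of_ev Exp.approxE 17 fun I x κ N hfit hsize => ?_
  obtain ⟨B, p, hp⟩ : NNRat × {p : NNRat // p ≤ 1} := x
  change (Val.pair I.code (.pair (.pair (.nat B.num) (.nat B.den))
    (.pair (.nat p.num) (.nat p.den)))).size ≤ N at hsize
  simp only [Val.size] at hsize
  refine ⟨decide (p.num * I.schema.execSeqs.card ≤
    (∑ σ ∈ I.schema.execSeqs, if I.schema.minCost σ * B.den ≤ B.num then 1 else 0) * p.den),
    ?_, ?_⟩
  · have e := Exp.ev_approxE hfit (a := B.num) (b := B.den) (c := p.num) (d := p.den) (by omega)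
      (by omega) (by omega) (by omega)
    rw [toNat_decide]
    exact e
  · change _ ↔ I.schema.CompletesWithinBudget I.schema.uniformFreq (B : ℝ) (p : ℝ)
    have hcard : (0 : ℝ) < I.schema.execSeqs.card := by exact_mod_cast I.execSeqs_card_pos
    have hden : (0 : ℝ) < p.den := by exact_mod_cast p.den_pos
    have hfilter : (I.schema.execSeqs.filter fun σ => (I.schema.minCost σ : ℝ) ≤ (B : ℝ)) =
        I.schema.execSeqs.filter fun σ => I.schema.minCost σ * B.den ≤ B.num := by
      refine Finset.filter_congr fun σ _ => ?_
      have hBden : (0 : ℝ) < B.den := by exact_mod_cast B.den_pos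
      rw [NNRat.cast_def, le_div_iff₀ hBden]
      exact_mod_cast Iff.rfl
    rw [decide_eq_true_eq, I.schema.completesWithinBudget_iff, hfilter, ← Finset.card_filter,
      NNRat.cast_def, div_le_div_iff₀ hden hcard]
    exact_mod_cast Iff.rfl

/-- The running time bound is bounded by a computable function of the parameter. -/
theorem CCWS.timeFactor_le (I : CCWS) : I.timeFactor ≤ (I.parameter + 2) ^ (4 * I.parameter) := by
  have hx : I.numXor ≤ I.parameter := by unfold parameter; omega
  have hm : I.numReleases ≤ I.parameter := by unfold parameter; omega
  have hk : I.numSteps ≤ I.parameter := by unfold parameter; omega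
  generalize I.parameter = n at hx hm hk ⊢
  have key : ∀ a b : ℕ, a ≤ n + 2 → b ≤ n → a ^ b ≤ (n + 2) ^ n := fun a b ha hb =>
    (Nat.pow_le_pow_left ha b).trans (Nat.pow_le_pow_right (by omega) hb)
  unfold timeFactor
  calc _ ≤ (n + 2) ^ n * (n + 2) ^ n * (n + 2) ^ n * (n + 2) ^ n :=
        Nat.mul_le_mul (Nat.mul_le_mul (Nat.mul_le_mul (key _ _ (by omega) hx)
          ((Nat.factorial_le_pow _).trans (key _ _ (by omega) hm))) (key _ _ (by omega) hk))
          (key _ _ (by omega) hk)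
    _ = _ := by ring

theorem computable_pow : Computable fun n : ℕ => (n + 2) ^ (4 * n) := by
  have hpow : Primrec₂ fun a b : ℕ => a ^ b := by
    refine (Primrec.nat_rec' (f := fun x : ℕ × ℕ => x.2) (g := fun _ => 1)
      (h := fun x y => y.2 * x.1) Primrec.snd (Primrec.const 1) ?_).of_eq fun x => ?_
    · exact Primrec.nat_mul.comp (Primrec.snd.comp Primrec.snd) (Primrec.fst.comp Primrec.fst)
    · induction x.2 with
      | zero => rfl
      | succ n ih => exact (congrArg (· * x.1) ih).trans (pow_succ x.1 n).symm
  exact (hpow.comp (Primrec.nat_add.comp Primrec.id (Primrec.const 2))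
    (Primrec.nat_mul.comp (Primrec.const 4) Primrec.id)).to_comp

/-- With `T(n) = (n + 2) ^ (4 n)`, an `𝒪*` bound by `timeFactor` gives fixed-parameter tractability.
-/
theorem DecisionProblem.SolvableInOStar.isFPT {D : DecisionProblem}
    (h : D.SolvableInOStar CCWS.timeFactor) : D.IsFPT CCWS.parameter :=
  ⟨_, computable_pow, h.mono CCWS.timeFactor_le⟩

end WSP

theorem mainTheorem2 :
    (∀ (S R U : Type*) [Fintype S] [Fintype R] [Fintype U]
        [DecidableEq S] [DecidableEq R] [DecidableEq U] (W : WSP.Schema S R U),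
      ∃ wstar : Finset (List (S ⊕ R)) → ℕ,
        (∀ X ∈ W.arrangements, ∀ σ ∈ X,
          IsLeast {w : ℕ | ∃ π : WSP.Plan S U, WSP.IsPlanFor σ π ∧ W.cost σ π = w} (wstar X)) ∧
        (∀ B : ℝ, 0 ≤ B →
          (W.BoundedExpectedCost W.uniformFreq B ↔
            (∑ X ∈ W.arrangements, (X.card : ℝ) * (wstar X : ℝ)) /
              (∑ X ∈ W.arrangements, (X.card : ℝ)) ≤ B)) ∧
        (∀ B p : ℝ, 0 ≤ B → 0 ≤ p → p ≤ 1 →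
          (W.CompletesWithinBudget W.uniformFreq B p ↔
            p ≤ (∑ X ∈ W.arrangements with (wstar X : ℝ) ≤ B, (X.card : ℝ)) /
              (∑ X ∈ W.arrangements, (X.card : ℝ))))) ∧
    WSP.becWSP.SolvableInOStar WSP.CCWS.timeFactor ∧
    WSP.becWSP.IsFPT WSP.CCWS.parameter ∧
    WSP.approxBCWSP.SolvableInOStar WSP.CCWS.timeFactor ∧
    WSP.approxBCWSP.IsFPT WSP.CCWS.parameter :=
  ⟨fun _ _ _ _ _ _ _ _ _ W => WSP.arrangement_formulas W,
    WSP.becWSP_solvable, WSP.becWSP_solvable.isFPT,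
    WSP.approxBCWSP_solvable, WSP.approxBCWSP_solvable.isFPT⟩
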